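/- **Notation and conditions.** Write $\mathbb{C}_+=\{z:\Im z>0\}$, $F^\sharp(z)=\overline{F(\bar z)}$, and $(\mathsf{F}f)(z)=\int_{-\infty}^{\infty}f(x)e^{izx}\,dx$. Let $E$ be a function satisfying the following conditions. * (K1) There are $c>0$ and a closed discrete set $\mathcal{Z}\subset\mathbb{C}$, $0\notin\mathcal{Z}$, contained in the strip $-c\le\Im z\le c$ and closed under $z\mapsto\bar z$ and $z\mapsto -z$, such that $E$ is analytic and not identically zero on $\mathbb{C}\setminus\mathcal{Z}$ and $E^\sharp(z)=E(-z)$ for $z\in\mathbb{C}\setminus\mathcal{Z}$. * (K2) There is a real-valued continuous function $K$ on $\mathbb{R}$ with $|K(x)|\ll e^{c|x|}$ as $|x|\to\infty$ and $E^\sharp(z)/E(z)=(\mathsf{F}K)(z)$ for $\Im z>c$ (as an identity of meromorphic functions), with the same $c$. * (K3) $K(x)=0$ for $x<0$. * (K4) $K$ is continuously differentiable outside a discrete subset of $\mathbb{R}$ and $K'\in L^1_{\rm loc}(\mathbb{R})$. * (K5) There is $0<\tau\le\infty$ such that, for every $0\le t<\tau$, neither $1$ nor $-1$ is an eigenvalue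 of the operator $\mathsf{K}[t]:f(x)\mapsto \mathbf{1}_{(-\infty,t)}(x)\int_{-\infty}^tK(x+y)f(y)\,dy$ on $L^2(-\infty,t)$. For $t<\tau$ let $\Phi(t,\cdot)$ and $\Psi(t,\cdot)$ be the continuous real-valued solutions on $\mathbb{R}$ of $$\Phi(t,x)+\int_{-\infty}^tK(x+y)\Phi(t,y)\,dy=1,\qquad \Psi(t,x)-\int_{-\infty}^tK(x+y)\Psi(t,y)\,dy=1,$$ and let $A(t,\cdot),B(t,\cdot)$ be the analytic functions on $\mathbb{C}\setminus\mathcal{Z}$ which for $\Im z>c$ are given by $$A(t,z)=-\frac{iz}{2}E(z)\int_t^\infty\Psi(t,x)e^{izx}\,dx,\qquad -iB(t,z)=-\frac{iz}{2}E(z)\int_t^\infty\Phi(t,x)e^{izx}\,dx .$$ Say that $\Theta_E=E^\sharp/E$ is inner if, after removing removable singularities, it is a bounded analytic function on $\mathbb{C}_+$ with $\lim_{y\to0+}|\Theta_E(x+iy)|=1$ for almost every $x\in\mathbb{R}$. If $\Theta_E$ is inner, let $\mathsf{K}$ be the bounded operator on $L^2(\mathbb{R})$ that is the strong limit of $\mathsf{K}[s]$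 as $s\to\infty$, and for $t\ge0$ put $\mathcal{V}_t=L^2(t,\infty)\cap\mathsf{K}(L^2(t,\infty))$. The space $\mathsf{F}(\mathcal{V}_t)$, consisting of functions on $\mathbb{C}_+$, carries the inner product of the Hardy space $H^2(\mathbb{C}_+)$, i.e. $\langle F,G\rangle=\int_{\mathbb{R}}F(u)\overline{G(u)}\,du$ for the boundary values, equivalently $\lim_{v\to0+}\int_{\mathbb R}F(u+iv)\overline{G(u+iv)}\,du$. Its reproducing kernel $j(t;z,w)$ is the function on $\mathbb{C}_+\times\mathbb{C}_+$ with $j(t;z,\cdot)\in\mathsf{F}(\mathcal{V}_t)$ and $\langle F,j(t;z,\cdot)\rangle=F(z)$ for all $F\in\mathsf{F}(\mathcal{V}_t)$ and $z\in\mathbb{C}_+$. **Theorem 1.5.** 1. Assume that $E$ satisfies (K1)–(K5) and that $\Theta_E$ is inner. Then for every $0\le t<\tau$ the reproducing kernel $j(t;z,w)$ of $\mathsf{F}(\mathcal{V}_t)$ exists, $$j(t;z,w)=\frac{1}{\overline{E(z)}E(w)}\cdot\frac{\overline{A(t,z)}B(t,w)-A(t,w)\overline{B(t,z)}}{\pi(w-\bar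 z)}$$ for all $z,w\in\mathbb{C}_+\setminus\mathcal{Z}$ with $E(z)\ne0$ and $E(w)\neq0$, and $j(t;z,z)\not\equiv0$ as a function of $z\in\mathbb{C}_+$. 2. Assume that $E$ satisfies (K1)–(K5) with $\tau=\infty$. Then $\Theta_E$ is inner, the reproducing kernel $j(t;z,w)$ of $\mathsf{F}(\mathcal{V}_t)$ exists for every $t\ge0$, and $\lim_{t\to\infty}j(t;z,w)=0$ for all $z,w\in\mathbb{C}_+$. -/

import Mathlib

open Filter Topology MeasureTheory

noncomputable section

namespace CanonicalSystem

/-- `F♯(z) = conj (F (conj z))`. -/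
def sharp (F : ℂ → ℂ) (z : ℂ) : ℂ := star (F (star z))

/-- `Θ_E(z) = E♯(z) / E(z)`, to be used only where `E` is analytic and does not vanish. -/
def Theta (E : ℂ → ℂ) (z : ℂ) : ℂ := sharp E z / E z

/-- The Fourier integral `∫ f(x) e^{izx} dx` over the real line, at a complex point `z`. -/
def fourierInt (f : ℝ → ℂ) (z : ℂ) : ℂ :=
  ∫ x : ℝ, f x * Complex.exp (Complex.I * z * (x : ℂ))

/-- The operator `K[t]`:
`f ↦ 1_{(-∞,t)}(x) ∫_{-∞}^t K(x+y) f(y) dy`. -/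
def truncOp (K : ℝ → ℝ) (t : ℝ) (f : ℝ → ℂ) : ℝ → ℂ :=
  Set.indicator (Set.Iio t) (fun x => ∫ y in Set.Iio t, (K (x + y) : ℂ) * f y)

/-- `μ` is an eigenvalue of `K[t]` on `L²(-∞,t)`. -/
def TruncHasEigenvalue (K : ℝ → ℝ) (t : ℝ) (μ : ℂ) : Prop :=
  ∃ f : ℝ → ℂ, MemLp f 2 (volume.restrict (Set.Iio t)) ∧
    ¬ (f =ᵐ[volume.restrict (Set.Iio t)] 0) ∧
    truncOp K t f =ᵐ[volume.restrict (Set.Iio t)] fun x => μ * f x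

/-- Condition (K1), with its constant `c` and its exceptional set `Z`. The values of `E` on `Z`
are irrelevant. As `E♯ / E` is considered, `E` is not identically zero. -/
structure CondK1 (E : ℂ → ℂ) (c : ℝ) (Z : Set ℂ) : Prop where
  c_pos : 0 < c
  isClosed : IsClosed Z
  isDiscrete : IsDiscrete Z
  zero_notMem : (0 : ℂ) ∉ Z
  strip : ∀ z ∈ Z, |z.im| ≤ c
  conj_mem : ∀ z ∈ Z, star z ∈ Z
  neg_mem : ∀ z ∈ Z, -z ∈ Z
  analytic : AnalyticOnNhd ℂ E Zᶜ
  ne_zero : ∃ z, z ∉ Z ∧ E z ≠ 0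
  sharp_eq : ∀ z, z ∉ Z → sharp E z = E (-z)

/-- Condition (K2) for the function `K`, with the constant `c` of (K1). The identity
`E♯ / E = F K` is one of meromorphic functions in `Im z > c`: it is stated where `E z ≠ 0`. -/
structure CondK2 (E : ℂ → ℂ) (c : ℝ) (K : ℝ → ℝ) : Prop where
  continuous : Continuous K
  growth : K =O[cocompact ℝ] fun x => Real.exp (c * |x|)
  fourier : ∀ z : ℂ, c < z.im → E z ≠ 0 → Theta E z = fourierInt (fun x => (K x : ℂ)) z

/-- Condition (K3). -/
def CondK3 (K : ℝ → ℝ) : Prop := ∀ x < 0, K x = 0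

/-- Condition (K4): `K` is continuously differentiable outside a discrete set and `K'` is
locally integrable (a discrete set is countable, so the values of `deriv K` on it are irrelevant). -/
def CondK4 (K : ℝ → ℝ) : Prop :=
  (∃ Λ : Set ℝ, IsDiscrete Λ ∧ (∀ x, x ∉ Λ → DifferentiableAt ℝ K x) ∧
    ContinuousOn (deriv K) Λᶜ) ∧
  LocallyIntegrable (deriv K) volume

/-- Condition (K5) with its constant `τ ∈ (0,∞]`. -/
structure CondK5 (K : ℝ → ℝ) (τ : EReal) : Prop where
  tau_pos : 0 < τ
  not_eigenvalue : ∀ t : ℝ, 0 ≤ t → (t : EReal) < τ →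
    ¬ TruncHasEigenvalue K t 1 ∧ ¬ TruncHasEigenvalue K t (-1)

/-- Inner functions in the upper half-plane: bounded analytic, with vertical boundary values of
modulus one almost everywhere. -/
structure IsInner (θ : ℂ → ℂ) : Prop where
  analytic : AnalyticOnNhd ℂ θ {z | 0 < z.im}
  bounded : ∃ M : ℝ, ∀ z : ℂ, 0 < z.im → ‖θ z‖ ≤ M
  boundary : ∀ᵐ x : ℝ, Tendsto (fun y : ℝ => ‖θ ((x : ℂ) + (y : ℂ) * Complex.I)‖) (𝓝[>] 0) (𝓝 1)

/-- The function `Θ_E = E♯ / E`, after removal of removable singularities, is inner. -/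
def ThetaIsInner (E : ℂ → ℂ) (Z : Set ℂ) : Prop :=
  ∃ θ : ℂ → ℂ, IsInner θ ∧ ∀ z : ℂ, 0 < z.im → z ∉ Z → E z ≠ 0 → Theta E z = θ z

/-- `Φ` is a (continuous, real-valued) solution on the real line of
`Φ(x) + ε ∫_{-∞}^t K(x+y) Φ(y) dy = 1`. -/
def SolvesIntegralEq (K : ℝ → ℝ) (ε t : ℝ) (Φ : ℝ → ℝ) : Prop :=
  Continuous Φ ∧ ∀ x : ℝ, Φ x + ε * ∫ y in Set.Iio t, K (x + y) * Φ y = 1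

/-- `Φ(t,·)`, the solution of `Φ(t,x) + ∫_{-∞}^t K(x+y) Φ(t,y) dy = 1`. -/
def solPhi (K : ℝ → ℝ) (t : ℝ) : ℝ → ℝ := Classical.epsilon (SolvesIntegralEq K 1 t)

/-- `Ψ(t,·)`, the solution of `Ψ(t,x) - ∫_{-∞}^t K(x+y) Ψ(t,y) dy = 1`. -/
def solPsi (K : ℝ → ℝ) (t : ℝ) : ℝ → ℝ := Classical.epsilon (SolvesIntegralEq K (-1) t)

/-- The function `A(t,·)`: it is analytic on `ℂ \ Z`, and for `Im z > c` it is
`A(t,z) = -(iz/2) E(z) ∫_t^∞ Ψ(t,x) e^{izx} dx`. -/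
def solA (E : ℂ → ℂ) (c : ℝ) (Z : Set ℂ) (K : ℝ → ℝ) (t : ℝ) : ℂ → ℂ :=
  Classical.epsilon fun F : ℂ → ℂ => AnalyticOnNhd ℂ F Zᶜ ∧ ∀ z : ℂ, c < z.im →
    F z = -(Complex.I * z / 2) * E z *
      ∫ x in Set.Ioi t, (solPsi K t x : ℂ) * Complex.exp (Complex.I * z * (x : ℂ))

/-- The function `B(t,·)`: it is analytic on `ℂ \ Z`, and for `Im z > c` it is given by
`-i B(t,z) = -(iz/2) E(z) ∫_t^∞ Φ(t,x) e^{izx} dx`. -/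
def solB (E : ℂ → ℂ) (c : ℝ) (Z : Set ℂ) (K : ℝ → ℝ) (t : ℝ) : ℂ → ℂ :=
  Classical.epsilon fun F : ℂ → ℂ => AnalyticOnNhd ℂ F Zᶜ ∧ ∀ z : ℂ, c < z.im →
    -Complex.I * F z = -(Complex.I * z / 2) * E z *
      ∫ x in Set.Ioi t, (solPhi K t x : ℂ) * Complex.exp (Complex.I * z * (x : ℂ))

/-- The complex Hilbert space `L²(ℝ)`. -/
abbrev L2 : Type := Lp ℂ 2 (volume : Measure ℝ)

/-- `L²(t,∞)` as a subspace of `L²(ℝ)` (extension by zero). -/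
def L2Ioi (t : ℝ) : Submodule ℂ L2 where
  carrier := {f | ∀ᵐ x : ℝ, x < t → f x = 0}
  zero_mem' := by
    filter_upwards [Lp.coeFn_zero ℂ 2 (volume : Measure ℝ)] with x hx _
    simp [hx]
  add_mem' := by
    intro f g hf hg
    filter_upwards [hf, hg, Lp.coeFn_add f g] with x h1 h2 h3 hx
    rw [h3, Pi.add_apply, h1 hx, h2 hx, add_zero]
  smul_mem' := by
    intro a f hf
    filter_upwards [hf, Lp.coeFn_smul a f] with x h1 h2 hx
    rw [h2, Pi.smul_apply, h1 hx, smul_zero]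

/-- The bounded operator `T` on `L²(ℝ)` is the strong limit of `K[s]` as `s → ∞`. -/
def IsStrongLimit (K : ℝ → ℝ) (T : L2 →L[ℂ] L2) : Prop :=
  ∀ f : L2, Tendsto (fun s : ℝ => eLpNorm (fun x => truncOp K s f x - T f x) 2 volume)
    atTop (𝓝 0)

/-- The bounded operator `lim_{s → ∞} K[s]` on `L²(ℝ)`. -/
def hankelOp (K : ℝ → ℝ) : L2 →L[ℂ] L2 := Classical.epsilon (IsStrongLimit K)

/-- `V_t`, the intersection of `L²(t,∞)` with its image under the operator `lim_{s → ∞} K[s]`. -/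
def spaceV (K : ℝ → ℝ) (t : ℝ) : Submodule ℂ L2 :=
  L2Ioi t ⊓ (L2Ioi t).map (hankelOp K).toLinearMap

/-- The Fourier transforms of the elements of `V_t`, as functions in the upper half-plane.
(A function on the upper half-plane is represented by any of its extensions to `ℂ`.) -/
def fourierV (K : ℝ → ℝ) (t : ℝ) : Set (ℂ → ℂ) :=
  {F | ∃ f ∈ spaceV K t, ∀ z : ℂ, 0 < z.im → F z = fourierInt f z}

/-- `⟨F, G⟩ = l` in the Hardy space `H²` of the upper half-plane, whose inner product is
the `L²(ℝ)` inner product of boundary values, i.e.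
`⟨F, G⟩ = lim_{v → 0+} ∫ F(u+iv) conj(G(u+iv)) du`. -/
def HasHardyInner (F G : ℂ → ℂ) (l : ℂ) : Prop :=
  Tendsto (fun v : ℝ => ∫ u : ℝ, F ((u : ℂ) + (v : ℂ) * Complex.I) *
    star (G ((u : ℂ) + (v : ℂ) * Complex.I))) (𝓝[>] 0) (𝓝 l)

/-- `k` is the reproducing kernel of the space `H` of functions in the upper half-plane, with
the inner product of `H²`: `k(z,·) ∈ H` and `⟨F, k(z,·)⟩ = F(z)` for `F ∈ H`. -/
def IsReproducingKernel (H : Set (ℂ → ℂ)) (k : ℂ → ℂ → ℂ) : Prop :=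
  ∀ z : ℂ, 0 < z.im → k z ∈ H ∧ ∀ F ∈ H, HasHardyInner F (k z) (F z)

end CanonicalSystem

end

/-! Since K vanishes on the negative half-line, K[s] lives on the square (-s,s)², so it is a compact
self-adjoint operator on L²(ℝ) (`sqOp`) whose norm depends continuously on s. When Θ_E = θ is inner,
the Hankel integral T of kernel K(x+y) multiplies Fourier transforms by θ after reflection. Shifting
lines of integration down to the real axis, where |θ| = 1, shows that T is isometric
(`hankel_isometry_of_contDiff`). Being symmetric as well, T satisfies T² = 1, so V_t = {f ∈ L²(t,∞)
: Tf ∈ L²(t,∞)} is a closed subspace. Evaluation of Fourier transforms at z is the inner product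
with e_z = 1_{(t,∞)}(x) e^{-i z̄ x}, so the reproducing kernel exists: up to the factor 1/2π it
comes from the orthogonal projection of e_z to V_t.

For τ = ∞, a truncation of norm one would have an eigenvalue ±1. The norm starts from 0 at s = 0 and
is continuous, so it stays below one (`norm_sqOp_lt_one`). Testing the contractive limit operator on
exponentials gives |θ| ≤ 1 (`exists_contractive_symbol`), and |θ| = 1 almost everywhere on the real
line because |E(-x)| = |E(x)| there. The kernel tends to zero since ‖e_z‖ does.

For the formula, let m and n solve m = ε(K(·+t) + ∫_{-t}^t K(·+y) m(y) dy) with ε = 1 and ε = -1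
respectively. Then Φ and Ψ are multiples of 1 - ∫_t^x m and 1 - ∫_t^x n. Integration by parts
expresses A and B through the Fourier transforms M(w) (`moment`) of δ_t + 1_{(-t,t)} m and N(w) of
the same measure with n. Liouville's theorem gives the identity M(w)N(-w) + M(-w)N(w) = 2
(`moment_mul_add`). It makes the normalising constants of Φ and Ψ reciprocal, and it solves the 2×2
linear system that determines the projection of e_z explicitly (`kernelV_ae_eq`). A Fourier
transform then yields the formula for large imaginary parts, and analyticity with Hermitian symmetry
yields it in the whole half-plane. High on the imaginary axis the leading asymptotics show that the
diagonal kernel is not zero. -/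

open scoped FourierTransform ENNReal

noncomputable section

namespace CanonicalSystem

/-! ### Plancherel's theorem and Fourier integrals on horizontal lines -/

/-- The Fourier transform on `L²` is given by the Fourier integral on `L¹ ∩ L²`. -/
theorem fourier_toLp_ae {f : ℝ → ℂ} (hf1 : Integrable f) (hf : MemLp f 2) :
    (𝓕 (hf.toLp f) : Lp ℂ 2 (volume : Measure ℝ)) =ᵐ[volume] 𝓕 f := by
  have hcont : Continuous (𝓕 f) :=
    VectorFourier.fourierIntegral_continuous Real.continuous_fourierChar (innerSL ℝ).continuous₂ hf1
  apply ae_eq_of_integral_contDiff_smul_eq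
  · exact (Lp.memLp _).locallyIntegrable (by norm_num)
  · exact hcont.locallyIntegrable
  intro g hg hgc
  have hg₁ : HasCompactSupport (Complex.ofRealCLM ∘ g) := hgc.comp_left rfl
  have hg₂ : ContDiff ℝ ((⊤ : ℕ∞) : WithTop ℕ∞) (Complex.ofRealCLM ∘ g) := Complex.ofRealCLM.contDiff.comp hg
  set S := hg₁.toSchwartzMap hg₂ with hS
  have hSg : ∀ x, S x = (g x : ℂ) := fun x => rfl
  -- The two transforms are compared as tempered distributions: both satisfy the multiplication
  -- formula ∫ f̂ S = ∫ f Ŝ for the test function S.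
  have h1 := congrArg (fun D => D S) (Lp.fourier_toTemperedDistribution_eq (hf.toLp f))
  simp only [TemperedDistribution.fourier_apply, Lp.toTemperedDistribution_apply] at h1
  have h2 : ∫ x, (𝓕 f x) • S x = ∫ x, f x • 𝓕 (S : ℝ → ℂ) x := by
    have := VectorFourier.integral_fourierIntegral_smul_eq_flip (L := innerₗ ℝ) (μ := volume)
      (ν := volume) Real.continuous_fourierChar (innerSL ℝ).continuous₂ hf1 S.integrable
    rw [flip_innerₗ] at this
    exact this
  have h3 : ∫ x, (𝓕 S) x • (hf.toLp f) x = ∫ x, f x • 𝓕 (S : ℝ → ℂ) x := by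
    apply integral_congr_ae
    filter_upwards [hf.coeFn_toLp] with x hx
    rw [hx, smul_eq_mul, smul_eq_mul, mul_comm, SchwartzMap.fourier_coe]
  calc ∫ x, g x • (𝓕 (hf.toLp f) : Lp ℂ 2 (volume : Measure ℝ)) x
      = ∫ x, S x • (𝓕 (hf.toLp f) : Lp ℂ 2 (volume : Measure ℝ)) x := by
        refine integral_congr_ae (ae_of_all _ fun x => ?_)
        simp only [hSg, Complex.real_smul, smul_eq_mul]
    _ = ∫ x, (𝓕 f x) • S x := by rw [← h1, h3, h2]
    _ = _ := by
        refine integral_congr_ae (ae_of_all _ fun x => ?_)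
        simp only [hSg, Complex.real_smul, smul_eq_mul, mul_comm]

theorem memLp_fourier {f : ℝ → ℂ} (hf1 : Integrable f) (hf : MemLp f 2) : MemLp (𝓕 f) 2 :=
  (memLp_congr_ae (fourier_toLp_ae hf1 hf)).1 (Lp.memLp _)

theorem integral_fourier_mul_star {f g : ℝ → ℂ} (hf1 : Integrable f) (hf : MemLp f 2)
    (hg1 : Integrable g) (hg : MemLp g 2) :
    ∫ x, 𝓕 f x * star (𝓕 g x) = ∫ x, f x * star (g x) := by
  have h := Lp.inner_fourier_eq (hg.toLp g) (hf.toLp f)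
  rw [L2.inner_def, L2.inner_def] at h
  have e1 : ∫ x, 𝓕 f x * star (𝓕 g x) = ∫ x, inner ℂ
      ((𝓕 (hg.toLp g) : Lp ℂ 2 (volume : Measure ℝ)) x)
      ((𝓕 (hf.toLp f) : Lp ℂ 2 (volume : Measure ℝ)) x) := by
    apply integral_congr_ae
    filter_upwards [fourier_toLp_ae hf1 hf, fourier_toLp_ae hg1 hg] with x h1 h2
    rw [h1, h2]; simp
  have e2 : ∫ x, f x * star (g x) = ∫ x, inner ℂ ((hg.toLp g) x) ((hf.toLp f) x) := by
    apply integral_congr_ae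
    filter_upwards [hf.coeFn_toLp, hg.coeFn_toLp] with x h1 h2
    rw [h1, h2]; simp
  rw [e1, e2, h]

theorem norm_exp_I_mul (z : ℂ) (x : ℝ) :
    ‖Complex.exp (Complex.I * z * (x : ℂ))‖ = Real.exp (-z.im * x) := by
  rw [Complex.norm_exp]; congr 1; simp

/-- Mathlib's transform has the character e^{-2πixξ}, so e^{izx} at z = u + iv is the frequency
-u/2π with the damping e^{-vx} moved into the function. -/
theorem fourierInt_eq_fourier (f : ℝ → ℂ) (u v : ℝ) :
    fourierInt f ((u : ℂ) + (v : ℂ) * Complex.I) =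
      𝓕 (fun x : ℝ => f x * (Real.exp (-v * x) : ℂ)) ((-1 / (2 * Real.pi)) * u) := by
  rw [Real.fourier_real_eq_integral_exp_smul, fourierInt]
  refine integral_congr_ae (ae_of_all _ fun x => ?_)
  simp only [smul_eq_mul, Complex.ofReal_exp]
  rw [mul_comm (Complex.exp (_ * Complex.I)), mul_assoc (f x), ← Complex.exp_add]
  congr 2
  push_cast
  have := Real.pi_ne_zero
  field_simp
  linear_combination (-(u:ℂ) * 0 + v * x) * Complex.I_sq

/-- Plancherel's theorem on a horizontal line. -/
theorem integral_fourierInt_mul_star {f g : ℝ → ℂ} {v : ℝ}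
    (hf1 : Integrable fun x => f x * (Real.exp (-v * x) : ℂ))
    (hf : MemLp (fun x => f x * (Real.exp (-v * x) : ℂ)) 2)
    (hg1 : Integrable fun x => g x * (Real.exp (-v * x) : ℂ))
    (hg : MemLp (fun x => g x * (Real.exp (-v * x) : ℂ)) 2) :
    ∫ u : ℝ, fourierInt f ((u : ℂ) + (v : ℂ) * Complex.I) *
        star (fourierInt g ((u : ℂ) + (v : ℂ) * Complex.I)) =
      2 * Real.pi * ∫ x : ℝ, f x * star (g x) * (Real.exp (-(2 * v) * x) : ℂ) := by
  simp_rw [fourierInt_eq_fourier]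
  rw [Measure.integral_comp_mul_left (fun u => 𝓕 (fun x : ℝ => f x * (Real.exp (-v * x) : ℂ)) u *
    star (𝓕 (fun x : ℝ => g x * (Real.exp (-v * x) : ℂ)) u)), integral_fourier_mul_star hf1 hf hg1 hg]
  have : |(-1 / (2 * Real.pi))⁻¹| = 2 * Real.pi := by
    rw [inv_div, div_neg, div_one, abs_neg, abs_of_pos Real.two_pi_pos]
  rw [this, Complex.real_smul]
  push_cast
  congr 1
  refine integral_congr_ae (ae_of_all _ fun x => ?_)
  have e : Complex.exp (-(2 * v) * x) = Complex.exp (-v * x) * Complex.exp (-v * x) := by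
    rw [← Complex.exp_add]; ring_nf
  simp only [e, star_mul', Complex.star_def, ← Complex.exp_conj, map_mul, map_neg,
    Complex.conj_ofReal]
  ring

theorem fourierInt_congr {f g : ℝ → ℂ} (h : f =ᵐ[volume] g) (z : ℂ) :
    fourierInt f z = fourierInt g z := by
  refine integral_congr_ae ?_
  filter_upwards [h] with x hx
  rw [hx]

/-- The Fourier integral of `x ↦ ∫ K(x+y) f(y) dy`. -/
theorem fourierInt_hankel {k f : ℝ → ℂ} {w : ℂ}
    (hk : Integrable fun x : ℝ => k x * Complex.exp (Complex.I * w * x))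
    (hf : Integrable fun x : ℝ => f x * Complex.exp (Complex.I * (-w) * x)) :
    Integrable (fun x : ℝ => (∫ y, k (x + y) * f y) * Complex.exp (Complex.I * w * x)) ∧
      fourierInt (fun x => ∫ y, k (x + y) * f y) w = fourierInt k w * fourierInt f (-w) := by
  have hprod : Integrable (fun p : ℝ × ℝ => (k p.1 * Complex.exp (Complex.I * w * p.1)) *
    (f p.2 * Complex.exp (Complex.I * (-w) * p.2))) (volume.prod volume) := hk.mul_prod hf
  -- The shear (x,y) ↦ (x+y,y) preserves the measure and turns a product of two integrable functions
  -- into the double integrand, so Fubini applies.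
  have hmp : MeasurePreserving (fun p : ℝ × ℝ => (p.1 + p.2, p.2)) (volume.prod volume)
      (volume.prod volume) := by
    have := (measurePreserving_add_prod (volume : Measure ℝ) (volume : Measure ℝ))
    exact this
  have hshear := hmp.integrable_comp_of_integrable hprod
  have key : ∀ x y : ℝ, (k (x + y) * Complex.exp (Complex.I * w * ((x + y : ℝ) : ℂ))) *
      (f y * Complex.exp (Complex.I * (-w) * y)) =
      k (x + y) * f y * Complex.exp (Complex.I * w * x) := by
    intro x y
    have : Complex.exp (Complex.I * w * ((x + y : ℝ) : ℂ)) * Complex.exp (Complex.I * (-w) * y) =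
        Complex.exp (Complex.I * w * x) := by
      rw [← Complex.exp_add]; congr 1; push_cast; ring
    rw [← this]; ring
  refine ⟨hshear.integral_prod_left.congr (ae_of_all _ fun x => ?_), ?_⟩
  · simp only [Function.comp_apply, key, integral_mul_const]
  have e1 : fourierInt (fun x => ∫ y, k (x + y) * f y) w =
      ∫ x : ℝ, ∫ y : ℝ, (k (x + y) * Complex.exp (Complex.I * w * ((x + y : ℝ) : ℂ))) *
      (f y * Complex.exp (Complex.I * (-w) * y)) := by
    refine integral_congr_ae (ae_of_all _ fun x => ?_)
    simp only [key, integral_mul_const]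
  rw [e1, integral_integral_swap (f := fun x y : ℝ => (k (x + y) * Complex.exp (Complex.I * w *
    ((x + y : ℝ) : ℂ))) * (f y * Complex.exp (Complex.I * (-w) * y))) hshear]
  have e2 : ∀ y : ℝ, ∫ x : ℝ, (k (x + y) * Complex.exp (Complex.I * w * ((x + y : ℝ) : ℂ))) *
      (f y * Complex.exp (Complex.I * (-w) * y)) =
      fourierInt k w * (f y * Complex.exp (Complex.I * (-w) * y)) := by
    intro y
    rw [integral_mul_const]
    congr 1
    exact integral_add_right_eq_self (fun x : ℝ => k x * Complex.exp (Complex.I * w * (x : ℂ))) y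
  simp_rw [e2]
  rw [integral_const_mul]
  rfl

/-! ### Truncated Hankel operators: bounds, symmetry, compactness -/

theorem continuous_integral_translate_mul {k : ℝ → ℂ} (hk : Continuous k) {Y : Set ℝ}
    (hYb : Bornology.IsBounded Y) (hY : MeasurableSet Y) {f : ℝ → ℂ} (hf : IntegrableOn f Y) :
    Continuous fun x => ∫ y in Y, k (x + y) * f y := by
  obtain ⟨R, hR⟩ := hYb.subset_closedBall 0
  refine continuous_iff_continuousAt.2 fun x₀ => ?_
  obtain ⟨M, hM⟩ := (isCompact_closedBall (0 : ℝ) (|x₀| + 1 + R)).exists_bound_of_continuousOn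
    hk.continuousOn
  refine continuousAt_of_dominated (bound := fun y => M * ‖f y‖) ?_ ?_ ?_ ?_
  · refine Eventually.of_forall fun x => ?_
    exact (hk.comp (continuous_const.add continuous_id)).aestronglyMeasurable.mul hf.1
  · filter_upwards [Metric.ball_mem_nhds x₀ one_pos] with x hx
    filter_upwards [ae_restrict_mem hY] with y hy
    rw [norm_mul]
    refine mul_le_mul_of_nonneg_right (hM _ ?_) (norm_nonneg _)
    have h1 := hR hy
    simp only [Metric.mem_closedBall, dist_zero_right, Real.norm_eq_abs, Metric.mem_ball,
      Real.dist_eq] at h1 hx ⊢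
    have := abs_add_le x y
    have := abs_sub_abs_le_abs_sub x x₀
    linarith
  · exact hf.norm.const_mul M
  · refine ae_of_all _ fun y => ?_
    exact ((hk.comp (continuous_id.add continuous_const)).continuousAt).mul continuousAt_const

theorem setIntegral_norm_le {Y : Set ℝ} (hY : volume Y ≠ ∞) {f : ℝ → ℂ} (hf : MemLp f 2) :
    IntegrableOn f Y ∧
      ∫ y in Y, ‖f y‖ ≤ Real.sqrt (volume.real Y) * (eLpNorm f 2 volume).toReal := by
  have hfin : IsFiniteMeasure (volume.restrict Y) := ⟨by simpa using hY.lt_top⟩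
  have hint : IntegrableOn f Y := (hf.restrict Y).integrable (by norm_num)
  refine ⟨hint, ?_⟩
  rw [integral_norm_eq_lintegral_enorm hint.1, ← eLpNorm_one_eq_lintegral_enorm]
  have h1 := eLpNorm_le_eLpNorm_mul_rpow_measure_univ (μ := volume.restrict Y) (p := 1) (q := 2)
    (by norm_num) hint.1
  have h2 : eLpNorm f 2 (volume.restrict Y) ≤ eLpNorm f 2 volume :=
    eLpNorm_mono_measure _ Measure.restrict_le_self
  have h3 := h1.trans (mul_le_mul_left h2 _)
  have hne : eLpNorm f 2 volume * (volume.restrict Y) Set.univ ^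
      (1 / (1 : ℝ≥0∞).toReal - 1 / (2 : ℝ≥0∞).toReal) ≠ ∞ := by
    refine ENNReal.mul_ne_top hf.2.ne (ENNReal.rpow_ne_top_of_nonneg (by norm_num) ?_)
    simpa using hY
  refine (ENNReal.toReal_mono hne h3).trans (le_of_eq ?_)
  rw [ENNReal.toReal_mul, mul_comm, Measure.restrict_apply_univ, ← ENNReal.toReal_rpow,
    Real.sqrt_eq_rpow]
  norm_num [Measure.real]

/-- The function `1_X(x) ∫_Y k(x+y) f(y) dy`. -/
def rectFun (k : ℝ → ℝ) (X Y : Set ℝ) (f : ℝ → ℂ) : ℝ → ℂ :=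
  X.indicator fun x => ∫ y in Y, (k (x + y) : ℂ) * f y

/-- Cauchy–Schwarz in y and a supremum bound in x. The bound is linear in the supremum of the
kernel, for approximation of kernels, and carries the square roots of the side lengths, for
continuity in the truncation parameter. -/
theorem rectFun_bound {k : ℝ → ℝ} (hk : Continuous k) {X Y : Set ℝ}
    (hX : MeasurableSet X) (hY : MeasurableSet Y)
    (hXb : Bornology.IsBounded X) (hYb : Bornology.IsBounded Y) {M : ℝ}
    (hM : ∀ x ∈ X, ∀ y ∈ Y, |k (x + y)| ≤ M) {f : ℝ → ℂ} (hf : MemLp f 2) :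
    MemLp (rectFun k X Y f) 2 ∧ (eLpNorm (rectFun k X Y f) 2 volume).toReal ≤
      M * Real.sqrt (volume.real X) * Real.sqrt (volume.real Y) *
        (eLpNorm f 2 volume).toReal := by
  have hXf : volume X ≠ ∞ := hXb.measure_lt_top.ne
  have hYf : volume Y ≠ ∞ := hYb.measure_lt_top.ne
  obtain ⟨hint, hle⟩ := setIntegral_norm_le hYf hf
  have hfin : IsFiniteMeasure (volume.restrict X) := ⟨by simpa using hXf.lt_top⟩
  have hcont : Continuous fun x => ∫ y in Y, (k (x + y) : ℂ) * f y :=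
    continuous_integral_translate_mul (k := fun x => (k x : ℂ)) (by fun_prop) hYb hY hint
  have hbound : ∀ᵐ x ∂(volume.restrict X), ‖∫ y in Y, (k (x + y) : ℂ) * f y‖ ≤
      M * (Real.sqrt (volume.real Y) * (eLpNorm f 2 volume).toReal) := by
    filter_upwards [ae_restrict_mem hX] with x hx
    by_cases hne : Y.Nonempty
    · have hM0 : 0 ≤ M := by
        obtain ⟨y, hy⟩ := hne
        exact (abs_nonneg _).trans (hM x hx y hy)
      calc ‖∫ y in Y, (k (x + y) : ℂ) * f y‖ ≤ ∫ y in Y, M * ‖f y‖ := by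
            refine norm_integral_le_of_norm_le (hint.norm.const_mul M) ?_
            filter_upwards [ae_restrict_mem hY] with y hy
            rw [norm_mul, Complex.norm_real]
            exact mul_le_mul_of_nonneg_right (hM x hx y hy) (norm_nonneg _)
        _ = M * ∫ y in Y, ‖f y‖ := integral_const_mul _ _
        _ ≤ _ := mul_le_mul_of_nonneg_left hle hM0
    · rw [Set.not_nonempty_iff_eq_empty] at hne
      simp [hne]
  have hmem : MemLp (fun x => ∫ y in Y, (k (x + y) : ℂ) * f y) 2 (volume.restrict X) :=
    MemLp.of_bound hcont.aestronglyMeasurable _ hbound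
  refine ⟨(memLp_indicator_iff_restrict hX).2 hmem, ?_⟩
  rw [rectFun, eLpNorm_indicator_eq_eLpNorm_restrict hX]
  have h1 := eLpNorm_le_of_ae_bound (p := 2) hbound
  rcases X.eq_empty_or_nonempty with hXe | ⟨x, hx⟩
  · simp [hXe]
  rcases Y.eq_empty_or_nonempty with hYe | ⟨y, hy⟩
  · simp [hYe]
  have hM0 : 0 ≤ M := (abs_nonneg _).trans (hM x hx y hy)
  refine (ENNReal.toReal_mono ?_ h1).trans (le_of_eq ?_)
  · refine ENNReal.mul_ne_top (ENNReal.rpow_ne_top_of_nonneg (by norm_num) ?_) ENNReal.ofReal_ne_top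
    simpa using hXf
  · rw [ENNReal.toReal_mul, ENNReal.toReal_ofReal (by positivity), Measure.restrict_apply_univ,
      ← ENNReal.toReal_rpow, Real.sqrt_eq_rpow (volume.real X)]
    norm_num [Measure.real]
    ring

theorem exists_bound_square (k : C(ℝ, ℝ)) (s : ℝ) :
    ∃ M : ℝ, 0 ≤ M ∧ ∀ x ∈ Set.Ioo (-s) s, ∀ y ∈ Set.Ioo (-s) s, |k (x + y)| ≤ M := by
  obtain ⟨M, hM⟩ := (isCompact_Icc (a := -(2 * s)) (b := 2 * s)).exists_bound_of_continuousOn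
    k.continuous.continuousOn
  refine ⟨max M 0, le_max_right _ _, fun x hx y hy => (hM _ ?_).trans (le_max_left _ _)⟩
  constructor <;> linarith [hx.1, hx.2, hy.1, hy.2]

theorem memLp_rectFun (k : C(ℝ, ℝ)) (s : ℝ) (f : L2) :
    MemLp (rectFun k (Set.Ioo (-s) s) (Set.Ioo (-s) s) f) 2 := by
  obtain ⟨M, -, hM⟩ := exists_bound_square k s
  exact (rectFun_bound k.continuous measurableSet_Ioo measurableSet_Ioo
    (Metric.isBounded_Ioo _ _) (Metric.isBounded_Ioo _ _) hM (Lp.memLp f)).1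

theorem integrableOn_translate_mul (k : C(ℝ, ℝ)) (s x : ℝ) {f : ℝ → ℂ} (hf : MemLp f 2) :
    IntegrableOn (fun y => (k (x + y) : ℂ) * f y) (Set.Ioo (-s) s) := by
  have hint := (setIntegral_norm_le (Y := Set.Icc (-s) s) (by simp) hf).1
  refine IntegrableOn.mono_set ?_ Set.Ioo_subset_Icc_self
  exact hint.continuousOn_mul (by fun_prop) isCompact_Icc

/-- The operator `f ↦ 1_{(-s,s)}(x) ∫_{-s}^s k(x+y) f(y) dy` on `L²(ℝ)`. -/
def sqOp (k : C(ℝ, ℝ)) (s : ℝ) : L2 →L[ℂ] L2 :=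
  LinearMap.mkContinuous
    { toFun := fun f => (memLp_rectFun k s f).toLp _
      map_add' := by
        intro f g
        apply Lp.ext
        refine (MemLp.coeFn_toLp _).trans ?_
        filter_upwards [Lp.coeFn_add ((memLp_rectFun k s f).toLp _) ((memLp_rectFun k s g).toLp _),
          MemLp.coeFn_toLp (memLp_rectFun k s f), MemLp.coeFn_toLp (memLp_rectFun k s g)]
          with x h1 h2 h3
        rw [h1, Pi.add_apply, h2, h3]
        by_cases hx : x ∈ Set.Ioo (-s) s
        · simp only [rectFun, Set.indicator_of_mem hx]
          rw [← integral_add (integrableOn_translate_mul k s x (Lp.memLp f))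
            (integrableOn_translate_mul k s x (Lp.memLp g))]
          refine integral_congr_ae ?_
          filter_upwards [ae_restrict_of_ae (Lp.coeFn_add f g)] with y hy
          rw [hy, Pi.add_apply, mul_add]
        · simp [rectFun, Set.indicator_of_notMem hx]
      map_smul' := by
        intro a f
        apply Lp.ext
        refine (MemLp.coeFn_toLp _).trans ?_
        filter_upwards [Lp.coeFn_smul a ((memLp_rectFun k s f).toLp _),
          MemLp.coeFn_toLp (memLp_rectFun k s f)] with x h1 h2
        rw [RingHom.id_apply, h1, Pi.smul_apply, h2]
        by_cases hx : x ∈ Set.Ioo (-s) s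
        · simp only [rectFun, Set.indicator_of_mem hx, smul_eq_mul]
          rw [← integral_const_mul]
          refine integral_congr_ae ?_
          filter_upwards [ae_restrict_of_ae (Lp.coeFn_smul a f)] with y hy
          rw [hy, Pi.smul_apply, smul_eq_mul]
          ring
        · simp [rectFun, Set.indicator_of_notMem hx] }
    ((exists_bound_square k s).choose * Real.sqrt (volume.real (Set.Ioo (-s) s)) *
      Real.sqrt (volume.real (Set.Ioo (-s) s)))
    (by
      intro f
      have hM := (exists_bound_square k s).choose_spec.2
      have := (rectFun_bound k.continuous measurableSet_Ioo measurableSet_Ioo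
        (Metric.isBounded_Ioo _ _) (Metric.isBounded_Ioo _ _) hM (Lp.memLp f)).2
      rw [Lp.norm_def f]
      refine le_trans (le_of_eq ?_) this
      exact Lp.norm_toLp _ (memLp_rectFun k s f))

theorem sqOp_coeFn (k : C(ℝ, ℝ)) (s : ℝ) (f : L2) :
    sqOp k s f =ᵐ[volume] rectFun k (Set.Ioo (-s) s) (Set.Ioo (-s) s) f :=
  MemLp.coeFn_toLp (memLp_rectFun k s f)

theorem norm_sqOp_le (k : C(ℝ, ℝ)) {s M : ℝ} (hs : 0 ≤ s) (hM0 : 0 ≤ M)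
    (hM : ∀ x ∈ Set.Ioo (-s) s, ∀ y ∈ Set.Ioo (-s) s, |k (x + y)| ≤ M) :
    ‖sqOp k s‖ ≤ M * (2 * s) := by
  refine ContinuousLinearMap.opNorm_le_bound _ (by positivity) fun f => ?_
  have := (rectFun_bound k.continuous measurableSet_Ioo measurableSet_Ioo
        (Metric.isBounded_Ioo _ _) (Metric.isBounded_Ioo _ _) hM (Lp.memLp f)).2
  rw [Lp.norm_def f, Lp.norm_def, eLpNorm_congr_ae (sqOp_coeFn k s f)]
  refine this.trans (le_of_eq ?_)
  rw [mul_assoc M, Real.mul_self_sqrt (by positivity), Real.volume_real_Ioo_of_le (by linarith)]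
  ring

/-- The kernel k(x+y) is real and symmetric in x and y; the rest is Fubini on a bounded square. -/
theorem inner_sqOp (k : C(ℝ, ℝ)) (s : ℝ) (f g : L2) :
    inner ℂ (sqOp k s f) g = inner ℂ f (sqOp k s g) := by
  rw [L2.inner_def, L2.inner_def]
  have hf := (setIntegral_norm_le (Y := Set.Ioo (-s) s) (by simp) (Lp.memLp f)).1
  have hg := (setIntegral_norm_le (Y := Set.Ioo (-s) s) (by simp) (Lp.memLp g)).1
  obtain ⟨M, hM0, hM⟩ := exists_bound_square k s
  have e1 : ∫ x, inner ℂ (sqOp k s f x) (g x) =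
      ∫ x in Set.Ioo (-s) s, ∫ y in Set.Ioo (-s) s, (k (x + y) : ℂ) * (star (f y) * g x) := by
    rw [← integral_indicator measurableSet_Ioo]
    refine integral_congr_ae ?_
    filter_upwards [sqOp_coeFn k s f] with x hx
    rw [hx, rectFun]
    by_cases h : x ∈ Set.Ioo (-s) s
    · simp only [Set.indicator_of_mem h, RCLike.inner_apply]
      rw [← integral_conj, ← integral_const_mul]
      refine integral_congr_ae (ae_of_all _ fun y => ?_)
      simp only [map_mul, Complex.conj_ofReal, Complex.star_def]
      ring
    · simp [Set.indicator_of_notMem h]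
  have e2 : ∫ x, inner ℂ (f x) (sqOp k s g x) =
      ∫ x in Set.Ioo (-s) s, ∫ y in Set.Ioo (-s) s, (k (y + x) : ℂ) * (star (f x) * g y) := by
    rw [← integral_indicator measurableSet_Ioo]
    refine integral_congr_ae ?_
    filter_upwards [sqOp_coeFn k s g] with x hx
    rw [hx, rectFun]
    by_cases h : x ∈ Set.Ioo (-s) s
    · simp only [Set.indicator_of_mem h, RCLike.inner_apply]
      rw [← integral_mul_const]
      refine integral_congr_ae (ae_of_all _ fun y => ?_)
      simp only [Complex.star_def, add_comm x y]
      ring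
    · simp [Set.indicator_of_notMem h]
  rw [e1, e2, integral_integral_swap]
  have hfs : IntegrableOn (fun y => star (f y)) (Set.Ioo (-s) s) :=
    (LinearIsometryEquiv.integrable_comp_iff Complex.conjLIE).2 hf
  have hp := hg.mul_prod hfs
  refine Integrable.mono' (hp.norm.const_mul M) ?_ ?_
  · refine AEStronglyMeasurable.mul ?_ ?_
    · exact Continuous.aestronglyMeasurable (by fun_prop)
    · refine hp.1.congr (ae_of_all _ fun p => ?_)
      exact mul_comm _ _
  · rw [Measure.prod_restrict]
    filter_upwards [ae_restrict_mem (measurableSet_Ioo.prod measurableSet_Ioo)] with p hp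
    simp only [Function.uncurry, norm_mul, Complex.norm_real]
    rw [mul_comm ‖g p.1‖]
    exact mul_le_mul_of_nonneg_right (hM _ hp.1 _ hp.2) (by positivity)

theorem coeFn_sum {ι : Type*} (S : Finset ι) (g : ι → L2) :
    ⇑(∑ i ∈ S, g i) =ᵐ[volume] fun x => ∑ i ∈ S, g i x := by
  classical
  induction S using Finset.induction_on with
  | empty =>
    filter_upwards [Lp.coeFn_zero ℂ 2 (volume : Measure ℝ)] with x hx
    simp only [Finset.sum_empty, hx, Pi.zero_apply]
  | insert i S hi ih =>
    rw [Finset.sum_insert hi]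
    filter_upwards [Lp.coeFn_add (g i) (∑ i ∈ S, g i), ih] with x h1 h2
    rw [h1, Pi.add_apply, h2, Finset.sum_insert hi]

theorem isCompactOperator_of_forall_mem {A : L2 →L[ℂ] L2} {W : Submodule ℂ L2}
    [FiniteDimensional ℂ W] (h : ∀ f, A f ∈ W) : IsCompactOperator A := by
  have h1 : IsCompactOperator (fun f : L2 => A.codRestrict W h f) := by
    have : LocallyCompactSpace W := .of_finiteDimensional_of_complete ℂ W
    exact isCompactOperator_of_locallyCompactSpace_dom (A.codRestrict W h)
  exact h1.clm_comp W.subtypeL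

theorem sqOp_sub (k l : C(ℝ, ℝ)) (s : ℝ) : sqOp k s - sqOp l s = sqOp (k - l) s := by
  ext1 f
  apply Lp.ext
  rw [sub_apply]
  filter_upwards [Lp.coeFn_sub (sqOp k s f) (sqOp l s f), sqOp_coeFn k s f, sqOp_coeFn l s f,
    sqOp_coeFn (k - l) s f] with x h1 h2 h3 h4
  rw [h1, Pi.sub_apply, h2, h3, h4]
  by_cases hx : x ∈ Set.Ioo (-s) s
  · simp only [rectFun, Set.indicator_of_mem hx]
    rw [← integral_sub (integrableOn_translate_mul k s x (Lp.memLp f))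
      (integrableOn_translate_mul l s x (Lp.memLp f))]
    refine integral_congr_ae (ae_of_all _ fun y => ?_)
    simp only [ContinuousMap.sub_apply]
    push_cast
    ring
  · simp [rectFun, Set.indicator_of_notMem hx]

theorem memLp_indicator_pow (s : ℝ) (i : ℕ) :
    MemLp ((Set.Ioo (-s) s).indicator fun x : ℝ => (x : ℂ) ^ i) 2 (volume : Measure ℝ) := by
  rw [memLp_indicator_iff_restrict measurableSet_Ioo]
  refine MemLp.of_bound (by fun_prop) (|s| ^ i) ?_
  filter_upwards [ae_restrict_mem measurableSet_Ioo] with x hx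
  rw [norm_pow, Complex.norm_real]
  refine pow_le_pow_left₀ (norm_nonneg _) ?_ _
  exact (abs_le.2 ⟨hx.1.le, hx.2.le⟩).trans (le_abs_self s)

/-- Taylor's formula p(x+y) = Σ (D_i p)(y) x^i, with Hasse derivatives D_i, makes the kernel
degenerate, so the range is spanned by finitely many truncated monomials. -/
theorem isCompactOperator_sqOp_polynomial (p : Polynomial ℝ) (s : ℝ) :
    IsCompactOperator (sqOp (Polynomial.toContinuousMap p) s) := by
  set v : Fin (p.natDegree + 1) → L2 := fun i => (memLp_indicator_pow s i).toLp _ with hv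
  have : FiniteDimensional ℂ (Submodule.span ℂ (Set.range v)) :=
    FiniteDimensional.span_of_finite ℂ (Set.finite_range v)
  refine isCompactOperator_of_forall_mem (W := Submodule.span ℂ (Set.range v)) fun f => ?_
  have key : sqOp (Polynomial.toContinuousMap p) s f = ∑ i : Fin (p.natDegree + 1),
      (∫ y in Set.Ioo (-s) s, (((Polynomial.hasseDeriv i p).eval y : ℝ) : ℂ) * f y) • v i := by
    apply Lp.ext
    have hall : ∀ᵐ x : ℝ, ∀ i : Fin (p.natDegree + 1), v i x = (Set.Ioo (-s) s).indicator (fun x : ℝ => (x : ℂ) ^ (i : ℕ)) x :=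
      ae_all_iff.2 fun i => (memLp_indicator_pow s i).coeFn_toLp
    have hall2 : ∀ᵐ x : ℝ, ∀ i : Fin (p.natDegree + 1), ((∫ y in Set.Ioo (-s) s,
        (((Polynomial.hasseDeriv i p).eval y : ℝ) : ℂ) * f y) • v i : L2) x =
        (∫ y in Set.Ioo (-s) s, (((Polynomial.hasseDeriv i p).eval y : ℝ) : ℂ) * f y) * v i x :=
      ae_all_iff.2 fun i => Lp.coeFn_smul _ _
    filter_upwards [sqOp_coeFn (Polynomial.toContinuousMap p) s f, hall, hall2,
      coeFn_sum Finset.univ fun i : Fin (p.natDegree + 1) =>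
      ((∫ y in Set.Ioo (-s) s, (((Polynomial.hasseDeriv i p).eval y : ℝ) : ℂ) * f y) • v i)]
      with x h1 h2 h3 h4
    rw [h1, h4]
    simp only [h3, h2]
    by_cases hx : x ∈ Set.Ioo (-s) s
    · simp only [rectFun, Set.indicator_of_mem hx]
      have e : ∀ y : ℝ, (((Polynomial.toContinuousMap p) (x + y) : ℝ) : ℂ) * f y =
          ∑ i : Fin (p.natDegree + 1),
            ((((Polynomial.hasseDeriv i p).eval y : ℝ) : ℂ) * f y) * (x : ℂ) ^ (i : ℕ) := by
        intro y
        have : (Polynomial.toContinuousMap p) (x + y) =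
            ∑ i : Fin (p.natDegree + 1), (Polynomial.hasseDeriv i p).eval y * x ^ (i : ℕ) := by
          rw [Polynomial.toContinuousMap_apply, ← Polynomial.taylor_eval,
            Polynomial.eval_eq_sum_range, Polynomial.natDegree_taylor, Finset.sum_range]
          simp only [Polynomial.taylor_coeff]
        rw [this]
        push_cast
        rw [Finset.sum_mul]
        refine Finset.sum_congr rfl fun i _ => ?_
        ring
      simp_rw [e]
      rw [integral_finsetSum]
      · simp_rw [integral_mul_const]
      · intro i _
        have h := integrableOn_translate_mul
          (Polynomial.toContinuousMap (Polynomial.hasseDeriv i p)) s 0 (Lp.memLp f)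
        simp only [zero_add, Polynomial.toContinuousMap_apply] at h
        exact h.mul_const _
    · simp [rectFun, Set.indicator_of_notMem hx]
  rw [key]
  exact Submodule.sum_mem _ fun i _ =>
    Submodule.smul_mem _ _ (Submodule.subset_span (Set.mem_range_self i))

/-- Weierstrass approximation on [-2s,2s], where x+y ranges, exhibits the operator as a norm limit
of finite-rank ones. The tolerance ε/(2s+1) remains below ε after multiplication by the side length
2s. -/
theorem isCompactOperator_sqOp (k : C(ℝ, ℝ)) {s : ℝ} (hs : 0 ≤ s) : IsCompactOperator (sqOp k s) := by
  have hcl : IsClosed {A : L2 →L[ℂ] L2 | IsCompactOperator A} := isClosed_setOfPred_isCompactOperator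
  refine hcl.closure_subset (Metric.mem_closure_iff.2 fun ε hε => ?_)
  obtain ⟨p, hp⟩ := exists_polynomial_near_of_continuousOn (-(2 * s)) (2 * s) k
    k.continuous.continuousOn (ε / (2 * s + 1)) (by positivity)
  refine ⟨_, isCompactOperator_sqOp_polynomial p s, ?_⟩
  rw [dist_eq_norm, sqOp_sub]
  refine (norm_sqOp_le (M := ε / (2 * s + 1)) _ hs (by positivity) fun x hx y hy => ?_).trans_lt ?_
  · have := hp (x + y) ⟨by linarith [hx.1, hy.1], by linarith [hx.2, hy.2]⟩
    rw [abs_sub_comm] at this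
    exact this.le
  · rw [div_mul_eq_mul_div, div_lt_iff₀ (by positivity)]
    nlinarith

/-! ### Spectrum and norm of the truncations -/

theorem isSelfAdjoint_sqOp (k : C(ℝ, ℝ)) (s : ℝ) : IsSelfAdjoint (sqOp k s) := by
  rw [ContinuousLinearMap.isSelfAdjoint_iff_isSymmetric]
  exact fun f g => inner_sqOp k s f g

/-- For a self-adjoint operator the norm is the spectral radius, so the real spectrum contains 1 or
-1; compactness makes a nonzero spectral point an eigenvalue. -/
theorem hasEigenvalue_of_norm_eq_one (k : C(ℝ, ℝ)) {s : ℝ} (hs : 0 ≤ s) (h : ‖sqOp k s‖ = 1) :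
    Module.End.HasEigenvalue (sqOp k s : Module.End ℂ L2) 1 ∨
      Module.End.HasEigenvalue (sqOp k s : Module.End ℂ L2) (-1) := by
  have hnt : Nontrivial L2 := by
    by_contra hc
    rw [not_nontrivial_iff_subsingleton] at hc
    have : sqOp k s = 0 := Subsingleton.elim _ _
    rw [this, norm_zero] at h
    exact zero_ne_one h
  obtain ⟨μ, hμ, hμn⟩ := spectrum.exists_nnnorm_eq_spectralRadius (sqOp k s)
  rw [(isSelfAdjoint_sqOp k s).spectralRadius_eq_nnnorm] at hμn
  have hμ1 : ‖μ‖ = 1 := by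
    have : ‖μ‖₊ = ‖sqOp k s‖₊ := by exact_mod_cast hμn
    rw [← coe_nnnorm, this, coe_nnnorm, h]
  have hre := (isSelfAdjoint_sqOp k s).mem_spectrum_eq_re hμ
  have hμ0 : μ ≠ 0 := by
    rintro rfl
    simp at hμ1
  have he := ((isCompactOperator_sqOp k hs).hasEigenvalue_iff_mem_spectrum hμ0).2 hμ
  rw [hre] at hμ1
  rw [Complex.norm_real, Real.norm_eq_abs] at hμ1
  rcases (abs_eq zero_le_one).1 hμ1 with h1 | h1
  · left
    rw [hre, h1] at he
    simpa using he
  · right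
    rw [hre, h1] at he
    simpa using he

/-- For a kernel vanishing on the negative half-line, `K[s]` lives on `(-s,s)`. -/
theorem truncOp_eq_rectFun {K : ℝ → ℝ} (h3 : CondK3 K) (s : ℝ) (f : ℝ → ℂ) :
    truncOp K s f = rectFun K (Set.Ioo (-s) s) (Set.Ioo (-s) s) f := by
  ext x
  by_cases hx : x ∈ Set.Ioo (-s) s
  · rw [truncOp, rectFun, Set.indicator_of_mem hx, Set.indicator_of_mem (show x ∈ Set.Iio s from hx.2)]
    refine setIntegral_eq_of_subset_of_forall_sdiff_eq_zero measurableSet_Iio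
      (fun y hy => hy.2) fun y hy => ?_
    have hy1 : y ≤ -s := by
      by_contra hc
      exact hy.2 ⟨not_le.1 hc, hy.1⟩
    rw [h3 _ (by linarith [hx.2])]
    simp
  · rw [rectFun, Set.indicator_of_notMem hx, truncOp]
    by_cases hx2 : x ∈ Set.Iio s
    · rw [Set.indicator_of_mem hx2]
      have hx3 : x ≤ -s := by
        by_contra hc
        exact hx ⟨not_le.1 hc, hx2⟩
      refine setIntegral_eq_zero_of_forall_eq_zero fun y hy => ?_
      rw [h3 _ (by linarith [hy.out])]
      simp
    · rw [Set.indicator_of_notMem hx2]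

theorem truncOp_ae_eq {k : C(ℝ, ℝ)} (h3 : CondK3 k) (s : ℝ) (f : L2) :
    truncOp k s f =ᵐ[volume] sqOp k s f := by
  rw [truncOp_eq_rectFun h3]
  exact (sqOp_coeFn k s f).symm

theorem truncHasEigenvalue_of_hasEigenvalue {k : C(ℝ, ℝ)} (h3 : CondK3 k) {s : ℝ} {μ : ℂ}
    (hμ : μ ≠ 0) (h : Module.End.HasEigenvalue (sqOp k s : Module.End ℂ L2) μ) :
    TruncHasEigenvalue k s μ := by
  obtain ⟨f, hf⟩ := h.exists_hasEigenvector
  have hf1 : sqOp k s f = μ • f := hf.apply_eq_smul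
  refine ⟨f, (Lp.memLp f).restrict _, fun hc => hf.2 ?_, ?_⟩
  -- An eigenvector in L²(ℝ) cannot vanish on (-∞,s): K[s] sees only that part, and μ ≠ 0.
  · have h0 : sqOp k s f = 0 := by
      apply Lp.ext
      filter_upwards [truncOp_ae_eq h3 s f, Lp.coeFn_zero ℂ 2 (volume : Measure ℝ)] with x h1 h2
      rw [h2, ← h1, truncOp, Pi.zero_apply]
      refine Set.indicator_apply_eq_zero.2 fun _ => ?_
      rw [integral_congr_ae (g := fun _ => 0), integral_zero]
      filter_upwards [hc] with y hy
      rw [hy, Pi.zero_apply, mul_zero]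
    rw [h0] at hf1
    exact (smul_eq_zero.1 hf1.symm).resolve_left hμ
  · refine ae_restrict_of_ae ?_
    filter_upwards [truncOp_ae_eq h3 s f, Lp.coeFn_smul μ f] with x h1 h2
    rw [h1, hf1, h2, Pi.smul_apply, smul_eq_mul]

/-- The region between the squares of half-sides r and s splits into D × (-s,s) and (-r,r) × D,
where D = (-s,s) \ (-r,r) has measure 2(s - r). Each piece is small by `rectFun_bound`. -/
theorem norm_sqOp_sub_sqOp_le (k : C(ℝ, ℝ)) {S M : ℝ} (hM0 : 0 ≤ M)
    (hM : ∀ x ∈ Set.Ioo (-S) S, ∀ y ∈ Set.Ioo (-S) S, |k (x + y)| ≤ M) {r s : ℝ} (hr : 0 ≤ r)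
    (hrs : r ≤ s) (hs : s ≤ S) :
    ‖sqOp k s - sqOp k r‖ ≤ 2 * M * Real.sqrt (2 * S) * Real.sqrt (2 * (s - r)) := by
  refine ContinuousLinearMap.opNorm_le_bound _ (by positivity) fun f => ?_
  have hsub : Set.Ioo (-r) r ⊆ Set.Ioo (-s) s := Set.Ioo_subset_Ioo (by linarith) hrs
  have hsubS : Set.Ioo (-s) s ⊆ Set.Ioo (-S) S := Set.Ioo_subset_Ioo (by linarith) hs
  set D := Set.Ioo (-s) s \ Set.Ioo (-r) r with hD
  have hDm : MeasurableSet D := measurableSet_Ioo.diff measurableSet_Ioo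
  have hDb : Bornology.IsBounded D := (Metric.isBounded_Ioo (-s) s).subset Set.sdiff_subset
  have hDv : volume.real D = 2 * (s - r) := by
    rw [hD, measureReal_sdiff hsub measurableSet_Ioo (by simp), Real.volume_real_Ioo_of_le (by linarith),
      Real.volume_real_Ioo_of_le (by linarith)]
    ring
  have b1 := rectFun_bound k.continuous hDm measurableSet_Ioo hDb (Metric.isBounded_Ioo (-s) s)
    (M := M) (fun x hx y hy => hM x (hsubS hx.1) y (hsubS hy)) (Lp.memLp f)
  have b2 := rectFun_bound k.continuous measurableSet_Ioo hDm (Metric.isBounded_Ioo (-r) r) hDb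
    (M := M) (fun x hx y hy => hM x (hsubS (hsub hx)) y (hsubS hy.1)) (Lp.memLp f)
  have e : (sqOp k s - sqOp k r) f = b1.1.toLp _ + b2.1.toLp _ := by
    apply Lp.ext
    rw [sub_apply]
    filter_upwards [Lp.coeFn_sub (sqOp k s f) (sqOp k r f), sqOp_coeFn k s f, sqOp_coeFn k r f,
      Lp.coeFn_add (b1.1.toLp _) (b2.1.toLp _), b1.1.coeFn_toLp, b2.1.coeFn_toLp]
      with x h1 h2 h3 h4 h5 h6
    rw [h1, Pi.sub_apply, h2, h3, h4, Pi.add_apply, h5, h6]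
    by_cases hx : x ∈ Set.Ioo (-s) s
    · by_cases hx2 : x ∈ Set.Ioo (-r) r
      · have hx3 : x ∉ D := fun hc => hc.2 hx2
        simp only [rectFun, Set.indicator_of_mem hx, Set.indicator_of_mem hx2,
          Set.indicator_of_notMem hx3, zero_add]
        rw [hD, setIntegral_sdiff measurableSet_Ioo
          (integrableOn_translate_mul k s x (Lp.memLp f)) hsub]
      · have hx3 : x ∈ D := ⟨hx, hx2⟩
        simp only [rectFun, Set.indicator_of_mem hx, Set.indicator_of_notMem hx2,
          Set.indicator_of_mem hx3, sub_zero, add_zero]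
    · have hx2 : x ∉ Set.Ioo (-r) r := fun hc => hx (hsub hc)
      have hx3 : x ∉ D := fun hc => hx hc.1
      simp only [rectFun, Set.indicator_of_notMem hx, Set.indicator_of_notMem hx2,
          Set.indicator_of_notMem hx3, sub_zero, add_zero]
  rw [e]
  refine (norm_add_le _ _).trans ?_
  rw [Lp.norm_toLp, Lp.norm_toLp, Lp.norm_def]
  refine (add_le_add b1.2 b2.2).trans ?_
  rw [hDv, Real.volume_real_Ioo_of_le (by linarith), Real.volume_real_Ioo_of_le (by linarith)]
  have q1 : Real.sqrt (s - -s) ≤ Real.sqrt (2 * S) := Real.sqrt_le_sqrt (by linarith)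
  have q2 : Real.sqrt (r - -r) ≤ Real.sqrt (2 * S) := Real.sqrt_le_sqrt (by linarith)
  have q3 : 0 ≤ M * Real.sqrt (2 * (s - r)) * (eLpNorm f 2 volume).toReal := by positivity
  nlinarith [mul_le_mul_of_nonneg_left q1 q3, mul_le_mul_of_nonneg_left q2 q3]

theorem continuousOn_norm_sqOp (k : C(ℝ, ℝ)) (S : ℝ) :
    ContinuousOn (fun s => ‖sqOp k s‖) (Set.Icc 0 S) := by
  obtain ⟨M, hM0, hM⟩ := exists_bound_square k S
  intro r hr
  rw [ContinuousWithinAt, tendsto_iff_norm_sub_tendsto_zero]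
  have hlim : Tendsto (fun s => 2 * M * Real.sqrt (2 * S) * Real.sqrt (2 * |s - r|))
      (𝓝[Set.Icc 0 S] r) (𝓝 0) := by
    have : Continuous fun s => 2 * M * Real.sqrt (2 * S) * Real.sqrt (2 * |s - r|) := by fun_prop
    have h := (this.tendsto r).mono_left (nhdsWithin_le_nhds (s := Set.Icc 0 S))
    simpa using h
  refine squeeze_zero' (Eventually.of_forall fun _ => norm_nonneg _) ?_ hlim
  filter_upwards [self_mem_nhdsWithin] with s hs
  refine (abs_norm_sub_norm_le _ _).trans ?_
  rcases le_total r s with h | h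
  · rw [abs_of_nonneg (by linarith)]
    exact norm_sqOp_sub_sqOp_le k hM0 hM hr.1 h hs.2
  · rw [abs_of_nonpos (by linarith), norm_sub_rev, neg_sub]
    exact norm_sqOp_sub_sqOp_le k hM0 hM hs.1 h hr.2

theorem norm_sqOp_ne_one {k : C(ℝ, ℝ)} (h3 : CondK3 k) {s : ℝ} (hs : 0 ≤ s)
    (h : ¬ TruncHasEigenvalue k s 1 ∧ ¬ TruncHasEigenvalue k s (-1)) : ‖sqOp k s‖ ≠ 1 := by
  intro hn
  rcases hasEigenvalue_of_norm_eq_one k hs hn with he | he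
  · exact h.1 (truncHasEigenvalue_of_hasEigenvalue h3 one_ne_zero he)
  · exact h.2 (truncHasEigenvalue_of_hasEigenvalue h3 (by simp) he)

/-- The norm is 0 at s = 0 and continuous in s. If it reached one later, it would equal one
somewhere by the intermediate value theorem, and ±1 would be an eigenvalue there. -/
theorem norm_sqOp_lt_one {k : C(ℝ, ℝ)} (h3 : CondK3 k)
    (h : ∀ s : ℝ, 0 ≤ s → ¬ TruncHasEigenvalue k s 1 ∧ ¬ TruncHasEigenvalue k s (-1))
    {s : ℝ} (hs : 0 ≤ s) : ‖sqOp k s‖ < 1 := by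
  by_contra hc
  rw [not_lt] at hc
  obtain ⟨M, hM0, hM⟩ := exists_bound_square k 0
  have h0 : ‖sqOp k 0‖ ≤ 1 := by
    have := norm_sqOp_le k le_rfl hM0 hM
    linarith
  obtain ⟨r, hr, hr1⟩ := intermediate_value_Icc hs (continuousOn_norm_sqOp k s) ⟨h0, hc⟩
  exact norm_sqOp_ne_one h3 hr.1 (h r hr.1) hr1

/-! ### The strong limit of the truncations -/

theorem integral_hankel_eq_setIntegral {k : ℝ → ℝ} (h3 : CondK3 k) {f : ℝ → ℂ} {R s x : ℝ}
    (hf : ∀ᵐ y : ℝ, R < y → f y = 0) (hRs : R < s) (hx : x < s) :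
    ∫ y in Set.Ioo (-s) s, (k (x + y) : ℂ) * f y = ∫ y, (k (x + y) : ℂ) * f y := by
  refine setIntegral_eq_integral_of_ae_compl_eq_zero ?_
  filter_upwards [hf] with y hy hys
  rcases lt_or_ge R y with h | h
  · rw [hy h, mul_zero]
  · have : y ≤ -s := by
      by_contra hc
      exact hys ⟨not_le.1 hc, h.trans_lt hRs⟩
    rw [h3 _ (by linarith)]
    simp

theorem continuous_hankel {k : C(ℝ, ℝ)} (h3 : CondK3 k) {f : ℝ → ℂ} {R : ℝ} (hm : MemLp f 2)
    (hf : ∀ᵐ y : ℝ, R < y → f y = 0) : Continuous fun x => ∫ y, (k (x + y) : ℂ) * f y := by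
  refine continuous_iff_continuousAt.2 fun x₀ => ?_
  set s := max R x₀ + 1 with hs
  have h1 : Continuous fun x => ∫ y in Set.Ioo (-s) s, (k (x + y) : ℂ) * f y :=
    continuous_integral_translate_mul (k := fun x => (k x : ℂ)) (by fun_prop)
      (Metric.isBounded_Ioo _ _) measurableSet_Ioo
      (setIntegral_norm_le (by simp) hm).1
  refine h1.continuousAt.congr ?_
  filter_upwards [Iio_mem_nhds (show x₀ < s by linarith [le_max_right R x₀])] with x hx
  exact integral_hankel_eq_setIntegral h3 hf (by linarith [le_max_left R x₀]) hx

/-- If f vanishes beyond R < s, truncation does not affect the input: for x < s the integrand is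
supported in -x ≤ y ≤ R, inside (-s,s). Only the output is cut at s. -/
theorem sqOp_ae_eq_indicator {k : C(ℝ, ℝ)} (h3 : CondK3 k) {f : L2} {R s : ℝ}
    (hf : ∀ᵐ y : ℝ, R < y → f y = 0) (hRs : R < s) :
    sqOp k s f =ᵐ[volume] (Set.Iio s).indicator fun x => ∫ y, (k (x + y) : ℂ) * f y := by
  filter_upwards [truncOp_ae_eq h3 s f] with x hx
  rw [← hx, truncOp]
  by_cases h : x ∈ Set.Iio s
  · rw [Set.indicator_of_mem h, Set.indicator_of_mem h,
      ← integral_hankel_eq_setIntegral h3 hf hRs h]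
    refine setIntegral_eq_of_subset_of_forall_sdiff_eq_zero measurableSet_Iio
      (fun y hy => hy.2) fun y hy => ?_
    have hy1 : y ≤ -s := by
      by_contra hc
      exact hy.2 ⟨not_le.1 hc, hy.1⟩
    rw [h3 _ (by linarith [h.out])]
    simp
  · rw [Set.indicator_of_notMem h, Set.indicator_of_notMem h]

theorem tendsto_eLpNorm_indicator_Ici {f : ℝ → ℂ} (hf : MemLp f 2) :
    Tendsto (fun s : ℝ => eLpNorm ((Set.Ici s).indicator f) 2 volume) atTop (𝓝 0) := by
  have hfin : ∫⁻ x, ‖f x‖ₑ ^ (2 : ℝ) ≠ ∞ := by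
    have := hf.2
    rw [eLpNorm_lt_top_iff_lintegral_rpow_enorm_lt_top (by norm_num) (by norm_num)] at this
    simpa using this.ne
  have h : Tendsto (fun s : ℝ => ∫⁻ x, (Set.Ici s).indicator (fun x => ‖f x‖ₑ ^ (2 : ℝ)) x) atTop
      (𝓝 (∫⁻ _ : ℝ, 0)) := by
    refine tendsto_lintegral_filter_of_dominated_convergence' (fun x => ‖f x‖ₑ ^ (2 : ℝ)) ?_ ?_ hfin ?_
    · exact Eventually.of_forall fun s => (hf.1.enorm.pow_const _).indicator measurableSet_Ici
    · exact Eventually.of_forall fun s => ae_of_all _ fun x => Set.indicator_le_self _ _ x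
    · refine ae_of_all _ fun x => tendsto_const_nhds.congr' ?_
      filter_upwards [eventually_gt_atTop x] with s hs
      rw [Set.indicator_of_notMem (by simpa using hs)]
  rw [lintegral_zero] at h
  have h2 := (ENNReal.continuous_rpow_const (y := 1 / 2)).tendsto 0 |>.comp h
  rw [ENNReal.zero_rpow_of_pos (by norm_num)] at h2
  refine h2.congr fun s => ?_
  rw [Function.comp_apply, eLpNorm_eq_lintegral_rpow_enorm_toReal (by norm_num) (by norm_num)]
  norm_num
  congr 1
  rw [← lintegral_indicator measurableSet_Ici]
  refine lintegral_congr fun x => ?_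
  by_cases hx : x ∈ Set.Ici s
  · simp [Set.indicator_of_mem hx]
  · simp [Set.indicator_of_notMem hx]

theorem exists_boundedSupport_near (f : L2) {ε : ℝ} (hε : 0 < ε) :
    ∃ g : L2, ∃ R : ℝ, (∀ᵐ y : ℝ, R < y → g y = 0) ∧ ‖f - g‖ < ε := by
  have h := tendsto_eLpNorm_indicator_Ici (Lp.memLp f)
  have hev := (ENNReal.tendsto_nhds_zero.1 h) (ENNReal.ofReal (ε / 2)) (by simpa using hε)
  obtain ⟨R, hR⟩ := hev.exists
  have hm : MemLp ((Set.Iio R).indicator f) 2 (volume : Measure ℝ) := (Lp.memLp f).indicator measurableSet_Iio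
  refine ⟨hm.toLp _, R, ?_, ?_⟩
  · filter_upwards [hm.coeFn_toLp] with x hx hRx
    rw [hx, Set.indicator_of_notMem (by simpa using hRx.le)]
  · rw [Lp.norm_def]
    have e : ⇑(f - hm.toLp _) =ᵐ[volume] (Set.Ici R).indicator f := by
      filter_upwards [Lp.coeFn_sub f (hm.toLp _), hm.coeFn_toLp] with x h1 h2
      rw [h1, Pi.sub_apply, h2]
      by_cases hx : x < R
      · rw [Set.indicator_of_mem (by simpa using hx), Set.indicator_of_notMem (by simpa using hx),
          sub_self]
      · rw [Set.indicator_of_notMem (by simpa using hx),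
          Set.indicator_of_mem (by simpa using hx), sub_zero]
    rw [eLpNorm_congr_ae e]
    refine (ENNReal.toReal_mono ENNReal.ofReal_ne_top hR).trans_lt ?_
    rw [ENNReal.toReal_ofReal (by positivity)]
    linarith

theorem norm_sqOp_le_one_of_nonneg {k : C(ℝ, ℝ)} (hc : ∀ s : ℝ, 0 ≤ s → ‖sqOp k s‖ ≤ 1) (s : ℝ) :
    ‖sqOp k s‖ ≤ 1 := by
  rcases le_or_gt 0 s with h | h
  · exact hc s h
  · refine ContinuousLinearMap.opNorm_le_bound _ zero_le_one fun f => ?_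
    have : sqOp k s f = 0 := by
      apply Lp.ext
      filter_upwards [sqOp_coeFn k s f, Lp.coeFn_zero ℂ 2 (volume : Measure ℝ)] with x h1 h2
      rw [h1, h2, rectFun, Set.Ioo_eq_empty (by linarith)]
      simp
    rw [this, norm_zero]
    positivity

/-- The truncations are 1_{(-∞,s)} g with norms at most ‖f‖. Fatou's lemma puts g itself in L², and
the error is the tail of g on [s,∞). -/
theorem tendsto_sqOp_of_boundedSupport {k : C(ℝ, ℝ)} (h3 : CondK3 k)
    (hc : ∀ s : ℝ, 0 ≤ s → ‖sqOp k s‖ ≤ 1) {f : L2} {R : ℝ}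
    (hf : ∀ᵐ y : ℝ, R < y → f y = 0) :
    ∃ hg : MemLp (fun x => ∫ y, (k (x + y) : ℂ) * f y) 2,
      Tendsto (fun s => sqOp k s f) atTop (𝓝 (hg.toLp _)) := by
  set g : ℝ → ℂ := fun x => ∫ y, (k (x + y) : ℂ) * f y with hgdef
  have hcont : Continuous g := continuous_hankel h3 (Lp.memLp f) hf
  have hle : eLpNorm g 2 volume ≤ eLpNorm f 2 volume := by
    have h := Lp.eLpNorm_lim_le_liminf_eLpNorm (p := 2) (μ := (volume : Measure ℝ))
      (f := fun n : ℕ => (Set.Iio (n : ℝ)).indicator g)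
      (fun n => hcont.aestronglyMeasurable.indicator measurableSet_Iio) g
      (ae_of_all _ fun x => by
        refine tendsto_const_nhds.congr' ?_
        filter_upwards [(tendsto_natCast_atTop_atTop (R := ℝ)).eventually_gt_atTop x] with n hn
        rw [Set.indicator_of_mem (by simpa using hn)])
    refine h.trans ?_
    refine Filter.liminf_le_of_le (by isBoundedDefault) fun b hb => ?_
    obtain ⟨n, hn1, hn2⟩ := (hb.and
      ((tendsto_natCast_atTop_atTop (R := ℝ)).eventually_gt_atTop R)).exists
    refine hn1.trans ?_
    rw [← eLpNorm_congr_ae (sqOp_ae_eq_indicator h3 hf hn2)]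
    have := (sqOp k n).le_of_opNorm_le (norm_sqOp_le_one_of_nonneg hc n) f
    rw [one_mul, Lp.norm_def, Lp.norm_def] at this
    exact (ENNReal.toReal_le_toReal (Lp.memLp _).2.ne (Lp.memLp _).2.ne).1 this
  have hg : MemLp g 2 := ⟨hcont.aestronglyMeasurable, hle.trans_lt (Lp.memLp f).2⟩
  refine ⟨hg, ?_⟩
  rw [tendsto_iff_norm_sub_tendsto_zero]
  have h := (ENNReal.tendsto_toReal ENNReal.zero_ne_top).comp (tendsto_eLpNorm_indicator_Ici hg)
  rw [ENNReal.toReal_zero] at h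
  refine h.congr' ?_
  filter_upwards [eventually_gt_atTop R] with s hs
  rw [Function.comp_apply, norm_sub_rev, Lp.norm_def]
  congr 1
  refine eLpNorm_congr_ae ?_
  filter_upwards [Lp.coeFn_sub (hg.toLp g) (sqOp k s f), hg.coeFn_toLp,
    sqOp_ae_eq_indicator h3 hf hs] with x h1 h2 h3
  rw [h1, Pi.sub_apply, h2, h3]
  by_cases hx : x < s
  · rw [Set.indicator_of_mem (s := Set.Iio s) (by simpa using hx),
      Set.indicator_of_notMem (by simpa using hx), sub_self]
  · rw [Set.indicator_of_notMem (s := Set.Iio s) (by simpa using hx),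
      Set.indicator_of_mem (by simpa using hx), sub_zero]

/-- Convergence on the dense set of functions supported in a left half-line extends to all of L²
because the truncations are uniformly bounded by one. -/
theorem exists_strong_limit {k : C(ℝ, ℝ)} (h3 : CondK3 k)
    (hc : ∀ s : ℝ, 0 ≤ s → ‖sqOp k s‖ ≤ 1) :
    ∃ T : L2 →L[ℂ] L2, ∀ f, Tendsto (fun s => sqOp k s f) atTop (𝓝 (T f)) := by
  have hlim : ∀ f : L2, ∃ y, Tendsto (fun s => sqOp k s f) atTop (𝓝 y) := by
    intro f
    refine cauchySeq_tendsto_of_complete (Metric.cauchySeq_iff'.2 fun ε hε => ?_)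
    obtain ⟨g, R, hg, hfg⟩ := exists_boundedSupport_near f (show 0 < ε / 4 by positivity)
    obtain ⟨_, hT⟩ := tendsto_sqOp_of_boundedSupport h3 hc hg
    obtain ⟨N, hN⟩ := Metric.cauchySeq_iff'.1 hT.cauchySeq (ε / 4) (by positivity)
    refine ⟨N, fun s hs => ?_⟩
    have h1 := hN s hs
    have h2 : ∀ r, dist (sqOp k r f) (sqOp k r g) < ε / 4 := by
      intro r
      rw [dist_eq_norm, ← map_sub]
      refine ((sqOp k r).le_of_opNorm_le (norm_sqOp_le_one_of_nonneg hc r) _).trans_lt ?_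
      rwa [one_mul]
    have h3 := dist_triangle4 (sqOp k s f) (sqOp k s g) (sqOp k N g) (sqOp k N f)
    have h4 := h2 s
    have h5 := h2 N
    rw [dist_comm] at h5
    linarith
  choose y hy using hlim
  exact ⟨continuousLinearMapOfTendsto (fun s => sqOp k s) (tendsto_pi_nhds.2 hy), hy⟩

theorem isStrongLimit_iff {k : C(ℝ, ℝ)} (h3 : CondK3 k) (T : L2 →L[ℂ] L2) :
    IsStrongLimit k T ↔ ∀ f, Tendsto (fun s => sqOp k s f) atTop (𝓝 (T f)) := by
  have key : ∀ f : L2, ∀ s : ℝ, eLpNorm (fun x => truncOp k s f x - T f x) 2 volume =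
      ENNReal.ofReal ‖sqOp k s f - T f‖ := by
    intro f s
    rw [Lp.norm_def, ENNReal.ofReal_toReal (Lp.memLp _).2.ne]
    refine eLpNorm_congr_ae ?_
    filter_upwards [Lp.coeFn_sub (sqOp k s f) (T f), truncOp_ae_eq h3 s f] with x h1 h2
    rw [h1, Pi.sub_apply, h2]
  refine forall_congr' fun f => ?_
  rw [tendsto_iff_norm_sub_tendsto_zero]
  simp_rw [key]
  constructor
  · intro h
    have := (ENNReal.tendsto_toReal ENNReal.zero_ne_top).comp h
    rw [ENNReal.toReal_zero] at this
    refine this.congr fun s => ?_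
    rw [Function.comp_apply, ENNReal.toReal_ofReal (norm_nonneg _)]
  · intro h
    have := ENNReal.tendsto_ofReal h
    rwa [ENNReal.ofReal_zero] at this

theorem tendsto_sqOp_hankelOp {k : C(ℝ, ℝ)} (h3 : CondK3 k)
    (hc : ∀ s : ℝ, 0 ≤ s → ‖sqOp k s‖ ≤ 1) (f : L2) :
    Tendsto (fun s => sqOp k s f) atTop (𝓝 (hankelOp k f)) := by
  obtain ⟨T, hT⟩ := exists_strong_limit h3 hc
  have hex : ∃ T, IsStrongLimit k T := ⟨T, (isStrongLimit_iff h3 T).2 hT⟩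
  exact (isStrongLimit_iff h3 _).1 (Classical.epsilon_spec hex) f

theorem norm_hankelOp_apply_le {k : C(ℝ, ℝ)} (h3 : CondK3 k)
    (hc : ∀ s : ℝ, 0 ≤ s → ‖sqOp k s‖ ≤ 1) (f : L2) : ‖hankelOp k f‖ ≤ ‖f‖ := by
  refine le_of_tendsto (tendsto_sqOp_hankelOp h3 hc f).norm (Eventually.of_forall fun s => ?_)
  simpa using (sqOp k s).le_of_opNorm_le (norm_sqOp_le_one_of_nonneg hc s) f

/-- Symmetry passes to the strong limit. -/
theorem inner_hankelOp {k : C(ℝ, ℝ)} (h3 : CondK3 k)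
    (hc : ∀ s : ℝ, 0 ≤ s → ‖sqOp k s‖ ≤ 1) (f g : L2) :
    inner ℂ (hankelOp k f) g = inner ℂ f (hankelOp k g) := by
  have h1 := (tendsto_sqOp_hankelOp h3 hc f).inner (𝕜 := ℂ) (tendsto_const_nhds (x := g))
  have h2 := (tendsto_const_nhds (x := f)).inner (𝕜 := ℂ) (tendsto_sqOp_hankelOp h3 hc g)
  simp_rw [inner_sqOp] at h1
  exact tendsto_nhds_unique h1 h2

theorem hankelOp_ae_eq {k : C(ℝ, ℝ)} (h3 : CondK3 k)
    (hc : ∀ s : ℝ, 0 ≤ s → ‖sqOp k s‖ ≤ 1) {f : L2} {R : ℝ} (hf : ∀ᵐ y : ℝ, R < y → f y = 0) :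
    hankelOp k f =ᵐ[volume] fun x => ∫ y, (k (x + y) : ℂ) * f y := by
  obtain ⟨hg, hT⟩ := tendsto_sqOp_of_boundedSupport h3 hc hf
  rw [tendsto_nhds_unique (tendsto_sqOp_hankelOp h3 hc f) hT]
  exact hg.coeFn_toLp

/-! ### Fourier integrals: analyticity in strips, decay, shift of lines -/

theorem integrable_mul_exp_of_re {f : ℝ → ℂ} {v : ℝ} (hf : Integrable fun x => f x * (Real.exp (-v * x) : ℂ))
    {z : ℂ} (hz : z.im = v) : Integrable fun x : ℝ => f x * Complex.exp (Complex.I * z * x) := by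
  have h2 : Integrable fun x : ℝ => Complex.exp (Complex.I * z.re * x) *
      (f x * (Real.exp (-v * x) : ℂ)) := by
    refine hf.bdd_mul (c := 1) (by fun_prop) (ae_of_all _ fun x => ?_)
    rw [norm_exp_I_mul]
    simp
  refine h2.congr (ae_of_all _ fun x => ?_)
  have : Complex.exp (Complex.I * z * x) = Complex.exp (Complex.I * z.re * x) *
      (Real.exp (-v * x) : ℂ) := by
    rw [Complex.ofReal_exp, ← Complex.exp_add]
    congr 1
    conv_lhs => rw [← Complex.re_add_im z, hz]
    push_cast
    linear_combination (v * x : ℂ) * Complex.I_sq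
  simp only [this]
  ring

theorem integrable_mul_exp_real_of_complex {f : ℝ → ℂ} {z : ℂ}
    (hf : Integrable fun x : ℝ => f x * Complex.exp (Complex.I * z * x)) :
    Integrable fun x => f x * (Real.exp (-z.im * x) : ℂ) := by
  have h2 : Integrable fun x : ℝ => Complex.exp (Complex.I * (-z.re : ℝ) * x) *
      (f x * Complex.exp (Complex.I * z * x)) := by
    refine hf.bdd_mul (c := 1) (by fun_prop) (ae_of_all _ fun x => ?_)
    rw [norm_exp_I_mul]
    simp
  refine h2.congr (ae_of_all _ fun x => ?_)
  have : (Real.exp (-z.im * x) : ℂ) = Complex.exp (Complex.I * (-z.re : ℝ) * x) *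
      Complex.exp (Complex.I * z * x) := by
    rw [Complex.ofReal_exp, ← Complex.exp_add]
    congr 1
    push_cast
    linear_combination (-z.im * x : ℂ) * Complex.I_sq + (Complex.I * x) * Complex.re_add_im z
  simp only [this]
  ring

/-- Differentiation under the integral produces a factor x. The margin δ to both edges of the strip
absorbs it, leaving the two edge exponentials as majorant. -/
theorem abs_mul_exp_le {a b y δ x : ℝ} (hδ : 0 < δ) (h1 : a + δ ≤ y) (h2 : y ≤ b - δ) :
    |x| * Real.exp (-y * x) ≤ δ⁻¹ * (Real.exp (-a * x) + Real.exp (-b * x)) := by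
  have hx : δ * |x| ≤ Real.exp (δ * |x|) := by linarith [Real.add_one_le_exp (δ * |x|)]
  have key : δ * |x| * Real.exp (-y * x) ≤ Real.exp (-a * x) + Real.exp (-b * x) := by
    refine (mul_le_mul_of_nonneg_right hx (Real.exp_pos _).le).trans ?_
    rw [← Real.exp_add]
    rcases le_total 0 x with h | h
    · rw [abs_of_nonneg h]
      have : Real.exp (δ * x + -y * x) ≤ Real.exp (-a * x) := Real.exp_le_exp.2 (by nlinarith)
      linarith [Real.exp_pos (-b * x)]
    · rw [abs_of_nonpos h]
      have : Real.exp (δ * -x + -y * x) ≤ Real.exp (-b * x) := Real.exp_le_exp.2 (by nlinarith)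
      linarith [Real.exp_pos (-a * x)]
  rw [inv_mul_eq_div, le_div_iff₀ hδ]
  linarith

theorem exp_le_add_exp {a b y x : ℝ} (h1 : a ≤ y) (h2 : y ≤ b) :
    Real.exp (-y * x) ≤ Real.exp (-a * x) + Real.exp (-b * x) := by
  rcases le_total 0 x with h | h
  · have : Real.exp (-y * x) ≤ Real.exp (-a * x) := Real.exp_le_exp.2 (by nlinarith)
    linarith [Real.exp_pos (-b * x)]
  · have : Real.exp (-y * x) ≤ Real.exp (-b * x) := Real.exp_le_exp.2 (by nlinarith)
    linarith [Real.exp_pos (-a * x)]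

theorem integrable_mul_exp_of_between {f : ℝ → ℂ} {a b y : ℝ} (hm : AEStronglyMeasurable f)
    (ha : Integrable fun x => f x * (Real.exp (-a * x) : ℂ))
    (hb : Integrable fun x => f x * (Real.exp (-b * x) : ℂ)) (h1 : a ≤ y) (h2 : y ≤ b) :
    Integrable fun x => f x * (Real.exp (-y * x) : ℂ) := by
  refine (ha.norm.add hb.norm).mono' (hm.mul (by fun_prop)) (ae_of_all _ fun x => ?_)
  simp only [norm_mul, Pi.add_apply, Complex.norm_real, Real.norm_eq_abs, Real.abs_exp]
  rw [← mul_add]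
  exact mul_le_mul_of_nonneg_left (exp_le_add_exp h1 h2) (norm_nonneg _)

/-- The Fourier integral is holomorphic in the interior of its strip of convergence. -/
theorem differentiableAt_fourierInt {f : ℝ → ℂ} {a b : ℝ} (hm : AEStronglyMeasurable f)
    (ha : Integrable fun x => f x * (Real.exp (-a * x) : ℂ))
    (hb : Integrable fun x => f x * (Real.exp (-b * x) : ℂ)) {z : ℂ} (haz : a < z.im)
    (hzb : z.im < b) : DifferentiableAt ℂ (fourierInt f) z := by
  obtain ⟨δ, hδ, hδ1, hδ2⟩ : ∃ δ : ℝ, 0 < δ ∧ a + 2 * δ ≤ z.im ∧ z.im ≤ b - 2 * δ :=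
    ⟨min (z.im - a) (b - z.im) / 2, by
      have := lt_min (sub_pos.2 haz) (sub_pos.2 hzb); linarith,
      by linarith [min_le_left (z.im - a) (b - z.im)],
      by linarith [min_le_right (z.im - a) (b - z.im)]⟩
  have h := hasDerivAt_integral_of_dominated_loc_of_deriv_le (μ := (volume : Measure ℝ))
    (F := fun (w : ℂ) (x : ℝ) => f x * Complex.exp (Complex.I * w * x))
    (F' := fun (w : ℂ) (x : ℝ) => f x * (Complex.exp (Complex.I * w * x) * (Complex.I * x)))
    (x₀ := z) (s := Metric.ball z δ)
    (bound := fun x => δ⁻¹ * (‖f x * (Real.exp (-a * x) : ℂ)‖ + ‖f x * (Real.exp (-b * x) : ℂ)‖))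
    (Metric.ball_mem_nhds z hδ) ?_ ?_ ?_ ?_ ?_ ?_
  · exact h.2.differentiableAt
  · exact Eventually.of_forall fun w => hm.mul (by fun_prop)
  · exact integrable_mul_exp_of_re (integrable_mul_exp_of_between hm ha hb haz.le hzb.le) rfl
  · exact hm.mul (by fun_prop)
  · refine ae_of_all _ fun x w hw => ?_
    have him : |w.im - z.im| < δ := by
      have h0 : ‖w - z‖ < δ := mem_ball_iff_norm.1 hw
      rw [← Complex.sub_im]
      exact (Complex.abs_im_le_norm _).trans_lt h0
    rw [abs_lt] at him
    simp only [norm_mul, norm_exp_I_mul, Complex.norm_I, Complex.norm_real, one_mul,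
      Real.norm_eq_abs, Real.abs_exp]
    rw [← mul_add, mul_left_comm δ⁻¹]
    refine mul_le_mul_of_nonneg_left ?_ (norm_nonneg _)
    rw [mul_comm (Real.exp _)]
    exact abs_mul_exp_le hδ (by linarith) (by linarith)
  · exact (ha.norm.add hb.norm).const_mul _
  · refine ae_of_all _ fun x w _ => ?_
    have : HasDerivAt (fun w : ℂ => Complex.I * w * x) (Complex.I * x) w := by
      simpa using ((hasDerivAt_id w).const_mul Complex.I).mul_const (x : ℂ)
    exact this.cexp.const_mul _

/-- Shift of the line of integration. -/
theorem integral_line_eq {F : ℂ → ℂ} (hF : DifferentiableOn ℂ F {z | 0 < z.im}) {v₁ v₂ C : ℝ}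
    (hv₁ : 0 < v₁) (hv : v₁ ≤ v₂)
    (hC : ∀ u v : ℝ, v₁ ≤ v → v ≤ v₂ → ‖F ((u : ℂ) + (v : ℂ) * Complex.I)‖ ≤ C * (1 + u ^ 2)⁻¹) :
    ∫ u : ℝ, F ((u : ℂ) + (v₁ : ℂ) * Complex.I) = ∫ u : ℝ, F ((u : ℂ) + (v₂ : ℂ) * Complex.I) := by
  have hcont : ∀ v : ℝ, 0 < v → Continuous fun u : ℝ => F ((u : ℂ) + (v : ℂ) * Complex.I) := by
    intro v hv0
    refine hF.continuousOn.comp_continuous (by fun_prop) fun u => ?_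
    simpa using hv0
  have hint : ∀ v : ℝ, v₁ ≤ v → v ≤ v₂ → Integrable fun u : ℝ => F ((u : ℂ) + (v : ℂ) * Complex.I) :=
    fun v h1 h2 => (integrable_inv_one_add_sq.const_mul C).mono'
      (hcont v (hv₁.trans_le h1)).aestronglyMeasurable (ae_of_all _ fun u => hC u v h1 h2)
  have hC0 : 0 ≤ C := by
    have := (norm_nonneg _).trans (hC 0 v₁ le_rfl hv)
    simpa using this
  -- The sign s selects the right or left vertical side of the rectangle at abscissa ±n. Quadratic
  -- decay makes both contributions vanish in the limit.
  have hside : ∀ s : ℝ, |s| = 1 → Tendsto (fun n : ℕ => ∫ y : ℝ in v₁..v₂, F (((s * n : ℝ) : ℂ) + (y : ℂ) * Complex.I))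
      atTop (𝓝 0) := by
    intro s hs
    have hlim : Tendsto (fun n : ℕ => C * (1 + (n : ℝ) ^ 2)⁻¹ * |v₂ - v₁|) atTop (𝓝 0) := by
      have h1 : Tendsto (fun n : ℕ => 1 + (n : ℝ) ^ 2) atTop atTop :=
        tendsto_atTop_add_const_left _ _
          ((tendsto_pow_atTop two_ne_zero).comp tendsto_natCast_atTop_atTop)
      have h2 := (h1.inv_tendsto_atTop.const_mul C).mul_const |v₂ - v₁|
      simpa using h2
    refine squeeze_zero_norm (fun n => ?_) hlim
    refine intervalIntegral.norm_integral_le_of_norm_le_const fun y hy => ?_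
    rw [Set.uIoc_of_le hv] at hy
    have := hC (s * n) y hy.1.le hy.2
    rwa [mul_pow, ← sq_abs s, hs, one_pow, one_mul] at this
  have hrect : ∀ n : ℕ, (∫ x : ℝ in (-(n : ℝ))..n, F ((x : ℂ) + (v₁ : ℂ) * Complex.I)) -
      (∫ x : ℝ in (-(n : ℝ))..n, F ((x : ℂ) + (v₂ : ℂ) * Complex.I)) +
      Complex.I • (∫ y : ℝ in v₁..v₂, F (((1 * n : ℝ) : ℂ) + (y : ℂ) * Complex.I)) -
      Complex.I • (∫ y : ℝ in v₁..v₂, F ((((-1) * n : ℝ) : ℂ) + (y : ℂ) * Complex.I)) = 0 := by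
    intro n
    have h := Complex.integral_boundary_rect_eq_zero_of_differentiableOn F ⟨-(n : ℝ), v₁⟩ ⟨n, v₂⟩
      (hF.mono fun z hz => by
        have h2 := hz.2
        simp only [Set.mem_preimage, Set.uIcc_of_le hv] at h2
        exact hv₁.trans_le h2.1)
    simpa using h
  have h1 := intervalIntegral_tendsto_integral (hint v₁ le_rfl hv)
    (tendsto_neg_atTop_atBot.comp tendsto_natCast_atTop_atTop) (tendsto_natCast_atTop_atTop (R := ℝ))
  have h2 := intervalIntegral_tendsto_integral (hint v₂ hv le_rfl)
    (tendsto_neg_atTop_atBot.comp tendsto_natCast_atTop_atTop) (tendsto_natCast_atTop_atTop (R := ℝ))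
  have h3 := (((h1.sub h2).add ((hside 1 (by simp)).const_smul Complex.I)).sub
    ((hside (-1) (by simp)).const_smul Complex.I))
  simp only [smul_zero, add_zero, sub_zero] at h3
  have h4 : (∫ u : ℝ, F ((u : ℂ) + (v₁ : ℂ) * Complex.I)) -
      ∫ u : ℝ, F ((u : ℂ) + (v₂ : ℂ) * Complex.I) = 0 := by
    refine tendsto_nhds_unique h3 ?_
    refine tendsto_const_nhds.congr fun n => ?_
    exact (hrect n).symm
  exact sub_eq_zero.1 h4

theorem integrable_mul_exp_of_compactSupport {f : ℝ → ℂ} (hf : Continuous f) (hs : HasCompactSupport f) (v : ℝ) :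
    Integrable fun x => f x * (Real.exp (-v * x) : ℂ) :=
  Continuous.integrable_of_hasCompactSupport (by fun_prop) hs.mul_right

theorem fourierInt_deriv {f : ℝ → ℂ} (hf : ContDiff ℝ 1 f) (hs : HasCompactSupport f) (w : ℂ) :
    fourierInt (deriv f) w = -(Complex.I * w) * fourierInt f w := by
  have hd : Continuous (deriv f) := hf.continuous_deriv le_rfl
  have hu : ∀ x : ℝ, HasDerivAt (fun x : ℝ => Complex.exp (Complex.I * w * x))
      (Complex.exp (Complex.I * w * x) * (Complex.I * w)) x := by
    intro x
    have : HasDerivAt (fun x : ℝ => Complex.I * w * (x : ℂ)) (Complex.I * w) x := by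
      simpa using (Complex.ofRealCLM.hasDerivAt (x := x)).const_mul (Complex.I * w)
    exact this.cexp
  have i1 : ∀ {g : ℝ → ℂ}, Continuous g → HasCompactSupport g →
      Integrable fun x : ℝ => Complex.exp (Complex.I * w * x) * g x := fun hg hgs =>
    Continuous.integrable_of_hasCompactSupport (by fun_prop) hgs.mul_left
  have h := integral_mul_deriv_eq_deriv_mul_of_integrable (u := fun x : ℝ => Complex.exp (Complex.I * w * x))
    (v := f) (u' := fun x : ℝ => Complex.exp (Complex.I * w * x) * (Complex.I * w)) (v' := deriv f)
    (fun x _ => hu x) (fun x _ => (hf.differentiable (by norm_num) x).hasDerivAt)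
    (i1 hd hs.deriv) ?_ (i1 hf.continuous hs)
  · simp only [fourierInt]
    simp_rw [mul_comm (deriv f _), mul_comm (f _)]
    rw [h, ← integral_const_mul, ← integral_neg]
    refine integral_congr_ae (ae_of_all _ fun x => ?_)
    simp only
    ring
  · have := (i1 hf.continuous hs).const_mul (Complex.I * w)
    refine this.congr (ae_of_all _ fun x => ?_)
    simp only [Pi.mul_apply]
    ring

theorem norm_fourierInt_le {f : ℝ → ℂ} (hf : Continuous f) (hs : HasCompactSupport f) {V : ℝ} {w : ℂ}
    (hw : |w.im| ≤ V) : ‖fourierInt f w‖ ≤ ∫ x, ‖f x‖ * Real.exp (V * |x|) := by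
  refine norm_integral_le_of_norm_le ?_ (ae_of_all _ fun x => ?_)
  · exact Continuous.integrable_of_hasCompactSupport (by fun_prop) hs.norm.mul_right
  · rw [norm_mul, norm_exp_I_mul]
    refine mul_le_mul_of_nonneg_left (Real.exp_le_exp.2 ?_) (norm_nonneg _)
    calc -w.im * x ≤ |-w.im * x| := le_abs_self _
      _ = |w.im| * |x| := by rw [abs_mul, abs_neg]
      _ ≤ _ := mul_le_mul_of_nonneg_right hw (abs_nonneg _)

/-- Integrating by parts twice bounds w² times the transform. The bound is uniform in horizontal
strips, as needed both for the shift of lines and for dominated convergence. -/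
theorem exists_fourierInt_decay {f : ℝ → ℂ} (hf : ContDiff ℝ 2 f) (hs : HasCompactSupport f) (V : ℝ) :
    ∃ C : ℝ, 0 ≤ C ∧ ∀ w : ℂ, |w.im| ≤ V → ‖fourierInt f w‖ ≤ C * (1 + w.re ^ 2)⁻¹ := by
  have hf1 : ContDiff ℝ 1 (deriv f) := (contDiff_succ_iff_deriv (n := 1)).1 (by simpa [one_add_one_eq_two] using hf) |>.2.2
  refine ⟨(∫ x, ‖f x‖ * Real.exp (V * |x|)) + ∫ x, ‖deriv (deriv f) x‖ * Real.exp (V * |x|),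
    add_nonneg (integral_nonneg fun x => by positivity) (integral_nonneg fun x => by positivity),
    fun w hw => ?_⟩
  have h0 := norm_fourierInt_le hf.continuous hs hw
  have h2 := norm_fourierInt_le (hf1.continuous_deriv le_rfl) hs.deriv.deriv hw
  rw [fourierInt_deriv hf1 hs.deriv, fourierInt_deriv (hf.of_le (by norm_num)) hs, norm_mul, norm_mul,
    norm_neg, norm_mul, Complex.norm_I, one_mul] at h2
  have h3 : w.re ^ 2 ≤ ‖w‖ ^ 2 := by
    rw [← sq_abs]
    exact pow_le_pow_left₀ (abs_nonneg _) (Complex.abs_re_le_norm w) 2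
  rw [← div_eq_mul_inv, le_div_iff₀ (by positivity)]
  nlinarith [norm_nonneg (fourierInt f w)]

theorem integrable_kernel_exp {k : C(ℝ, ℝ)} (h3 : CondK3 k) {c C v : ℝ}
    (hC : ∀ x, |k x| ≤ C * Real.exp (c * x)) (hv : c < v) :
    Integrable fun x => (k x : ℂ) * (Real.exp (-v * x) : ℂ) := by
  have h1 : IntegrableOn (fun x => (k x : ℂ) * (Real.exp (-v * x) : ℂ)) (Set.Ioi 0) := by
    refine ((exp_neg_integrableOn_Ioi 0 (sub_pos.2 hv)).const_mul C).mono' (by fun_prop)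
      (ae_of_all _ fun x => ?_)
    rw [norm_mul, Complex.norm_real, Complex.norm_real, Real.norm_eq_abs, Real.norm_eq_abs, Real.abs_exp]
    refine (mul_le_mul_of_nonneg_right (hC x) (Real.exp_pos _).le).trans (le_of_eq ?_)
    rw [mul_assoc, ← Real.exp_add]
    ring_nf
  rw [← integrableOn_univ, ← Set.Iic_union_Ioi (a := (0 : ℝ)), integrableOn_union]
  refine ⟨?_, h1⟩
  rw [integrableOn_Iic_iff_integrableOn_Iio]
  refine (integrableOn_zero).congr_fun (fun x hx => ?_) measurableSet_Iio
  simp [h3 x hx]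

theorem memLp_two_of_decay {L : ℝ → ℂ} (hL : Continuous L) {C : ℝ}
    (hC : ∀ u, ‖L u‖ ≤ C * (1 + u ^ 2)⁻¹) : Integrable L ∧ MemLp L 2 := by
  refine ⟨(integrable_inv_one_add_sq.const_mul C).mono' hL.aestronglyMeasurable (ae_of_all _ hC), ?_⟩
  rw [memLp_two_iff_integrable_sq_norm hL.aestronglyMeasurable]
  refine (integrable_inv_one_add_sq.const_mul (C ^ 2)).mono' (by fun_prop) (ae_of_all _ fun u => ?_)
  have h0 : (0 : ℝ) < (1 + u ^ 2)⁻¹ := by positivity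
  have h1 : (1 + u ^ 2)⁻¹ ≤ 1 := inv_le_one_of_one_le₀ (by nlinarith [sq_nonneg u])
  rw [Real.norm_eq_abs, abs_of_nonneg (by positivity)]
  refine (pow_le_pow_left₀ (norm_nonneg _) (hC u) 2).trans ?_
  rw [mul_pow]
  refine mul_le_mul_of_nonneg_left ?_ (sq_nonneg _)
  nlinarith

/-! ### A Hankel operator with inner symbol is an isometric involution -/

theorem integral_norm_sq_eq {f : ℝ → ℂ} : ((∫ x, ‖f x‖ ^ 2 : ℝ) : ℂ) = ∫ x, f x * star (f x) := by
  rw [← integral_complex_ofReal]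
  refine integral_congr_ae (ae_of_all _ fun x => ?_)
  simp only [Complex.star_def, Complex.mul_conj']
  push_cast
  rfl

theorem integral_norm_sq_fourier {f : ℝ → ℂ} (hf1 : Integrable f) (hf : MemLp f 2) :
    ∫ x, ‖𝓕 f x‖ ^ 2 = ∫ x, ‖f x‖ ^ 2 := by
  have := integral_fourier_mul_star hf1 hf hf1 hf
  rw [← integral_norm_sq_eq, ← integral_norm_sq_eq] at this
  exact_mod_cast this

theorem integral_norm_sq_fourierInt {f : ℝ → ℂ} (hf1 : Integrable f) (hf : MemLp f 2) :
    ∫ u : ℝ, ‖fourierInt f (-(u : ℂ))‖ ^ 2 = 2 * Real.pi * ∫ x, ‖f x‖ ^ 2 := by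
  have h := integral_fourierInt_mul_star (v := 0) (f := f) (g := f) (by simpa using hf1)
    (by simpa using hf) (by simpa using hf1) (by simpa using hf)
  simp only [Complex.ofReal_zero, zero_mul, add_zero, mul_zero, neg_zero, Real.exp_zero,
    Complex.ofReal_one, mul_one] at h
  rw [← integral_norm_sq_eq, ← integral_norm_sq_eq] at h
  have h2 := integral_neg_eq_self (fun u : ℝ => ‖fourierInt f (u : ℂ)‖ ^ 2) volume
  simp only [Complex.ofReal_neg] at h2
  rw [h2]
  exact_mod_cast h

/-- On a line Im w = v > c, the transform of g is θ(w) f̂(-w). This product decays and is analytic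
for every v > 0 because θ is bounded, so inversion on a high line can be moved down to any v > 0.
Plancherel on that line and v → 0, where |θ| → 1, give equality of norms. -/
theorem hankel_isometry_of_contDiff {k : C(ℝ, ℝ)} (h3 : CondK3 k) {c C : ℝ} (hc0 : 0 < c)
    (hC : ∀ x, |k x| ≤ C * Real.exp (c * x)) {θ : ℂ → ℂ}
    (hθ : DifferentiableOn ℂ θ {z | 0 < z.im}) {M : ℝ} (hM : ∀ z : ℂ, 0 < z.im → ‖θ z‖ ≤ M)
    (hθ1 : ∀ᵐ x : ℝ, Tendsto (fun y : ℝ => ‖θ ((x : ℂ) + (y : ℂ) * Complex.I)‖) (𝓝[>] 0) (𝓝 1))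
    (hθk : ∀ z : ℂ, c < z.im → θ z = fourierInt (fun x => (k x : ℂ)) z)
    {f : ℝ → ℂ} (hf : ContDiff ℝ 2 f) (hs : HasCompactSupport f) :
    MemLp (fun x => ∫ y, (k (x + y) : ℂ) * f y) 2 ∧
      ∫ x, ‖∫ y, (k (x + y) : ℂ) * f y‖ ^ 2 = ∫ x, ‖f x‖ ^ 2 := by
  set g : ℝ → ℂ := fun x => ∫ y, (k (x + y) : ℂ) * f y with hg
  have hfm : MemLp f 2 := hf.continuous.memLp_of_hasCompactSupport hs
  obtain ⟨R, hR⟩ := hs.isCompact.isBounded.subset_closedBall 0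
  have hR' : ∀ y, f y ≠ 0 → |y| ≤ R := by
    intro y hy
    have := hR (subset_tsupport f hy)
    simpa using this
  have hgc : Continuous g := continuous_hankel (R := R) h3 hfm (ae_of_all _ fun y hy => by
    by_contra hc
    exact absurd ((le_abs_self y).trans (hR' y hc)) (not_le.2 hy))
  have hg0 : ∀ x, x < -R → g x = 0 := by
    intro x hx
    refine integral_eq_zero_of_ae (ae_of_all _ fun y => ?_)
    by_cases hy : f y = 0
    · simp [hy]
    · have : k (x + y) = 0 := h3 _ (by linarith [(abs_le.1 (hR' y hy)).2])
      simp [this]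
  have hM0 : 0 ≤ M := (norm_nonneg _).trans (hM Complex.I (by simp))
  -- `L v` is the expected transform of g on the line of height v; it agrees with the actual one as
  -- soon as v > c.
  set L : ℝ → ℝ → ℂ := fun v u => θ ((u : ℂ) + (v : ℂ) * Complex.I) *
    fourierInt f (-((u : ℂ) + (v : ℂ) * Complex.I)) with hL
  have hfd : Differentiable ℂ (fourierInt f) := fun z =>
    differentiableAt_fourierInt (a := z.im - 1) (b := z.im + 1) hf.continuous.aestronglyMeasurable
      (integrable_mul_exp_of_compactSupport hf.continuous hs _)
      (integrable_mul_exp_of_compactSupport hf.continuous hs _) (by linarith) (by linarith)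
  have hdec : ∀ V : ℝ, ∃ D : ℝ, 0 ≤ D ∧ ∀ u v : ℝ, 0 < v → v ≤ V → ‖L v u‖ ≤ D * (1 + u ^ 2)⁻¹ := by
    intro V
    obtain ⟨D, hD0, hD⟩ := exists_fourierInt_decay hf hs V
    refine ⟨M * D, by positivity, fun u v hv hvV => ?_⟩
    rw [hL, norm_mul, mul_assoc]
    refine mul_le_mul (hM _ (by simpa using hv)) ?_ (norm_nonneg _) hM0
    have := hD (-((u : ℂ) + (v : ℂ) * Complex.I)) (by simpa [abs_of_pos hv] using hvV)
    simpa using this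
  have hLc : ∀ v : ℝ, 0 < v → Continuous (L v) := by
    intro v hv
    refine Continuous.mul ?_ (hfd.continuous.comp (by fun_prop))
    exact hθ.continuousOn.comp_continuous (by fun_prop) fun u => by simpa using hv
  have hLm : ∀ v : ℝ, 0 < v → Integrable (L v) ∧ MemLp (L v) 2 := by
    intro v hv
    obtain ⟨D, -, hD⟩ := hdec v
    exact memLp_two_of_decay (hLc v hv) fun u => hD u v hv le_rfl
  have hpi : (-(2 * Real.pi)) ≠ 0 := by simp [Real.pi_ne_zero]
  -- Rescaling by -2π matches the convention of the Fourier transform `𝓕`.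
  set H : ℝ → ℝ → ℂ := fun v ξ => L v (-(2 * Real.pi) * ξ) with hH
  have hHm : ∀ v : ℝ, 0 < v → Integrable (H v) ∧ MemLp (H v) 2 := by
    intro v hv
    obtain ⟨h1, h2⟩ := hLm v hv
    refine ⟨h1.comp_mul_left' hpi, ?_⟩
    have hHc : Continuous (H v) := (hLc v hv).comp (by fun_prop)
    rw [memLp_two_iff_integrable_sq_norm hHc.aestronglyMeasurable]
    rw [memLp_two_iff_integrable_sq_norm (hLc v hv).aestronglyMeasurable] at h2
    exact h2.comp_mul_left' hpi
  have hHinv : ∀ v : ℝ, ∀ x : ℝ, 𝓕⁻ (H v) x = (2 * Real.pi : ℂ)⁻¹ *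
      ∫ u : ℝ, L v u * Complex.exp (-(Complex.I * u * x)) := by
    intro v x
    rw [Real.fourierInv_eq']
    have h := Measure.integral_comp_mul_left
      (fun u : ℝ => L v u * Complex.exp (-(Complex.I * u * x))) (-(2 * Real.pi))
    have e : |(-(2 * Real.pi))⁻¹| = (2 * Real.pi)⁻¹ := by
      rw [abs_inv, abs_neg, abs_of_pos Real.two_pi_pos]
    rw [e, Complex.real_smul] at h
    push_cast at h
    rw [← h]
    refine integral_congr_ae (ae_of_all _ fun ξ => ?_)
    simp only [smul_eq_mul, hH, RCLike.inner_apply, conj_trivial]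
    rw [mul_comm]
    congr 2
    push_cast
    ring
  -- inversion for large `v`
  have hbig : ∀ v : ℝ, c < v → ∀ x, g x * (Real.exp (-v * x) : ℂ) = 𝓕⁻ (H v) x := by
    intro v hv x
    have hk := integrable_kernel_exp h3 hC hv
    have hfour : ∀ u : ℝ, Integrable (fun x : ℝ => g x * Complex.exp (Complex.I * ((u : ℂ) + (v : ℂ) * Complex.I) * x)) ∧
        fourierInt g ((u : ℂ) + (v : ℂ) * Complex.I) = L v u := by
      intro u
      have h := fourierInt_hankel (k := fun x => (k x : ℂ)) (f := f)
        (w := (u : ℂ) + (v : ℂ) * Complex.I)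
        (integrable_mul_exp_of_re hk (by simp))
        (integrable_mul_exp_of_re (v := -v)
          (integrable_mul_exp_of_compactSupport hf.continuous hs _) (by simp))
      refine ⟨h.1, h.2.trans ?_⟩
      simp only [hL]
      rw [hθk ((u : ℂ) + (v : ℂ) * Complex.I) (by simpa using hv)]
    have hint : Integrable fun x => g x * (Real.exp (-v * x) : ℂ) := by
      have := integrable_mul_exp_real_of_complex (hfour 0).1
      simpa using this
    have hF : 𝓕 (fun x => g x * (Real.exp (-v * x) : ℂ)) = H v := by
      ext ξ
      simp only [hH]
      rw [← (hfour _).2, fourierInt_eq_fourier]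
      field_simp
    have hinv := Continuous.fourierInv_fourier_eq (f := fun x => g x * (Real.exp (-v * x) : ℂ))
      (by fun_prop) hint (by rw [hF]; exact (hHm v (hc0.trans hv)).1)
    rw [hF] at hinv
    rw [hinv]
  -- inversion for all `v`
  have hall : ∀ v : ℝ, 0 < v → ∀ x, g x * (Real.exp (-v * x) : ℂ) = 𝓕⁻ (H v) x := by
    intro v hv x
    set F : ℂ → ℂ := fun w => θ w * fourierInt f (-w) * Complex.exp (-(Complex.I * w * x)) with hF
    -- The height v + c + 1 is an arbitrary choice above both v and c, where inversion is already
    -- known.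
    obtain ⟨D, hD0, hD⟩ := hdec (v + c + 1)
    have hline := integral_line_eq (F := F) (v₁ := v) (v₂ := v + c + 1)
      (C := D * Real.exp ((v + c + 1) * |x|))
      ((hθ.mul (hfd.comp differentiable_neg).differentiableOn).mul (by fun_prop)) hv (by linarith) (by
        intro u v' h1 h2
        have h3 := hD u v' (hv.trans_le h1) h2
        rw [hF, norm_mul, mul_right_comm D]
        refine mul_le_mul h3 ?_ (norm_nonneg _) (by positivity)
        rw [Complex.norm_exp]
        refine Real.exp_le_exp.2 ?_
        simp only [Complex.neg_re, Complex.mul_re, Complex.mul_im, Complex.I_re, Complex.I_im,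
          Complex.add_re, Complex.add_im, Complex.ofReal_re, Complex.ofReal_im]
        have : v' * x ≤ (v + c + 1) * |x| := (mul_le_mul_of_nonneg_left (le_abs_self x)
          (hv.trans_le h1).le).trans (mul_le_mul_of_nonneg_right h2 (abs_nonneg x))
        linarith)
    have hFL : ∀ v' : ℝ, ∫ u : ℝ, F ((u : ℂ) + (v' : ℂ) * Complex.I) =
        (Real.exp (v' * x) : ℂ) * ((2 * Real.pi : ℂ) * 𝓕⁻ (H v') x) := by
      intro v'
      rw [hHinv, mul_inv_cancel_left₀ (by exact_mod_cast Real.two_pi_pos.ne'), ← integral_const_mul]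
      refine integral_congr_ae (ae_of_all _ fun u => ?_)
      have : Complex.exp (-(Complex.I * ((u : ℂ) + (v' : ℂ) * Complex.I) * x)) =
          (Real.exp (v' * x) : ℂ) * Complex.exp (-(Complex.I * u * x)) := by
        rw [Complex.ofReal_exp, ← Complex.exp_add]
        congr 1
        push_cast
        linear_combination (-v' * x : ℂ) * Complex.I_sq
      simp only [hF, this, hL]
      ring
    rw [hFL, hFL, ← hbig (v + c + 1) (by linarith) x] at hline
    have hexp : ∀ v' : ℝ, (Real.exp (v' * x) : ℂ) * (Real.exp (-v' * x) : ℂ) = 1 := by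
      intro v'
      rw [← Complex.ofReal_mul, ← Real.exp_add]
      simp
    have h2pi : (2 * Real.pi : ℂ) ≠ 0 := by exact_mod_cast Real.two_pi_pos.ne'
    apply mul_left_cancel₀ h2pi
    have e1 := hexp v
    have e2 := hexp (v + c + 1)
    linear_combination ((2 * Real.pi : ℂ) * 𝓕⁻ (H v) x) * e1 - (Real.exp (-v * x) : ℂ) * hline -
      (2 * Real.pi * g x * (Real.exp (-v * x) : ℂ)) * e2
  have hpl : ∀ v : ℝ, 0 < v → Integrable (fun x => ‖g x * (Real.exp (-v * x) : ℂ)‖ ^ 2) ∧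
      ∫ x, ‖g x * (Real.exp (-v * x) : ℂ)‖ ^ 2 = (2 * Real.pi)⁻¹ * ∫ u, ‖L v u‖ ^ 2 := by
    intro v hv
    obtain ⟨hH1, hH2⟩ := hHm v hv
    have e : ∀ x, g x * (Real.exp (-v * x) : ℂ) = 𝓕 (H v) (-x) := fun x => by
      rw [hall v hv x, Real.fourierInv_eq_fourier_neg]
    simp only [e]
    have hFm := memLp_fourier hH1 hH2
    constructor
    · exact ((memLp_two_iff_integrable_sq_norm hFm.1).1 hFm).comp_neg
    · rw [integral_neg_eq_self (fun x => ‖𝓕 (H v) x‖ ^ 2) volume, integral_norm_sq_fourier hH1 hH2,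
        Measure.integral_comp_mul_left (fun u => ‖L v u‖ ^ 2), abs_inv, abs_neg,
        abs_of_pos Real.two_pi_pos, smul_eq_mul]
  set vn : ℕ → ℝ := fun n => 1 / ((n : ℝ) + 1) with hvn
  have hvn0 : ∀ n, 0 < vn n := fun n => Nat.one_div_pos_of_nat
  have hvn1 : ∀ n, vn n ≤ 1 := fun n => by
    rw [hvn, div_le_one (by positivity)]
    linarith [(Nat.cast_nonneg n : (0 : ℝ) ≤ n)]
  have hvnt : Tendsto vn atTop (𝓝 0) := tendsto_one_div_add_atTop_nhds_zero_nat
  have hvnt' : Tendsto vn atTop (𝓝[>] 0) :=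
    tendsto_nhdsWithin_iff.2 ⟨hvnt, Eventually.of_forall hvn0⟩
  have hlim : Tendsto (fun n => (2 * Real.pi)⁻¹ * ∫ u, ‖L (vn n) u‖ ^ 2) atTop
      (𝓝 (∫ x, ‖f x‖ ^ 2)) := by
    have hfi : Integrable f := hf.continuous.integrable_of_hasCompactSupport hs
    have e : ∫ x, ‖f x‖ ^ 2 = (2 * Real.pi)⁻¹ * ∫ u : ℝ, ‖fourierInt f (-(u : ℂ))‖ ^ 2 := by
      rw [integral_norm_sq_fourierInt hfi hfm, inv_mul_cancel_left₀ Real.two_pi_pos.ne']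
    rw [e]
    refine Tendsto.const_mul _ ?_
    obtain ⟨D, hD0, hD⟩ := hdec 1
    refine tendsto_integral_of_dominated_convergence (fun u => (D * (1 + u ^ 2)⁻¹) ^ 2)
      (fun n => ((hLc _ (hvn0 n)).norm.pow 2).aestronglyMeasurable) ?_
      (fun n => ae_of_all _ fun u => ?_) ?_
    · have hc : Continuous fun u : ℝ => (((D * (1 + u ^ 2)⁻¹ : ℝ)) : ℂ) := by
        refine Complex.continuous_ofReal.comp (continuous_const.mul (Continuous.inv₀ (by fun_prop) ?_))
        intro u
        positivity
      have := (memLp_two_of_decay (C := D) hc fun u => by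
        rw [Complex.norm_real, Real.norm_eq_abs, abs_of_nonneg (by positivity)]).2
      rw [memLp_two_iff_integrable_sq_norm hc.aestronglyMeasurable] at this
      refine this.congr (ae_of_all _ fun u => ?_)
      simp only [Complex.norm_real, Real.norm_eq_abs, sq_abs]
    · rw [Real.norm_eq_abs, abs_of_nonneg (by positivity)]
      exact pow_le_pow_left₀ (norm_nonneg _) (hD u _ (hvn0 n) (hvn1 n)) 2
    · filter_upwards [hθ1] with u hu
      have h1 := hu.comp hvnt'
      have hcc : Continuous fun v : ℝ => fourierInt f (-((u : ℂ) + (v : ℂ) * Complex.I)) :=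
        hfd.continuous.comp (by fun_prop)
      have h2 := ((hcc.tendsto 0).comp hvnt).norm
      have h3 := (h1.mul h2).pow 2
      simp only [Complex.ofReal_zero, zero_mul, add_zero, one_mul] at h3
      refine h3.congr fun n => ?_
      simp only [Function.comp_apply, hL, norm_mul]
  have hlim2 : Tendsto (fun n => ∫ x, ‖g x * (Real.exp (-(vn n) * x) : ℂ)‖ ^ 2) atTop
      (𝓝 (∫ x, ‖f x‖ ^ 2)) := hlim.congr fun n => ((hpl _ (hvn0 n)).2).symm
  have hpt : ∀ x, Tendsto (fun n => ‖g x * (Real.exp (-(vn n) * x) : ℂ)‖ ^ 2) atTop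
      (𝓝 (‖g x‖ ^ 2)) := by
    intro x
    have hcc : Continuous fun v : ℝ => ‖g x * (Real.exp (-v * x) : ℂ)‖ ^ 2 := by fun_prop
    have := (hcc.tendsto 0).comp hvnt
    simpa [Function.comp_def] using this
  -- Fatou's lemma: the damped functions converge pointwise to g, and their squared norms converge
  -- to ∫ ‖f‖².
  have hgi : Integrable fun x => ‖g x‖ ^ 2 := by
    refine integrable_of_tendsto (ae_of_all _ hpt) (fun n => by fun_prop) ?_
    have e : ∀ n, ∫⁻ x, ‖‖g x * (Real.exp (-(vn n) * x) : ℂ)‖ ^ 2‖ₑ =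
        ENNReal.ofReal (∫ x, ‖g x * (Real.exp (-(vn n) * x) : ℂ)‖ ^ 2) := by
      intro n
      rw [ofReal_integral_eq_lintegral_ofReal (hpl _ (hvn0 n)).1
        (ae_of_all _ fun x => by positivity)]
      refine lintegral_congr fun x => ?_
      rw [Real.enorm_eq_ofReal (by positivity)]
    simp only [e]
    rw [(ENNReal.tendsto_ofReal hlim2).liminf_eq]
    exact ENNReal.ofReal_ne_top
  refine ⟨(memLp_two_iff_integrable_sq_norm hgc.aestronglyMeasurable).2 hgi, ?_⟩
  refine tendsto_nhds_unique ?_ hlim2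
  -- The damping e^{-2vx} exceeds one only for x < 0. As g vanishes left of -R and v ≤ 1, it is at
  -- most e^{2|R|} wherever it matters.
  refine tendsto_integral_of_dominated_convergence (fun x => Real.exp (2 * |R|) * ‖g x‖ ^ 2)
    (fun n => by fun_prop) (hgi.const_mul _) (fun n => ae_of_all _ fun x => ?_) (ae_of_all _ hpt)
  rw [Real.norm_eq_abs, abs_of_nonneg (by positivity), norm_mul, mul_pow, mul_comm (_ ^ 2)]
  rcases lt_or_ge x (-R) with h | h
  · simp [hg0 x h]
  · refine mul_le_mul_of_nonneg_right ?_ (sq_nonneg _)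
    rw [Complex.norm_real, Real.norm_eq_abs, Real.abs_exp, ← Real.exp_nat_mul]
    refine Real.exp_le_exp.2 ?_
    have h1 : -x ≤ |R| := by linarith [le_abs_self R]
    have h2 : vn n * -x ≤ vn n * |R| := mul_le_mul_of_nonneg_left h1 (hvn0 n).le
    have h3 : vn n * |R| ≤ |R| := mul_le_of_le_one_left (abs_nonneg _) (hvn1 n)
    push_cast
    linarith

/-- The kernel `k`, of exponential type `c` and supported in `[0,∞)`, has the inner function `θ` as
its Fourier transform. -/
structure HasInnerSymbol (k : C(ℝ, ℝ)) (c : ℝ) (θ : ℂ → ℂ) : Prop where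
  support : CondK3 k
  c_pos : 0 < c
  growth : ∃ C, ∀ x, |k x| ≤ C * Real.exp (c * x)
  isInner : IsInner θ
  fourier : ∀ z : ℂ, c < z.im → θ z = fourierInt (fun x => (k x : ℂ)) z

theorem IsInner.differentiableOn {θ : ℂ → ℂ} (h : IsInner θ) :
    DifferentiableOn ℂ θ {z | 0 < z.im} := h.analytic.differentiableOn

theorem toLp_norm_sq {f : ℝ → ℂ} (hf : MemLp f 2) : ‖hf.toLp f‖ ^ 2 = ∫ x, ‖f x‖ ^ 2 := by
  rw [← inner_self_eq_norm_sq (𝕜 := ℂ), L2.inner_def]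
  have e : ∫ x, inner ℂ ((hf.toLp f) x) ((hf.toLp f) x) = ((∫ x, ‖f x‖ ^ 2 : ℝ) : ℂ) := by
    rw [← integral_complex_ofReal]
    refine integral_congr_ae ?_
    filter_upwards [hf.coeFn_toLp] with x hx
    rw [hx, inner_self_eq_norm_sq_to_K]
    push_cast
    rfl
  rw [e]
  exact Complex.ofReal_re _

section Isometry

variable {k : C(ℝ, ℝ)} {c : ℝ} {θ : ℂ → ℂ}

theorem HasInnerSymbol.norm_hankel_toLp (h : HasInnerSymbol k c θ) {f : ℝ → ℂ}
    (hf : ContDiff ℝ 2 f) (hs : HasCompactSupport f) (hfm : MemLp f 2) :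
    ∃ hg : MemLp (fun x => ∫ y, (k (x + y) : ℂ) * f y) 2, ‖hg.toLp _‖ = ‖hfm.toLp f‖ := by
  obtain ⟨C, hC⟩ := h.growth
  obtain ⟨M, hM⟩ := h.isInner.bounded
  obtain ⟨hg, he⟩ := hankel_isometry_of_contDiff h.support h.c_pos hC h.isInner.differentiableOn hM
    h.isInner.boundary h.fourier hf hs
  refine ⟨hg, ?_⟩
  rw [← toLp_norm_sq hg, ← toLp_norm_sq hfm] at he
  exact (sq_eq_sq₀ (norm_nonneg _) (norm_nonneg _)).1 he

/-- For a test function supported well to the left of S, K[S] is the isometry followed by a cut-off,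
hence contractive. A general input is truncated to (-s,s) and approximated by such functions, using
only that K[S] is bounded. -/
theorem HasInnerSymbol.norm_sqOp_le_one (h : HasInnerSymbol k c θ) (s : ℝ) (hs : 0 ≤ s) :
    ‖sqOp k s‖ ≤ 1 := by
  have htest : ∀ {f : ℝ → ℂ} (_ : ContDiff ℝ 2 f) (_ : HasCompactSupport f) (hfm : MemLp f 2) (S : ℝ),
      (∀ y, S - 1 < y → f y = 0) → ‖sqOp k S (hfm.toLp f)‖ ≤ ‖hfm.toLp f‖ := by
    intro f hf hfs hfm S hfS
    obtain ⟨hg, hgn⟩ := h.norm_hankel_toLp hf hfs hfm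
    rw [← hgn]
    have hae : ∀ᵐ y : ℝ, S - 1 < y → (hfm.toLp f) y = 0 := by
      filter_upwards [hfm.coeFn_toLp] with y hy hyS
      rw [hy, hfS y hyS]
    refine Lp.norm_le_norm_of_ae_le ?_
    filter_upwards [sqOp_ae_eq_indicator h.support hae (sub_one_lt S), hg.coeFn_toLp] with x h1 h2
    rw [h1, h2]
    refine (norm_indicator_le_norm_self _ _).trans (le_of_eq ?_)
    congr 1
    refine integral_congr_ae ?_
    filter_upwards [hfm.coeFn_toLp] with y hy
    rw [hy]
  -- The cut-off is one on (-s,s) and vanishes beyond s + 2, so approximants multiplied by it vanish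
  -- beyond S - 1 with S = s + 3, and approximate at least as well.
  let χ : ContDiffBump (0 : ℝ) := ⟨s + 1, s + 2, by linarith, by linarith⟩
  have hχ1 : ∀ x ∈ Set.Ioo (-s) s, χ x = 1 := fun x hx => χ.one_of_mem_closedBall (by
    rw [mem_closedBall_zero_iff, Real.norm_eq_abs, abs_le]
    constructor
    · show -(s + 1) ≤ x
      linarith [hx.1]
    · show x ≤ s + 1
      linarith [hx.2])
  refine ContinuousLinearMap.opNorm_le_bound _ zero_le_one fun f => ?_
  rw [one_mul]
  refine le_of_forall_pos_le_add fun ε hε => ?_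
  set S : ℝ := s + 3 with hS
  have hfm : MemLp ((Set.Ioo (-s) s).indicator f) 2 (volume : Measure ℝ) :=
    (Lp.memLp f).indicator measurableSet_Ioo
  have hsub : Set.Ioo (-s) s ⊆ Set.Ioo (-S) S := Set.Ioo_subset_Ioo (by linarith) (by linarith)
  have h1 : ‖sqOp k s f‖ ≤ ‖sqOp k S (hfm.toLp _)‖ := by
    refine Lp.norm_le_norm_of_ae_le ?_
    filter_upwards [sqOp_coeFn k s f, sqOp_coeFn k S (hfm.toLp _)] with x hx1 hx2
    rw [hx1, hx2]
    by_cases hx : x ∈ Set.Ioo (-s) s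
    · rw [rectFun, rectFun, Set.indicator_of_mem hx, Set.indicator_of_mem (hsub hx)]
      refine le_of_eq (congrArg _ ?_)
      rw [← integral_indicator measurableSet_Ioo, ← integral_indicator measurableSet_Ioo]
      refine integral_congr_ae ?_
      filter_upwards [hfm.coeFn_toLp] with y hy
      by_cases hys : y ∈ Set.Ioo (-s) s
      · rw [Set.indicator_of_mem hys, Set.indicator_of_mem (hsub hys), hy, Set.indicator_of_mem hys]
      · rw [Set.indicator_of_notMem hys, Set.indicator_apply, hy, Set.indicator_of_notMem hys]
        simp
    · rw [rectFun, Set.indicator_of_notMem hx, norm_zero]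
      exact norm_nonneg _
  have h2 : ‖hfm.toLp _‖ ≤ ‖f‖ := by
    refine Lp.norm_le_norm_of_ae_le ?_
    filter_upwards [hfm.coeFn_toLp] with x hx
    rw [hx]
    exact norm_indicator_le_norm_self _ _
  obtain ⟨g, hgs, hgd, hgε⟩ := MemLp.exist_eLpNorm_sub_le (p := 2) (by simp) (by norm_num) hfm
    (show 0 < ε / (‖sqOp k S‖ + 1) by positivity)
  set G : ℝ → ℂ := fun x => (χ x : ℂ) * g x with hG
  have hGd : ContDiff ℝ 2 G :=
    (Complex.ofRealCLM.contDiff.comp (χ.contDiff (n := 2))).mul (contDiff_infty.1 hgd 2)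
  have hGs : HasCompactSupport G := hgs.mul_left
  have hGm : MemLp G 2 := hGd.continuous.memLp_of_hasCompactSupport hGs
  have h3 : ‖hfm.toLp _ - hGm.toLp G‖ ≤ ε / (‖sqOp k S‖ + 1) := by
    rw [← MemLp.toLp_sub, Lp.norm_toLp]
    refine ENNReal.toReal_le_of_le_ofReal (by positivity) (le_trans (eLpNorm_mono fun x => ?_) hgε)
    simp only [Pi.sub_apply, hG]
    by_cases hx : x ∈ Set.Ioo (-s) s
    · rw [hχ1 x hx, Complex.ofReal_one, one_mul]
    · rw [Set.indicator_of_notMem hx, zero_sub, zero_sub, norm_neg, norm_neg, norm_mul,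
        Complex.norm_real, Real.norm_eq_abs, abs_of_nonneg χ.nonneg]
      exact mul_le_of_le_one_left (norm_nonneg _) χ.le_one
  have h4 : ‖sqOp k S (hGm.toLp G)‖ ≤ ‖hGm.toLp G‖ := by
    refine htest hGd hGs hGm S fun y hy => ?_
    rw [hG]
    simp only
    rw [χ.zero_of_le_dist, Complex.ofReal_zero, zero_mul]
    rw [dist_zero_right, Real.norm_eq_abs]
    show s + 2 ≤ |y|
    linarith [le_abs_self y]
  have h5 : ‖sqOp k S (hfm.toLp _ - hGm.toLp G)‖ ≤ ‖sqOp k S‖ * (ε / (‖sqOp k S‖ + 1)) :=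
    ((sqOp k S).le_opNorm _).trans (mul_le_mul_of_nonneg_left h3 (norm_nonneg _))
  have h6 : ‖sqOp k S (hfm.toLp _)‖ ≤ ‖sqOp k S (hfm.toLp _ - hGm.toLp G)‖ + ‖sqOp k S (hGm.toLp G)‖ := by
    rw [map_sub]
    exact norm_le_norm_sub_add _ _
  have h7 : ‖hGm.toLp G‖ ≤ ‖hfm.toLp _ - hGm.toLp G‖ + ‖hfm.toLp _‖ := by
    rw [norm_sub_rev]
    exact norm_le_norm_sub_add _ _
  have h8 : ‖sqOp k S‖ * (ε / (‖sqOp k S‖ + 1)) + ε / (‖sqOp k S‖ + 1) = ε := by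
    field_simp
  linarith

theorem HasInnerSymbol.norm_hankelOp_apply (h : HasInnerSymbol k c θ) (f : L2) :
    ‖hankelOp k f‖ = ‖f‖ := by
  have hcl : IsClosed {f : L2 | ‖hankelOp k f‖ = ‖f‖} :=
    isClosed_eq (hankelOp k).continuous.norm continuous_norm
  refine (Lp.dense_hasCompactSupport_contDiff (p := 2) (by simp)).induction
    (P := fun f => ‖hankelOp k f‖ = ‖f‖) (fun f hf => ?_) hcl f
  obtain ⟨g, hfg, hgs, hgd⟩ := hf
  have hgm : MemLp g 2 := hgd.continuous.memLp_of_hasCompactSupport hgs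
  have hfe : f = hgm.toLp g := by
    apply Lp.ext
    exact hfg.trans hgm.coeFn_toLp.symm
  obtain ⟨hG, hGn⟩ := h.norm_hankel_toLp (contDiff_infty.1 hgd 2) hgs hgm
  obtain ⟨R, hR⟩ := hgs.isCompact.isBounded.subset_closedBall 0
  rw [hfe, ← hGn]
  congr 1
  apply Lp.ext
  have hae : ∀ᵐ y : ℝ, R < y → (hgm.toLp g) y = 0 := by
    filter_upwards [hgm.coeFn_toLp] with y hy hyR
    rw [hy]
    by_contra hc
    have := hR (subset_tsupport g hc)
    rw [mem_closedBall_zero_iff, Real.norm_eq_abs] at this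
    linarith [le_abs_self y]
  filter_upwards [hankelOp_ae_eq h.support h.norm_sqOp_le_one hae, hG.coeFn_toLp] with x h1 h2
  rw [h1, h2]
  refine integral_congr_ae ?_
  filter_upwards [hgm.coeFn_toLp] with y hy
  rw [hy]

/-- An isometry T satisfies T*T = 1, and here T* = T. -/
theorem HasInnerSymbol.hankelOp_hankelOp (h : HasInnerSymbol k c θ) (f : L2) :
    hankelOp k (hankelOp k f) = f := by
  refine ext_inner_right ℂ fun g => ?_
  rw [inner_hankelOp h.support h.norm_sqOp_le_one]
  exact (LinearMap.norm_map_iff_inner_map_map (𝕜 := ℂ) (hankelOp k)).1 h.norm_hankelOp_apply f g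

end Isometry

/-! ### The reproducing kernel as an orthogonal projection -/

theorem isClosed_L2Ioi (t : ℝ) : IsClosed (L2Ioi t : Set L2) := by
  have : (L2Ioi t : Set L2) =
      (LpToLpRestrictCLM ℝ ℂ ℂ (volume : Measure ℝ) 2 (Set.Iio t)) ⁻¹' {0} := by
    ext f
    rw [Set.mem_preimage, Set.mem_singleton_iff, Lp.eq_zero_iff_ae_eq_zero]
    have h := LpToLpRestrictCLM_coeFn ℂ (Set.Iio t) f
    constructor
    · intro hf
      refine h.trans ?_
      rw [EventuallyEq, ae_restrict_iff' measurableSet_Iio]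
      exact hf
    · intro hf
      have h2 := h.symm.trans hf
      rw [EventuallyEq, ae_restrict_iff' measurableSet_Iio] at h2
      exact h2
  rw [this]
  exact isClosed_singleton.preimage (ContinuousLinearMap.continuous _)

/-- The function `1_{(t,∞)}(x) e^{-i z̄ x}`. -/
def evalFun (t : ℝ) (z : ℂ) : ℝ → ℂ :=
  (Set.Ioi t).indicator fun x => Complex.exp (-(Complex.I * star z * x))

theorem star_exp_eq (z : ℂ) (x : ℝ) :
    star (Complex.exp (Complex.I * z * x)) = Complex.exp (-(Complex.I * star z * x)) := by
  rw [Complex.star_def, ← Complex.exp_conj]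
  congr 1
  simp

theorem norm_exp_neg_I_star (z : ℂ) (x : ℝ) :
    ‖Complex.exp (-(Complex.I * star z * x))‖ = Real.exp (-z.im * x) := by
  rw [← star_exp_eq, norm_star, norm_exp_I_mul]

theorem integrableOn_exp_sq {v : ℝ} (hv : 0 < v) (t : ℝ) :
    IntegrableOn (fun x : ℝ => Real.exp (-v * x) ^ 2) (Set.Ioi t) ∧
      ∫ x in Set.Ioi t, Real.exp (-v * x) ^ 2 = Real.exp (-(2 * v) * t) / (2 * v) := by
  have e : ∀ x : ℝ, Real.exp (-v * x) ^ 2 = Real.exp (-(2 * v) * x) := by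
    intro x
    rw [← Real.exp_nat_mul]
    push_cast
    ring_nf
  simp_rw [e]
  refine ⟨exp_neg_integrableOn_Ioi t (by positivity), ?_⟩
  rw [integral_exp_mul_Ioi (by linarith)]
  field_simp

theorem memLp_evalFun (t : ℝ) {z : ℂ} (hz : 0 < z.im) :
    MemLp (evalFun t z) 2 ∧ ∫ x, ‖evalFun t z x‖ ^ 2 = Real.exp (-(2 * z.im) * t) / (2 * z.im) := by
  obtain ⟨h1, h2⟩ := integrableOn_exp_sq hz t
  have e : ∀ x, ‖evalFun t z x‖ ^ 2 = (Set.Ioi t).indicator (fun x => Real.exp (-z.im * x) ^ 2) x := by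
    intro x
    by_cases hx : x ∈ Set.Ioi t
    · rw [evalFun, Set.indicator_of_mem hx, Set.indicator_of_mem hx, norm_exp_neg_I_star]
    · rw [evalFun, Set.indicator_of_notMem hx, Set.indicator_of_notMem hx]
      simp
  have hm : AEStronglyMeasurable (evalFun t z) volume :=
    AEStronglyMeasurable.indicator (by fun_prop) measurableSet_Ioi
  rw [memLp_two_iff_integrable_sq_norm hm]
  simp_rw [e]
  exact ⟨h1.integrable_indicator measurableSet_Ioi, by rw [integral_indicator measurableSet_Ioi, h2]⟩

open Classical in
/-- The function `1_{(t,∞)}(x) e^{-i z̄ x}` as an element of `L²`, for `Im z > 0`. -/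
def evalL2 (t : ℝ) (z : ℂ) : L2 :=
  if h : MemLp (evalFun t z) 2 (volume : Measure ℝ) then h.toLp _ else 0

theorem evalL2_coeFn (t : ℝ) {z : ℂ} (hz : 0 < z.im) : evalL2 t z =ᵐ[volume] evalFun t z := by
  rw [evalL2, dif_pos (memLp_evalFun t hz).1]
  exact MemLp.coeFn_toLp _

theorem norm_evalL2_sq (t : ℝ) {z : ℂ} (hz : 0 < z.im) :
    ‖evalL2 t z‖ ^ 2 = Real.exp (-(2 * z.im) * t) / (2 * z.im) := by
  rw [evalL2, dif_pos (memLp_evalFun t hz).1, toLp_norm_sq, (memLp_evalFun t hz).2]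

theorem ae_ne_real (t : ℝ) : ∀ᵐ x : ℝ, x ≠ t := by
  simp [ae_iff]

/-- The conjugate of e^{-i z̄ x} is e^{izx}: evaluation at z is a bounded functional on L²(t,∞),
represented by `evalL2`. -/
theorem fourierInt_eq_inner {t : ℝ} {z : ℂ} (hz : 0 < z.im) {f : L2} (hf : f ∈ L2Ioi t) :
    fourierInt f z = inner ℂ (evalL2 t z) f := by
  rw [L2.inner_def, fourierInt]
  refine integral_congr_ae ?_
  filter_upwards [evalL2_coeFn t hz, hf, ae_ne_real t] with x h1 h2 h3
  rw [h1, RCLike.inner_apply, evalFun]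
  rcases lt_or_gt_of_ne h3 with h | h
  · rw [h2 h, zero_mul, zero_mul]
  · rw [Set.indicator_of_mem (show x ∈ Set.Ioi t from h), ← star_exp_eq, Complex.star_def,
      Complex.conj_conj]

theorem integrable_mul_exp_of_mem_L2Ioi {t : ℝ} {f : L2} (hf : f ∈ L2Ioi t) {v : ℝ} (hv : 0 < v) :
    Integrable fun x => f x * (Real.exp (-v * x) : ℂ) := by
  have h := (memLp_evalFun t (z := (v : ℂ) * Complex.I) (by simpa using hv)).1
  have h2 : Integrable fun x => f x * evalFun t ((v : ℂ) * Complex.I) x :=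
    (Lp.memLp f).integrable_mul h
  refine h2.congr ?_
  filter_upwards [hf, ae_ne_real t] with x h2 h3
  rcases lt_or_gt_of_ne h3 with h | h
  · rw [h2 h, zero_mul, zero_mul]
  · rw [evalFun, Set.indicator_of_mem (show x ∈ Set.Ioi t from h)]
    congr 1
    rw [Complex.ofReal_exp]
    congr 1
    simp only [star_mul', Complex.star_def, Complex.conj_I, Complex.conj_ofReal]
    push_cast
    linear_combination (v * x : ℂ) * Complex.I_sq

theorem memLp_mul_exp_of_mem_L2Ioi {t : ℝ} (ht : 0 ≤ t) {f : L2} (hf : f ∈ L2Ioi t) {v : ℝ}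
    (hv : 0 ≤ v) : MemLp (fun x => f x * (Real.exp (-v * x) : ℂ)) 2 := by
  refine (Lp.memLp f).mono ((Lp.aestronglyMeasurable f).mul (by fun_prop)) ?_
  filter_upwards [hf] with x hx
  rcases lt_or_ge x t with h | h
  · rw [hx h, zero_mul]
  · rw [norm_mul, Complex.norm_real, Real.norm_eq_abs, Real.abs_exp]
    refine mul_le_of_le_one_right (norm_nonneg _) (Real.exp_le_one_iff.2 ?_)
    have := mul_nonneg hv (ht.trans h)
    linarith

theorem differentiableAt_fourierInt_of_mem_L2Ioi {t : ℝ} {f : L2} (hf : f ∈ L2Ioi t) {z : ℂ}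
    (hz : 0 < z.im) : DifferentiableAt ℂ (fourierInt f) z :=
  differentiableAt_fourierInt (a := z.im / 2) (b := z.im + 1) (Lp.aestronglyMeasurable f)
    (integrable_mul_exp_of_mem_L2Ioi hf (by linarith))
    (integrable_mul_exp_of_mem_L2Ioi hf (by linarith)) (by linarith) (by linarith)

/-- The inner product of `H²` is the one of `L²`, up to the factor `2π`. -/
theorem hasHardyInner_of_mem_L2Ioi {t : ℝ} (ht : 0 ≤ t) {f g : L2} (hf : f ∈ L2Ioi t)
    (hg : g ∈ L2Ioi t) {F G : ℂ → ℂ} (hF : ∀ z : ℂ, 0 < z.im → F z = fourierInt f z)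
    (hG : ∀ z : ℂ, 0 < z.im → G z = fourierInt g z) :
    HasHardyInner F G (2 * Real.pi * inner ℂ g f) := by
  have hprod : Integrable fun x => f x * star (g x) := by
    refine (Lp.memLp f).integrable_mul (q := 2) (g := fun x => star (g x)) ?_
    exact (memLp_congr_norm (Lp.aestronglyMeasurable g) (Complex.continuous_conj.comp_aestronglyMeasurable
      (Lp.aestronglyMeasurable g)) (ae_of_all _ fun x => by simp)).1 (Lp.memLp g)
  have e : (2 * Real.pi * inner ℂ g f : ℂ) = 2 * Real.pi * ∫ x, f x * star (g x) := by
    rw [L2.inner_def]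
    congr 1
  rw [e, HasHardyInner]
  have h1 : Tendsto (fun v : ℝ => (2 * Real.pi : ℂ) * ∫ x : ℝ, f x * star (g x) * (Real.exp (-(2 * v) * x) : ℂ))
      (𝓝[>] 0) (𝓝 (2 * Real.pi * ∫ x, f x * star (g x))) := by
    refine Tendsto.const_mul _ ?_
    refine tendsto_integral_filter_of_dominated_convergence (fun x => ‖f x * star (g x)‖) ?_ ?_
      hprod.norm ?_
    · exact Eventually.of_forall fun v => hprod.1.mul (by fun_prop)
    · filter_upwards [self_mem_nhdsWithin] with v hv
      filter_upwards [hf] with x hx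
      rcases lt_or_ge x t with h | h
      · rw [hx h]; simp
      · rw [norm_mul _ (Real.exp _ : ℂ), Complex.norm_real, Real.norm_eq_abs, Real.abs_exp]
        refine mul_le_of_le_one_right (norm_nonneg _) (Real.exp_le_one_iff.2 ?_)
        have := mul_nonneg (le_of_lt hv.out) (ht.trans h)
        linarith
    · refine ae_of_all _ fun x => ?_
      have hc : Continuous fun v : ℝ => f x * star (g x) * (Real.exp (-(2 * v) * x) : ℂ) := by fun_prop
      have := (hc.tendsto 0).mono_left (nhdsWithin_le_nhds (s := Set.Ioi 0))
      simpa using this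
  refine h1.congr' ?_
  filter_upwards [self_mem_nhdsWithin] with v hv
  have hv' : 0 < v := hv
  rw [← integral_fourierInt_mul_star (integrable_mul_exp_of_mem_L2Ioi hf hv')
    (memLp_mul_exp_of_mem_L2Ioi ht hf hv'.le) (integrable_mul_exp_of_mem_L2Ioi hg hv')
    (memLp_mul_exp_of_mem_L2Ioi ht hg hv'.le)]
  refine integral_congr_ae (ae_of_all _ fun u => ?_)
  simp only
  rw [hF _ (by simpa using hv'), hG _ (by simpa using hv')]

/-- The orthogonal projection of `1_{(t,∞)}(x) e^{-i z̄ x}` to (the closure of) `V_t`. -/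
def kernelV (k : ℝ → ℝ) (t : ℝ) (z : ℂ) : L2 :=
  (spaceV k t).topologicalClosure.starProjection (evalL2 t z)

/-- The reproducing kernel of `F(V_t)`. -/
def reproKernel (k : ℝ → ℝ) (t : ℝ) (z w : ℂ) : ℂ :=
  (2 * Real.pi : ℂ)⁻¹ * fourierInt (kernelV k t z) w

section Kernel

variable {k : C(ℝ, ℝ)} {c : ℝ} {θ : ℂ → ℂ}

/-- As the operator is its own inverse, membership in the image of L²(t,∞) can be tested by applying
the operator once more. -/
theorem HasInnerSymbol.mem_spaceV_iff (h : HasInnerSymbol k c θ) {t : ℝ} {f : L2} :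
    f ∈ spaceV k t ↔ f ∈ L2Ioi t ∧ hankelOp k f ∈ L2Ioi t := by
  rw [spaceV, Submodule.mem_inf, Submodule.mem_map]
  refine and_congr_right fun _ => ?_
  constructor
  · rintro ⟨g, hg, rfl⟩
    rw [ContinuousLinearMap.coe_coe, h.hankelOp_hankelOp]
    exact hg
  · intro hf
    exact ⟨_, hf, h.hankelOp_hankelOp f⟩

theorem HasInnerSymbol.topologicalClosure_spaceV (h : HasInnerSymbol k c θ) (t : ℝ) :
    (spaceV k t).topologicalClosure = spaceV k t := by
  refine IsClosed.submodule_topologicalClosure_eq ?_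
  have : (spaceV k t : Set L2) = (L2Ioi t : Set L2) ∩ hankelOp k ⁻¹' (L2Ioi t : Set L2) := by
    ext f
    exact h.mem_spaceV_iff
  rw [this]
  exact (isClosed_L2Ioi t).inter ((isClosed_L2Ioi t).preimage (hankelOp k).continuous)

theorem HasInnerSymbol.kernelV_mem (h : HasInnerSymbol k c θ) (t : ℝ) (z : ℂ) :
    kernelV k t z ∈ spaceV k t := by
  have := Submodule.starProjection_apply_mem (spaceV k t).topologicalClosure (evalL2 t z)
  exact (h.topologicalClosure_spaceV t).le this

theorem HasInnerSymbol.inner_kernelV (h : HasInnerSymbol k c θ) {t : ℝ} {z : ℂ} (hz : 0 < z.im)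
    {f : L2} (hf : f ∈ spaceV k t) : inner ℂ (kernelV k t z) f = fourierInt f z := by
  rw [fourierInt_eq_inner hz (h.mem_spaceV_iff.1 hf).1, kernelV, Submodule.inner_starProjection_left_eq_right,
    Submodule.starProjection_eq_self_iff.2]
  exact (spaceV k t).le_topologicalClosure hf

/-- The factor (2π)⁻¹ in `reproKernel` cancels the 2π between the inner products of H² and L². -/
theorem HasInnerSymbol.isReproducingKernel (h : HasInnerSymbol k c θ) {t : ℝ} (ht : 0 ≤ t) :
    IsReproducingKernel (fourierV k t) (reproKernel k t) := by
  intro z hz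
  have hk := h.kernelV_mem t z
  have hs : ∀ w : ℂ, reproKernel k t z w = fourierInt ((2 * Real.pi : ℂ)⁻¹ • kernelV k t z : L2) w := by
    intro w
    rw [reproKernel, fourierInt, fourierInt, ← integral_const_mul]
    refine integral_congr_ae ?_
    filter_upwards [Lp.coeFn_smul ((2 * Real.pi : ℂ)⁻¹) (kernelV k t z)] with x hx
    rw [hx, Pi.smul_apply, smul_eq_mul]
    ring
  have hmem : (2 * Real.pi : ℂ)⁻¹ • kernelV k t z ∈ spaceV k t := Submodule.smul_mem _ _ hk
  refine ⟨⟨_, hmem, fun w _ => hs w⟩, ?_⟩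
  rintro F ⟨f, hf, hF⟩
  have := hasHardyInner_of_mem_L2Ioi ht (h.mem_spaceV_iff.1 hf).1 (h.mem_spaceV_iff.1 hmem).1 hF
    (G := reproKernel k t z) fun w _ => hs w
  have h2pi : (2 * Real.pi : ℂ) ≠ 0 := by exact_mod_cast Real.two_pi_pos.ne'
  rw [inner_smul_left, h.inner_kernelV hz hf, ← hF z hz] at this
  convert this using 1
  simp only [map_inv₀, map_mul, Complex.conj_ofReal, map_ofNat]
  rw [mul_inv_cancel_left₀ h2pi]

theorem HasInnerSymbol.reproKernel_eq_inner (h : HasInnerSymbol k c θ) {t : ℝ} {z w : ℂ}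
    (hw : 0 < w.im) : reproKernel k t z w =
      (2 * Real.pi : ℂ)⁻¹ * inner ℂ (kernelV k t w) (kernelV k t z) := by
  rw [reproKernel, h.inner_kernelV hw (h.kernelV_mem t z)]

theorem HasInnerSymbol.star_reproKernel (h : HasInnerSymbol k c θ) {t : ℝ} {z w : ℂ}
    (hz : 0 < z.im) (hw : 0 < w.im) : star (reproKernel k t z w) = reproKernel k t w z := by
  rw [h.reproKernel_eq_inner hw, h.reproKernel_eq_inner hz, star_mul', Complex.star_def,
    inner_conj_symm]
  simp only [map_inv₀, map_mul, Complex.conj_ofReal, map_ofNat]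

theorem HasInnerSymbol.differentiableAt_reproKernel (h : HasInnerSymbol k c θ) {t : ℝ} {z w : ℂ}
    (hw : 0 < w.im) : DifferentiableAt ℂ (reproKernel k t z) w :=
  (differentiableAt_fourierInt_of_mem_L2Ioi (h.mem_spaceV_iff.1 (h.kernelV_mem t z)).1 hw).const_mul _

/-- A projection does not increase norms, and ‖e_z‖² = e^{-2t Im z}/(2 Im z) tends to zero;
Cauchy–Schwarz finishes. -/
theorem HasInnerSymbol.tendsto_reproKernel (h : HasInnerSymbol k c θ) {z w : ℂ} (hz : 0 < z.im)
    (hw : 0 < w.im) : Tendsto (fun t => reproKernel k t z w) atTop (𝓝 0) := by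
  have hle : ∀ (t : ℝ) (z : ℂ), ‖kernelV k t z‖ ≤ ‖evalL2 t z‖ := fun t z =>
    Submodule.norm_starProjection_apply_le _ _
  have hlim : ∀ {z : ℂ}, 0 < z.im → Tendsto (fun t => ‖evalL2 t z‖) atTop (𝓝 0) := by
    intro z hz
    have h1 : Tendsto (fun t => ‖evalL2 t z‖ ^ 2) atTop (𝓝 0) := by
      simp_rw [norm_evalL2_sq _ hz]
      have h2 : Tendsto (fun t : ℝ => -(2 * z.im) * t) atTop atBot :=
        tendsto_id.const_mul_atTop_of_neg (by linarith)
      have := (Real.tendsto_exp_atBot.comp h2).div_const (2 * z.im)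
      simpa using this
    have h3 := h1.sqrt
    simpa [Real.sqrt_sq (norm_nonneg _)] using h3
  have hb := ((hlim hw).mul (hlim hz)).const_mul ‖(2 * Real.pi : ℂ)⁻¹‖
  rw [mul_zero, mul_zero] at hb
  refine squeeze_zero_norm (fun t => ?_) hb
  rw [h.reproKernel_eq_inner hw, norm_mul]
  refine mul_le_mul_of_nonneg_left ((norm_inner_le_norm _ _).trans ?_) (norm_nonneg _)
  exact mul_le_mul (hle t w) (hle t z) (norm_nonneg _) (norm_nonneg _)

/-- `V_t` is orthogonal to `L²(-∞,t)` and to its image under the operator. -/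
theorem HasInnerSymbol.eq_kernelV (h : HasInnerSymbol k c θ) {t : ℝ} {z : ℂ} {κ a b : L2}
    (hκ : κ ∈ spaceV k t) (ha : ∀ᵐ x : ℝ, t < x → a x = 0) (hb : ∀ᵐ x : ℝ, t < x → b x = 0)
    (he : κ = evalL2 t z + a + hankelOp k b) : κ = kernelV k t z := by
  have horth : ∀ f ∈ L2Ioi t, ∀ a : L2, (∀ᵐ x : ℝ, t < x → a x = 0) → inner ℂ f a = 0 := by
    intro f hf a ha
    rw [L2.inner_def]
    refine integral_eq_zero_of_ae ?_
    filter_upwards [hf, ha, ae_ne_real t] with x h1 h2 h3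
    rcases lt_or_gt_of_ne h3 with hx | hx
    · simp [h1 hx]
    · simp [h2 hx]
  have : (spaceV k t).topologicalClosure.starProjection (evalL2 t z) = κ := by
    refine Submodule.eq_starProjection_of_mem_of_inner_eq_zero ?_ ?_
    · exact (spaceV k t).le_topologicalClosure hκ
    · intro f hf
      rw [h.topologicalClosure_spaceV] at hf
      obtain ⟨h1, h2⟩ := h.mem_spaceV_iff.1 hf
      have e : evalL2 t z - κ = -(a + hankelOp k b) := by rw [he]; abel
      rw [e, inner_neg_left, neg_eq_zero, ← inner_conj_symm, inner_add_right, horth f h1 a ha,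
        ← inner_hankelOp h.support h.norm_sqOp_le_one, horth _ h2 b hb, add_zero, map_zero]
  rw [kernelV, this]

end Kernel

/-! ### Contractive truncations give a symbol bounded by one -/

/-- A function analytic in the upper half-plane is determined by its values in a half-plane. -/
theorem eqOn_upperHalfPlane {f g : ℂ → ℂ} {c : ℝ} (hc : 0 < c)
    (hf : ∀ z : ℂ, 0 < z.im → DifferentiableAt ℂ f z) (hg : ∀ z : ℂ, 0 < z.im → DifferentiableAt ℂ g z)
    (h : ∀ z : ℂ, c < z.im → f z = g z) {z : ℂ} (hz : 0 < z.im) : f z = g z := by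
  have hopen : IsOpen {z : ℂ | 0 < z.im} := isOpen_lt continuous_const Complex.continuous_im
  have hf' : AnalyticOnNhd ℂ f {z | 0 < z.im} :=
    DifferentiableOn.analyticOnNhd (fun z hz => (hf z hz).differentiableWithinAt) hopen
  have hg' : AnalyticOnNhd ℂ g {z | 0 < z.im} :=
    DifferentiableOn.analyticOnNhd (fun z hz => (hg z hz).differentiableWithinAt) hopen
  have hcon : IsPreconnected {z : ℂ | 0 < z.im} := (convex_halfSpace_im_gt 0).isPreconnected
  have hz₀ : c < (((c + 1 : ℝ) : ℂ) * Complex.I).im := by simp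
  refine hf'.eqOn_of_preconnected_of_eventuallyEq hg' hcon (hc.trans hz₀) ?_ hz
  filter_upwards [(isOpen_lt continuous_const Complex.continuous_im).mem_nhds hz₀] with w hw
  exact h w hw

section Symbol

variable {k : C(ℝ, ℝ)} {c C : ℝ}

/-- The test function is e^{-iζy} on y < 0, written as a reflected `evalFun` so that its norm is
already known. -/
theorem memLp_evalFun_neg {ζ : ℂ} (hζ : 0 < ζ.im) :
    ∃ h : MemLp (fun y : ℝ => evalFun 0 (-star ζ) (-y)) 2, ‖h.toLp _‖ ^ 2 = (2 * ζ.im)⁻¹ := by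
  have hi : (-star ζ).im = ζ.im := by simp
  obtain ⟨h1, h2⟩ := memLp_evalFun 0 (z := -star ζ) (by rwa [hi])
  refine ⟨h1.comp_measurePreserving (Measure.measurePreserving_neg volume), ?_⟩
  rw [toLp_norm_sq, integral_neg_eq_self (fun y => ‖evalFun 0 (-star ζ) y‖ ^ 2), h2, hi]
  simp

theorem fourierInt_evalFun_neg {ζ z : ℂ} (h : 0 < (z + ζ).im) :
    Integrable (fun y : ℝ => evalFun 0 (-star ζ) (-y) * Complex.exp (Complex.I * (-z) * y)) ∧
      fourierInt (fun y : ℝ => evalFun 0 (-star ζ) (-y)) (-z) = Complex.I / (z + ζ) := by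
  have e : (fun y : ℝ => evalFun 0 (-star ζ) (-y) * Complex.exp (Complex.I * (-z) * y)) =
      (Set.Iio 0).indicator fun y : ℝ => Complex.exp (-Complex.I * (z + ζ) * y) := by
    funext y
    by_cases hy : y < 0
    · rw [evalFun, Set.indicator_of_mem (show -y ∈ Set.Ioi 0 by simpa using hy),
        Set.indicator_of_mem (show y ∈ Set.Iio 0 from hy), ← Complex.exp_add]
      congr 1
      simp only [star_neg, star_star, Complex.ofReal_neg]
      ring
    · rw [evalFun, Set.indicator_of_notMem (by simpa using hy), Set.indicator_of_notMem (by simpa using hy),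
        zero_mul]
  have hre : 0 < (-Complex.I * (z + ζ)).re := by simpa using h
  have hne : z + ζ ≠ 0 := fun h0 => by simp [h0] at h
  rw [fourierInt, e, integrable_indicator_iff measurableSet_Iio, integral_indicator measurableSet_Iio,
    ← integral_Iic_eq_integral_Iio, integral_exp_mul_complex_Iic hre]
  refine ⟨(integrableOn_exp_mul_complex_Iic hre 0).mono_set Set.Iio_subset_Iic_self, ?_⟩
  simp only [Complex.ofReal_zero, mul_zero, Complex.exp_zero]
  field_simp
  rw [Complex.I_sq]

/-- If the truncations are contractions, then the Fourier transform of the kernel is bounded by one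
in the upper half-plane. -/
theorem exists_contractive_symbol (h3 : CondK3 k) (hc : 0 < c) (hC : ∀ x, |k x| ≤ C * Real.exp (c * x))
    (hn : ∀ s : ℝ, 0 ≤ s → ‖sqOp k s‖ ≤ 1) :
    ∃ θ : ℂ → ℂ, AnalyticOnNhd ℂ θ {z | 0 < z.im} ∧ (∀ z : ℂ, 0 < z.im → ‖θ z‖ ≤ 1) ∧
      ∀ z : ℂ, c < z.im → θ z = fourierInt (fun x => (k x : ℂ)) z := by
  have key : ∀ ζ : ℂ, 0 < ζ.im → ∃ S : ℂ → ℂ, (∀ z : ℂ, 0 < z.im → DifferentiableAt ℂ S z) ∧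
      (∀ z : ℂ, c < z.im → S z = fourierInt (fun x => (k x : ℂ)) z) ∧
      ∀ z : ℂ, 0 < z.im → ‖S z‖ ^ 2 ≤ ‖z + ζ‖ ^ 2 * ((2 * z.im)⁻¹ * (2 * ζ.im)⁻¹) := by
    intro ζ hζ
    obtain ⟨hm, hw⟩ := memLp_evalFun_neg hζ
    have hR : ∀ᵐ y : ℝ, 0 < y → hm.toLp _ y = 0 := by
      filter_upwards [hm.coeFn_toLp] with y hy h0
      rw [hy, evalFun, Set.indicator_of_notMem (by simpa using h0.le)]
    have hT := hankelOp_ae_eq h3 hn hR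
    have hT' : hankelOp k (hm.toLp _) =ᵐ[volume]
        fun x => ∫ y, (k (x + y) : ℂ) * evalFun 0 (-star ζ) (-y) := by
      refine hT.trans (ae_of_all _ fun x => integral_congr_ae ?_)
      filter_upwards [hm.coeFn_toLp] with y hy
      rw [hy]
    have hmem : hankelOp k (hm.toLp _) ∈ L2Ioi 0 := by
      show ∀ᵐ x : ℝ, x < 0 → hankelOp k (hm.toLp _) x = 0
      filter_upwards [hT'] with x hx hx0
      rw [hx]
      refine integral_eq_zero_of_ae (ae_of_all _ fun y => ?_)
      rcases lt_or_ge y 0 with hy | hy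
      · simp [h3 (x + y) (by linarith)]
      · simp only [evalFun]
        rw [Set.indicator_of_notMem (by simpa using hy), mul_zero, Pi.zero_apply]
    -- The image of the test function has transform θ(z) · i/(z+ζ) for Im z > c. Its support in
    -- [0,∞) makes the transform analytic for Im z > 0, so dividing out i/(z+ζ) continues θ.
    refine ⟨fun z => -Complex.I * (z + ζ) * fourierInt (hankelOp k (hm.toLp _)) z, ?_, ?_, ?_⟩
    · intro z hz
      exact DifferentiableAt.mul (by fun_prop) (differentiableAt_fourierInt_of_mem_L2Ioi hmem hz)
    · intro z hz
      have hzζ : 0 < (z + ζ).im := by rw [Complex.add_im]; linarith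
      obtain ⟨h1, h2⟩ := fourierInt_evalFun_neg hzζ
      have hne : z + ζ ≠ 0 := fun h0 => by simp [h0] at hzζ
      have hk := integrable_mul_exp_of_re (integrable_kernel_exp h3 hC hz) rfl
      simp only
      rw [fourierInt_congr hT', (fourierInt_hankel (k := fun x => (k x : ℂ)) hk h1).2, h2]
      field_simp
      linear_combination (-fourierInt (fun x => (k x : ℂ)) z) * Complex.I_sq
    · intro z hz
      have h1 : ‖fourierInt (hankelOp k (hm.toLp _)) z‖ ≤ ‖evalL2 0 z‖ * ‖hm.toLp _‖ := by
        rw [fourierInt_eq_inner hz hmem]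
        exact (norm_inner_le_norm _ _).trans
          (mul_le_mul_of_nonneg_left (norm_hankelOp_apply_le h3 hn _) (norm_nonneg _))
      have h2 : ‖evalL2 0 z‖ ^ 2 = (2 * z.im)⁻¹ := by rw [norm_evalL2_sq 0 hz]; simp
      rw [norm_mul, norm_mul, norm_neg, Complex.norm_I, one_mul, mul_pow, ← h2, ← hw,
        ← mul_pow ‖evalL2 0 z‖]
      gcongr
  obtain ⟨θ, hd, hf, -⟩ := key Complex.I (by simp)
  refine ⟨θ, DifferentiableOn.analyticOnNhd (fun z hz => (hd z hz).differentiableWithinAt)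
    (isOpen_lt continuous_const Complex.continuous_im), fun z hz => ?_, hf⟩
  -- All continuations agree, so ζ may depend on the point. The choice ζ = -z̄ gives z + ζ = 2i Im z
  -- and turns the bound into exactly one.
  obtain ⟨S, hSd, hSf, hSb⟩ := key (-star z) (by simpa using hz)
  rw [eqOn_upperHalfPlane hc hd hSd (fun w hw => (hf w hw).trans (hSf w hw).symm) hz]
  have h1 := hSb z hz
  have h2 : z + -star z = ((2 * z.im : ℝ) : ℂ) * Complex.I := by
    apply Complex.ext <;> simp
    ring
  have h3 : (-star z).im = z.im := by simp
  rw [h2, h3, norm_mul, Complex.norm_I, mul_one, Complex.norm_real, Real.norm_eq_abs, sq_abs] at h1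
  have h4 : (2 * z.im) ^ 2 * ((2 * z.im)⁻¹ * (2 * z.im)⁻¹) = 1 := by
    field_simp
  rw [h4] at h1
  exact (sq_le_one_iff₀ (norm_nonneg _)).1 h1

end Symbol

theorem countable_of_isDiscrete {S : Set ℂ} (h : IsDiscrete S) : S.Countable :=
  (HereditarilyLindelofSpace.isLindelof S).countable_of_isDiscrete h

theorem isPreconnected_compl_of_countable {S : Set ℂ} (hS : S.Countable) : IsPreconnected Sᶜ :=
  (hS.isConnected_compl_of_one_lt_rank (by simp [Complex.rank_real_complex])).isPreconnected

/-- The upper half-plane minus a countable set is connected. -/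
theorem isPreconnected_upperHalfPlane_diff {S : Set ℂ} (hS : S.Countable) :
    IsPreconnected ({z : ℂ | 0 < z.im} \ S) := by
  -- The map x + iy ↦ x + ie^y carries the plane bijectively and continuously to the half-plane, so
  -- the statement reduces to the complement of a countable set in ℂ.
  set φ : ℂ → ℂ := fun z => (z.re : ℂ) + (Real.exp z.im : ℂ) * Complex.I with hφ
  have hre : ∀ z, (φ z).re = z.re := fun z => by simp [hφ]
  have him : ∀ z, (φ z).im = Real.exp z.im := fun z => by simp [hφ, -Complex.ofReal_exp]
  have hinj : Function.Injective φ := fun z w h => by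
    have h1 := congrArg Complex.re h
    have h2 := congrArg Complex.im h
    rw [hre, hre] at h1
    rw [him, him] at h2
    exact Complex.ext h1 (Real.exp_injective h2)
  have hcont : Continuous φ := by fun_prop
  have e : {z : ℂ | 0 < z.im} \ S = φ '' (φ ⁻¹' S)ᶜ := by
    ext z
    constructor
    · rintro ⟨hz, hzS⟩
      have hz' : φ ((z.re : ℂ) + (Real.log z.im : ℂ) * Complex.I) = z := by
        refine Complex.ext ?_ ?_
        · rw [hre]; simp
        · rw [him]
          have : ((z.re : ℂ) + (Real.log z.im : ℂ) * Complex.I).im = Real.log z.im := by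
            rw [Complex.add_im, Complex.ofReal_im, Complex.im_ofReal_mul, Complex.I_im]
            ring
          rw [this, Real.exp_log hz]
      refine ⟨_, ?_, hz'⟩
      rwa [Set.mem_compl_iff, Set.mem_preimage, hz']
    · rintro ⟨w, hw, rfl⟩
      refine ⟨?_, hw⟩
      show 0 < (φ w).im
      rw [him]
      exact Real.exp_pos _
  rw [e]
  exact (isPreconnected_compl_of_countable (hS.preimage_of_injOn hinj.injOn)).image _ hcont.continuousOn

/-! ### E and its quotient E♯/E off the exceptional set -/

section Structure

variable {E : ℂ → ℂ} {c : ℝ} {Z : Set ℂ} {K : ℝ → ℝ}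

theorem CondK1.countable (h1 : CondK1 E c Z) : Z.Countable := countable_of_isDiscrete h1.isDiscrete

theorem CondK1.notMem_of_lt (h1 : CondK1 E c Z) {z : ℂ} (hz : c < z.im) : z ∉ Z := fun h => by
  linarith [h1.strip z h, le_abs_self z.im]

theorem CondK1.analyticOnNhd_neg (h1 : CondK1 E c Z) : AnalyticOnNhd ℂ (fun z => E (-z)) Zᶜ :=
  fun z hz => (h1.analytic (-z) fun h => hz (by simpa using h1.neg_mem _ h)).comp_of_eq
    (analyticAt_id.neg) rfl

theorem CondK1.eventually_ne_zero (h1 : CondK1 E c Z) {z : ℂ} (hz : z ∉ Z) :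
    ∀ᶠ w in 𝓝[≠] z, E w ≠ 0 := by
  rcases (h1.analytic z hz).eventually_eq_zero_or_eventually_ne_zero with h | h
  · obtain ⟨w, hw, hE⟩ := h1.ne_zero
    exact absurd (h1.analytic.eqOn_zero_of_preconnected_of_eventuallyEq_zero
      (isPreconnected_compl_of_countable h1.countable) hz h hw) hE
  · exact h

theorem CondK1.countable_zeros (h1 : CondK1 E c Z) : {z | z ∉ Z ∧ E z = 0}.Countable := by
  refine countable_of_isDiscrete (IsDiscrete.of_nhdsWithin fun z hz => ?_)
  rw [le_pure_iff]
  have := h1.eventually_ne_zero hz.1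
  rw [eventually_nhdsWithin_iff] at this
  rw [mem_nhdsWithin_iff_eventually]
  filter_upwards [this] with w hw hwS
  by_contra hne
  exact hw hne hwS.2

theorem CondK1.continuousAt (h1 : CondK1 E c Z) {z : ℂ} (hz : z ∉ Z) : ContinuousAt E z :=
  (h1.analytic z hz).continuousAt

theorem CondK1.continuousAt_neg (h1 : CondK1 E c Z) {z : ℂ} (hz : z ∉ Z) :
    ContinuousAt (fun z => E (-z)) z := (h1.analyticOnNhd_neg z hz).continuousAt

/-- An identity between continuous functions, away from the zeros of `E`. -/
theorem CondK1.eq_of_eq_of_ne_zero (h1 : CondK1 E c Z) {f g : ℂ → ℂ} {z : ℂ} (hz : z ∉ Z)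
    (hf : ContinuousAt f z) (hg : ContinuousAt g z) (h : ∀ᶠ w in 𝓝 z, w ∉ Z → E w ≠ 0 → f w = g w) :
    f z = g z := by
  have hf' := hf.tendsto.mono_left (nhdsWithin_le_nhds (s := {z}ᶜ))
  have hg' := hg.tendsto.mono_left (nhdsWithin_le_nhds (s := {z}ᶜ))
  refine tendsto_nhds_unique_of_eventuallyEq hf' hg' ?_
  filter_upwards [h1.eventually_ne_zero hz, nhdsWithin_le_nhds h,
    nhdsWithin_le_nhds (h1.isClosed.isOpen_compl.mem_nhds hz)] with w hw1 hw2 hw3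
  exact hw2 hw3 hw1

theorem CondK1.theta_mul (h1 : CondK1 E c Z) {z : ℂ} (hz : z ∉ Z) (hE : E z ≠ 0) :
    E z * Theta E z = E (-z) := by
  rw [Theta, h1.sharp_eq z hz, mul_div_cancel₀ _ hE]

theorem CondK2.exists_growth (h2 : CondK2 E c K) (h3 : CondK3 K) :
    ∃ C, ∀ x, |K x| ≤ C * Real.exp (c * x) := by
  obtain ⟨C₁, h⟩ := h2.growth.bound
  obtain ⟨S, hS, hS'⟩ := mem_cocompact.1 h
  obtain ⟨C₂, hC₂⟩ := hS.exists_bound_of_continuousOn (f := fun x => K x * Real.exp (-(c * x)))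
    (by have := h2.continuous; fun_prop)
  refine ⟨max (max C₁ C₂) 0, fun x => ?_⟩
  rcases lt_or_ge x 0 with hx | hx
  · rw [h3 x hx, abs_zero]
    positivity
  · by_cases hxS : x ∈ S
    · have := hC₂ x hxS
      rw [norm_mul, Real.norm_eq_abs, Real.norm_eq_abs, Real.abs_exp, Real.exp_neg,
        ← div_eq_mul_inv, div_le_iff₀ (Real.exp_pos _)] at this
      refine this.trans (mul_le_mul_of_nonneg_right ?_ (Real.exp_pos _).le)
      exact (le_max_right _ _).trans (le_max_left _ _)
    · have := hS' hxS
      simp only [Set.mem_ofPred_eq, Real.norm_eq_abs, Real.abs_exp, abs_of_nonneg hx] at this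
      refine this.trans (mul_le_mul_of_nonneg_right ?_ (Real.exp_pos _).le)
      exact (le_max_left _ _).trans (le_max_left _ _)

theorem differentiableAt_fourierInt_kernel {k : C(ℝ, ℝ)} (h3 : CondK3 k) {C : ℝ}
    (hC : ∀ x, |k x| ≤ C * Real.exp (c * x)) {z : ℂ} (hz : c < z.im) :
    DifferentiableAt ℂ (fourierInt fun x => (k x : ℂ)) z :=
  differentiableAt_fourierInt (a := (c + z.im) / 2) (b := z.im + 1) (by fun_prop)
    (integrable_kernel_exp h3 hC (by linarith)) (integrable_kernel_exp h3 hC (by linarith))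
    (by linarith) (by linarith)

/-- The meromorphic identity cleared of its denominator: zeros of E are isolated, so continuity
extends it across them. -/
theorem CondK2.mul_fourierInt {k : C(ℝ, ℝ)} (h1 : CondK1 E c Z) (h2 : CondK2 E c k) (h3 : CondK3 k)
    {z : ℂ} (hz : c < z.im) : E z * fourierInt (fun x => (k x : ℂ)) z = E (-z) := by
  obtain ⟨C, hC⟩ := h2.exists_growth h3
  have hzZ := h1.notMem_of_lt hz
  refine h1.eq_of_eq_of_ne_zero (f := fun z => E z * fourierInt (fun x => (k x : ℂ)) z)
    (g := fun z => E (-z)) hzZ ((h1.continuousAt hzZ).mul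
    (differentiableAt_fourierInt_kernel h3 hC hz).continuousAt) (h1.continuousAt_neg hzZ) ?_
  filter_upwards [(isOpen_lt continuous_const Complex.continuous_im).mem_nhds hz] with w hw hwZ hE
  rw [← h2.fourier w hw hE, h1.theta_mul hwZ hE]

theorem hasInnerSymbol_of_thetaIsInner {k : C(ℝ, ℝ)} (h1 : CondK1 E c Z) (h2 : CondK2 E c k)
    (h3 : CondK3 k) (h : ThetaIsInner E Z) :
    ∃ θ, HasInnerSymbol k c θ ∧ ∀ z : ℂ, 0 < z.im → z ∉ Z → E z * θ z = E (-z) := by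
  obtain ⟨θ, hθ, hE⟩ := h
  obtain ⟨C, hC⟩ := h2.exists_growth h3
  refine ⟨θ, ⟨h3, h1.c_pos, ⟨C, hC⟩, hθ, fun z hz => ?_⟩, fun z hz hzZ => ?_⟩
  · have hz0 := h1.c_pos.trans hz
    refine h1.eq_of_eq_of_ne_zero (h1.notMem_of_lt hz) (hθ.analytic z hz0).continuousAt
      (differentiableAt_fourierInt_kernel h3 hC hz).continuousAt ?_
    filter_upwards [(isOpen_lt continuous_const Complex.continuous_im).mem_nhds hz] with w hw hwZ hEw
    rw [← h2.fourier w hw hEw, hE w (h1.c_pos.trans hw) hwZ hEw]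
  · refine h1.eq_of_eq_of_ne_zero (f := fun z => E z * θ z)
      (g := fun z => E (-z)) hzZ ((h1.continuousAt hzZ).mul
      (hθ.analytic z hz).continuousAt) (h1.continuousAt_neg hzZ) ?_
    filter_upwards [(isOpen_lt continuous_const Complex.continuous_im).mem_nhds hz] with w hw hwZ hEw
    rw [← hE w hw hwZ hEw, h1.theta_mul hwZ hEw]

theorem CondK1.ae_real (h1 : CondK1 E c Z) : ∀ᵐ x : ℝ, (x : ℂ) ∉ Z ∧ E x ≠ 0 := by
  have h : ((fun x : ℝ => (x : ℂ)) ⁻¹' (Z ∪ {z | z ∉ Z ∧ E z = 0})).Countable :=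
    (h1.countable.union h1.countable_zeros).preimage_of_injOn Complex.ofReal_injective.injOn
  filter_upwards [h.ae_notMem volume] with x hx
  simp only [Set.mem_preimage, Set.mem_union, Set.mem_ofPred_eq, not_or, not_and] at hx
  exact ⟨hx.1, hx.2 hx.1⟩

/-- If no truncation has an eigenvalue `±1`, then `Θ_E` is inner. -/
theorem thetaIsInner_of_not_eigenvalue {k : C(ℝ, ℝ)} (h1 : CondK1 E c Z) (h2 : CondK2 E c k)
    (h3 : CondK3 k)
    (h : ∀ t : ℝ, 0 ≤ t → ¬ TruncHasEigenvalue k t 1 ∧ ¬ TruncHasEigenvalue k t (-1)) :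
    ThetaIsInner E Z := by
  obtain ⟨C, hC⟩ := h2.exists_growth h3
  obtain ⟨θ, hθ, hb, hf⟩ := exists_contractive_symbol h3 h1.c_pos hC
    fun s hs => (norm_sqOp_lt_one h3 h hs).le
  have hE : ∀ z : ℂ, 0 < z.im → z ∉ Z → E z * θ z = E (-z) := by
    intro z hz hzZ
    have hz₀ : c < (((c + 1 : ℝ) : ℂ) * Complex.I).im := by simp
    have hA : AnalyticOnNhd ℂ (fun z => E z * θ z) ({z : ℂ | 0 < z.im} \ Z) := fun w hw =>
      (h1.analytic w hw.2).mul (hθ w hw.1)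
    have hB : AnalyticOnNhd ℂ (fun z => E (-z)) ({z : ℂ | 0 < z.im} \ Z) := fun w hw =>
      h1.analyticOnNhd_neg w hw.2
    refine hA.eqOn_of_preconnected_of_eventuallyEq hB (isPreconnected_upperHalfPlane_diff h1.countable)
      ⟨h1.c_pos.trans hz₀, h1.notMem_of_lt hz₀⟩ ?_ ⟨hz, hzZ⟩
    filter_upwards [(isOpen_lt continuous_const Complex.continuous_im).mem_nhds hz₀] with w hw
    rw [hf w hw, h2.mul_fourierInt h1 h3 hw]
  refine ⟨θ, ⟨hθ, ⟨1, hb⟩, ?_⟩, fun z hz hzZ hEz => ?_⟩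
  · filter_upwards [h1.ae_real] with x hx
    have hlim : Tendsto (fun y : ℝ => (x : ℂ) + (y : ℂ) * Complex.I) (𝓝[>] 0) (𝓝 (x : ℂ)) := by
      have : Continuous fun y : ℝ => (x : ℂ) + (y : ℂ) * Complex.I := by fun_prop
      simpa using (this.tendsto 0).mono_left (nhdsWithin_le_nhds (s := Set.Ioi 0))
    have l1 := (h1.continuousAt hx.1).tendsto.comp hlim
    have l2 := (h1.continuousAt_neg hx.1).tendsto.comp hlim
    have l3 := l2.norm.div l1.norm (norm_ne_zero_iff.2 hx.2)
    -- On the real line E(-x) = E♯(x) is the conjugate of E(x), so the limit of |θ| is one wherever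
    -- x is neither exceptional nor a zero of E.
    have e : ‖E (-(x : ℂ))‖ = ‖E x‖ := by
      rw [← h1.sharp_eq x hx.1, sharp, norm_star]
      congr 2
      exact Complex.conj_ofReal x
    rw [e, div_self (norm_ne_zero_iff.2 hx.2)] at l3
    refine l3.congr' ?_
    filter_upwards [self_mem_nhdsWithin, hlim.eventually (h1.isClosed.isOpen_compl.mem_nhds hx.1),
      l1.eventually_ne hx.2] with y hy hyZ hEy
    simp only [Function.comp_apply, Pi.div_apply] at hEy ⊢
    rw [← hE _ (by simpa using hy) hyZ, norm_mul, mul_div_cancel_left₀ _ (norm_ne_zero_iff.2 hEy)]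
  · rw [Theta, h1.sharp_eq z hzZ, ← hE z hz hzZ, mul_div_cancel_left₀ _ hEz]

end Structure

/-! ### Resolvent densities and their moment functions -/

/-- The continuous function `m` solves `m(x) = ε (K(x+t) + ∫_{-t}^t K(x+y) m(y) dy)` with
`ε = ±1`. -/
structure IsResolvent (k : ℝ → ℝ) (t ε : ℝ) (m : ℝ → ℝ) : Prop where
  nonneg : 0 ≤ t
  mul_self : ε * ε = 1
  continuous : Continuous m
  eq : ∀ x, m x = ε * (k (x + t) + ∫ y in (-t)..t, k (x + y) * m y)

theorem CondK3.eq_zero {k : C(ℝ, ℝ)} (h3 : CondK3 k) {x : ℝ} (hx : x ≤ 0) : k x = 0 := by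
  have h : Set.EqOn k 0 (closure (Set.Iio 0)) :=
    Set.EqOn.closure (fun x hx => h3 x hx) k.continuous continuous_zero
  rw [closure_Iio] at h
  exact h hx

/-- By the Fredholm alternative ε - K[t] is invertible when ε is not an eigenvalue. Since ε² = 1,
the solution of (ε - K[t])u = 1_{(-t,t)} K(·+t) satisfies the required equation on (-t,t). -/
theorem exists_isResolvent {k : C(ℝ, ℝ)} (h3 : CondK3 k) {t ε : ℝ} (ht : 0 ≤ t) (hε : ε * ε = 1)
    (h : ¬ TruncHasEigenvalue k t (ε : ℂ)) : ∃ m, IsResolvent k t ε m := by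
  have hε0 : (ε : ℂ) ≠ 0 := by
    intro h0
    rw [Complex.ofReal_eq_zero.1 h0] at hε
    simp at hε
  have hεC : (ε : ℂ) * ε = 1 := by exact_mod_cast hε
  have hunit := ((isCompactOperator_sqOp k ht).hasEigenvalue_or_mem_resolventSet hε0).resolve_left
    fun he => h (truncHasEigenvalue_of_hasEigenvalue h3 hε0 he)
  rw [spectrum.mem_resolventSet_iff] at hunit
  have hb : MemLp ((Set.Ioo (-t) t).indicator fun x => (k (x + t) : ℂ)) 2 (volume : Measure ℝ) := by
    rw [memLp_indicator_iff_restrict measurableSet_Ioo]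
    obtain ⟨B, hB⟩ := isCompact_Icc.exists_bound_of_continuousOn (s := Set.Icc (-t) t)
      (f := fun x => (k (x + t) : ℂ)) (by fun_prop)
    refine MemLp.of_bound (by fun_prop) B ?_
    filter_upwards [ae_restrict_mem measurableSet_Ioo] with x hx
    exact hB x ⟨hx.1.le, hx.2.le⟩
  obtain ⟨u, hu⟩ : ∃ u : L2, (ε : ℂ) • u - sqOp k t u = hb.toLp _ := by
    obtain ⟨R, hR⟩ := hunit
    refine ⟨(↑R⁻¹ : L2 →L[ℂ] L2) (hb.toLp _), ?_⟩
    have h1 : (R : L2 →L[ℂ] L2) ((↑R⁻¹ : L2 →L[ℂ] L2) (hb.toLp _)) = hb.toLp _ := by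
      rw [← mul_apply_eq_comp, Units.mul_inv, one_apply_eq_self]
    rw [hR] at h1
    exact h1
  -- The right-hand side of the equation is defined and continuous on all of ℝ and depends only on u
  -- on (-t,t), so it furnishes the continuous extension of u.
  set M : ℝ → ℂ := fun x => ε * (k (x + t) + ∫ y in Set.Ioo (-t) t, (k (x + y) : ℂ) * u y) with hM
  have hMu : ∀ᵐ x : ℝ, x ∈ Set.Ioo (-t) t → u x = M x := by
    filter_upwards [Lp.coeFn_sub ((ε : ℂ) • u) (sqOp k t u), Lp.coeFn_smul (ε : ℂ) u,
      sqOp_coeFn k t u, hb.coeFn_toLp] with x e1 e2 e3 e4 hx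
    rw [hu, e4, Pi.sub_apply, e2, e3, Pi.smul_apply, smul_eq_mul, rectFun, Set.indicator_of_mem hx,
      Set.indicator_of_mem hx] at e1
    rw [hM]
    simp only
    rw [e1, sub_add_cancel, ← mul_assoc, hεC, one_mul]
  have hMc : Continuous M := by
    have := continuous_integral_translate_mul (k := fun x => (k x : ℂ)) (by fun_prop)
      (Metric.isBounded_Ioo (-t) t) measurableSet_Ioo (f := u)
      ((setIntegral_norm_le (Y := Set.Ioo (-t) t) (by simp) (Lp.memLp u)).1)
    fun_prop
  have hMe : ∀ x, M x = ε * (k (x + t) + ∫ y in Set.Ioo (-t) t, (k (x + y) : ℂ) * M y) := by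
    intro x
    rw [hM]
    simp only
    congr 2
    refine setIntegral_congr_ae measurableSet_Ioo ?_
    filter_upwards [hMu] with y hy hyt
    rw [hy hyt]
  refine ⟨fun x => (M x).re, ht, hε, Complex.continuous_re.comp hMc, fun x => ?_⟩
  have hint : IntegrableOn (fun y => (k (x + y) : ℂ) * M y) (Set.Ioo (-t) t) :=
    (Continuous.integrableOn_Icc (a := -t) (b := t) (by fun_prop)).mono_set Set.Ioo_subset_Icc_self
  have hre : (∫ y in Set.Ioo (-t) t, (k (x + y) : ℂ) * M y).re =
      ∫ y in (-t)..t, k (x + y) * (M y).re := by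
    rw [intervalIntegral.integral_of_le (by linarith), integral_Ioc_eq_integral_Ioo]
    have := integral_re (𝕜 := ℂ) hint
    simp only [RCLike.re_to_complex, Complex.re_ofReal_mul] at this
    exact this.symm
  rw [← hre, hMe x]
  simp

/-- The Fourier transform of the measure `δ_t + 1_{(-t,t)} m(x) dx`. -/
def moment (t : ℝ) (m : ℝ → ℝ) (w : ℂ) : ℂ :=
  Complex.exp (Complex.I * w * t) + ∫ x in (-t)..t, (m x : ℂ) * Complex.exp (Complex.I * w * x)

theorem star_moment (t : ℝ) (m : ℝ → ℝ) (w : ℂ) : star (moment t m w) = moment t m (-star w) := by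
  have e : ∀ x : ℝ, star (Complex.exp (Complex.I * w * x)) = Complex.exp (Complex.I * (-star w) * x) := by
    intro x
    rw [star_exp_eq]
    congr 1
    ring
  rw [moment, star_add, e, moment, intervalIntegral, intervalIntegral, star_sub, Complex.star_def,
    ← integral_conj, ← integral_conj]
  congr 2 <;>
  · refine integral_congr_ae (ae_of_all _ fun x => ?_)
    simp only [map_mul, Complex.conj_ofReal]
    exact congrArg _ (e x)

theorem differentiable_moment {t : ℝ} (ht : 0 ≤ t) {m : ℝ → ℝ} (hm : Continuous m) :
    Differentiable ℂ (moment t m) := by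
  have e : moment t m = fun w => Complex.exp (Complex.I * w * t) +
      fourierInt ((Set.Ioc (-t) t).indicator fun x => (m x : ℂ)) w := by
    funext w
    rw [moment, fourierInt, intervalIntegral.integral_of_le (by linarith),
      ← integral_indicator measurableSet_Ioc]
    congr 2
    funext x
    by_cases hx : x ∈ Set.Ioc (-t) t <;> simp [hx]
  have hint : ∀ v : ℝ, Integrable fun x =>
      (Set.Ioc (-t) t).indicator (fun x => (m x : ℂ)) x * (Real.exp (-v * x) : ℂ) := by
    intro v
    have : IntegrableOn (fun x => (m x : ℂ) * (Real.exp (-v * x) : ℂ)) (Set.Ioc (-t) t) :=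
      (Continuous.integrableOn_Icc (by fun_prop)).mono_set Set.Ioc_subset_Icc_self
    refine (this.integrable_indicator measurableSet_Ioc).congr (ae_of_all _ fun x => ?_)
    by_cases hx : x ∈ Set.Ioc (-t) t <;> simp [hx]
  rw [e]
  intro w
  refine DifferentiableAt.add (by fun_prop) (differentiableAt_fourierInt (a := w.im - 1) (b := w.im + 1)
    ?_ (hint _) (hint _) (by linarith) (by linarith))
  exact AEStronglyMeasurable.indicator (by fun_prop) measurableSet_Ioc

section Resolvent

variable {k : C(ℝ, ℝ)} {t ε : ℝ} {m : ℝ → ℝ} {c C : ℝ}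

theorem IsResolvent.eq_zero (hm : IsResolvent k t ε m) (h3 : CondK3 k) {x : ℝ} (hx : x ≤ -t) :
    m x = 0 := by
  have h1 : ∫ y in (-t)..t, k (x + y) * m y = 0 := by
    rw [← intervalIntegral.integral_zero (a := -t) (b := t)]
    refine intervalIntegral.integral_congr fun y hy => ?_
    rw [Set.uIcc_of_le (by linarith [hm.nonneg])] at hy
    rw [h3.eq_zero (by linarith [hy.2]), zero_mul]
  rw [hm.eq, h1, h3.eq_zero (by linarith), add_zero, mul_zero]

theorem IsResolvent.exists_growth (hm : IsResolvent k t ε m) (hc : 0 < c)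
    (hC : ∀ x, |k x| ≤ C * Real.exp (c * x)) : ∃ D, 0 ≤ D ∧ ∀ x, |m x| ≤ D * Real.exp (c * x) := by
  have ht := hm.nonneg
  have hC0 : 0 ≤ C := by
    have := (abs_nonneg _).trans (hC 0)
    simpa using this
  have hε : |ε| = 1 := by
    have := congrArg abs hm.mul_self
    rw [abs_mul, abs_one] at this
    nlinarith [abs_nonneg ε]
  obtain ⟨B, hB⟩ := isCompact_Icc.exists_bound_of_continuousOn (s := Set.Icc (-t) t) (f := m)
    hm.continuous.continuousOn
  have hB0 : 0 ≤ B := (norm_nonneg _).trans (hB t ⟨by linarith, le_rfl⟩)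
  have hk : ∀ x y, y ≤ t → |k (x + y)| ≤ C * Real.exp (c * t) * Real.exp (c * x) := by
    intro x y hy
    refine (hC _).trans ?_
    rw [mul_assoc, ← Real.exp_add]
    refine mul_le_mul_of_nonneg_left (Real.exp_le_exp.2 ?_) hC0
    nlinarith
  refine ⟨C * Real.exp (c * t) * (1 + B * (2 * t)), by positivity, fun x => ?_⟩
  have h2 : ‖∫ y in (-t)..t, k (x + y) * m y‖ ≤
      C * Real.exp (c * t) * Real.exp (c * x) * B * |t - -t| := by
    refine intervalIntegral.norm_integral_le_of_norm_le_const fun y hy => ?_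
    rw [Set.uIoc_of_le (by linarith)] at hy
    rw [norm_mul]
    exact mul_le_mul (hk x y hy.2) (hB y ⟨hy.1.le, hy.2⟩) (norm_nonneg _) (by positivity)
  rw [Real.norm_eq_abs, abs_of_nonneg (show 0 ≤ t - -t by linarith)] at h2
  rw [hm.eq, abs_mul, hε, one_mul]
  refine (abs_add_le _ _).trans ?_
  have := hk x t le_rfl
  calc |k (x + t)| + |∫ y in (-t)..t, k (x + y) * m y|
      ≤ C * Real.exp (c * t) * Real.exp (c * x) +
        C * Real.exp (c * t) * Real.exp (c * x) * B * (t - -t) := add_le_add this h2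
    _ = _ := by ring

/-- The density m is ε times the Hankel transform of the measure δ_t + 1_{(-t,t)} m; its Fourier
transform is therefore ε K̂(w) times the moment function at -w. -/
theorem IsResolvent.fourierInt_eq (hm : IsResolvent k t ε m) (h3 : CondK3 k)
    (hC : ∀ x, |k x| ≤ C * Real.exp (c * x)) {w : ℂ} (hw : c < w.im) :
    Integrable (fun x : ℝ => (m x : ℂ) * Complex.exp (Complex.I * w * x)) ∧
      fourierInt (fun x => (m x : ℂ)) w =
        ε * (fourierInt (fun x => (k x : ℂ)) w * moment t m (-w)) := by
  have ht := hm.nonneg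
  have hk : Integrable fun x : ℝ => (k x : ℂ) * Complex.exp (Complex.I * w * x) :=
    integrable_mul_exp_of_re (integrable_kernel_exp h3 hC hw) rfl
  have e1 : (fun x : ℝ => (k (x + t) : ℂ) * Complex.exp (Complex.I * w * x)) = fun x : ℝ =>
      (fun x : ℝ => Complex.exp (Complex.I * (-w) * t) * ((k x : ℂ) * Complex.exp (Complex.I * w * x))) (x + t) := by
    funext x
    simp only
    rw [mul_left_comm, ← Complex.exp_add]
    congr 2
    push_cast
    ring
  have i1 : Integrable fun x : ℝ => (k (x + t) : ℂ) * Complex.exp (Complex.I * w * x) := by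
    rw [e1]
    exact (hk.const_mul _).comp_add_right t
  have v1 : ∫ x : ℝ, (k (x + t) : ℂ) * Complex.exp (Complex.I * w * x) =
      Complex.exp (Complex.I * (-w) * t) * fourierInt (fun x => (k x : ℂ)) w := by
    rw [e1, integral_add_right_eq_self (fun x : ℝ => Complex.exp (Complex.I * (-w) * t) *
      ((k x : ℂ) * Complex.exp (Complex.I * w * x))), integral_const_mul, fourierInt]
  set f : ℝ → ℂ := (Set.Ioc (-t) t).indicator fun x => (m x : ℂ) with hf
  have hfe : ∀ x, f x * Complex.exp (Complex.I * (-w) * x) = (Set.Ioc (-t) t).indicator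
      (fun x => (m x : ℂ) * Complex.exp (Complex.I * (-w) * x)) x := by
    intro x
    by_cases hx : x ∈ Set.Ioc (-t) t <;> simp [hf, hx]
  have hfi : Integrable fun x => f x * Complex.exp (Complex.I * (-w) * x) := by
    simp_rw [hfe]
    refine IntegrableOn.integrable_indicator ?_ measurableSet_Ioc
    have := hm.continuous
    exact (Continuous.integrableOn_Icc (by fun_prop)).mono_set Set.Ioc_subset_Icc_self
  have hff : fourierInt f (-w) = ∫ x in (-t)..t, (m x : ℂ) * Complex.exp (Complex.I * (-w) * x) := by
    rw [fourierInt, intervalIntegral.integral_of_le (by linarith), ← integral_indicator measurableSet_Ioc]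
    exact integral_congr_ae (ae_of_all _ hfe)
  obtain ⟨i2, v2⟩ := fourierInt_hankel (k := fun x => (k x : ℂ)) hk hfi
  have hmx : ∀ x, (m x : ℂ) = ε * (k (x + t) + ∫ y, (k (x + y) : ℂ) * f y) := by
    intro x
    rw [hm.eq x, intervalIntegral.integral_of_le (by linarith), ← integral_indicator measurableSet_Ioc]
    push_cast
    rw [← integral_complex_ofReal]
    congr 3
    funext y
    by_cases hy : y ∈ Set.Ioc (-t) t <;> simp [hf, hy]
  have e3 : (fun x : ℝ => (m x : ℂ) * Complex.exp (Complex.I * w * x)) = fun x : ℝ =>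
      ε * ((k (x + t) : ℂ) * Complex.exp (Complex.I * w * x) +
        (∫ y, (k (x + y) : ℂ) * f y) * Complex.exp (Complex.I * w * x)) := by
    funext x
    rw [hmx x]
    ring
  refine ⟨by rw [e3]; exact (i1.add i2).const_mul _, ?_⟩
  rw [fourierInt, e3, integral_const_mul, integral_add i1 i2, v1]
  rw [fourierInt] at v2
  rw [v2, hff, moment]
  ring

/-- As m vanishes left of -t, the complete transform of m is the part on (-t,t), which sits in
`moment`, plus the tail. The tail expression is what integration by parts makes of the integrals
defining A and B. -/
theorem IsResolvent.tail_eq (hm : IsResolvent k t ε m) (h3 : CondK3 k)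
    (hC : ∀ x, |k x| ≤ C * Real.exp (c * x)) {w : ℂ} (hw : c < w.im) :
    Complex.exp (Complex.I * w * t) - ∫ x in Set.Ioi t, (m x : ℂ) * Complex.exp (Complex.I * w * x) =
      moment t m w - ε * (fourierInt (fun x => (k x : ℂ)) w * moment t m (-w)) := by
  have ht := hm.nonneg
  obtain ⟨hi, he⟩ := hm.fourierInt_eq h3 hC hw
  have h1 : ∫ x in Set.Iic t, (m x : ℂ) * Complex.exp (Complex.I * w * x) =
      ∫ x in (-t)..t, (m x : ℂ) * Complex.exp (Complex.I * w * x) := by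
    rw [intervalIntegral.integral_of_le (by linarith)]
    refine setIntegral_eq_of_subset_of_forall_sdiff_eq_zero measurableSet_Iic (fun x hx => hx.2) ?_
    intro x hx
    have : x ≤ -t := by
      by_contra hlt
      exact hx.2 ⟨not_le.1 hlt, hx.1⟩
    simp [hm.eq_zero h3 this]
  have h2 := intervalIntegral.integral_Iic_add_Ioi (b := t) hi.integrableOn hi.integrableOn
  rw [h1] at h2
  rw [← he, fourierInt, ← h2, moment]
  ring

/-- Because |m(x)| is at most a multiple of e^{cx}, both the tail of m and its part on (-t,t) are
O(1/(Im w - c)) relative to the exponential coming from δ_t. -/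
theorem IsResolvent.exists_asymptotic (hm : IsResolvent k t ε m) (h3 : CondK3 k) (hc : 0 < c)
    (hC : ∀ x, |k x| ≤ C * Real.exp (c * x)) :
    ∃ D, 0 ≤ D ∧ ∀ w : ℂ, c < w.im →
      ‖(moment t m w - ε * (fourierInt (fun x => (k x : ℂ)) w * moment t m (-w))) *
        Complex.exp (-(Complex.I * w * t)) - 1‖ ≤ D / (w.im - c) ∧
      ‖moment t m (-w) * Complex.exp (Complex.I * w * t) - 1‖ ≤ D / (w.im - c) := by
  have ht := hm.nonneg
  obtain ⟨D, hD, hDm⟩ := hm.exists_growth hc hC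
  refine ⟨D * Real.exp (c * t), by positivity, fun w hw => ⟨?_, ?_⟩⟩
  · have h1 : ‖∫ x in Set.Ioi t, (m x : ℂ) * Complex.exp (Complex.I * w * x)‖ ≤
        ∫ x in Set.Ioi t, D * Real.exp (-(w.im - c) * x) := by
      refine norm_integral_le_of_norm_le ((exp_neg_integrableOn_Ioi t (sub_pos.2 hw)).const_mul D)
        (ae_of_all _ fun x => ?_)
      rw [norm_mul, norm_exp_I_mul, Complex.norm_real]
      refine (mul_le_mul_of_nonneg_right (hDm x) (Real.exp_pos _).le).trans (le_of_eq ?_)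
      rw [mul_assoc, ← Real.exp_add]
      congr 2
      ring
    rw [integral_const_mul, integral_exp_mul_Ioi (by linarith)] at h1
    rw [← hm.tail_eq h3 hC hw, sub_mul, ← Complex.exp_add, add_neg_cancel, Complex.exp_zero,
      sub_sub_cancel_left, norm_neg, norm_mul]
    have h2 : ‖Complex.exp (-(Complex.I * w * t))‖ = Real.exp (w.im * t) := by
      rw [Complex.exp_neg, norm_inv, norm_exp_I_mul, ← Real.exp_neg]
      congr 1
      ring
    rw [h2]
    refine (mul_le_mul_of_nonneg_right h1 (Real.exp_pos _).le).trans (le_of_eq ?_)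
    have h3 : Real.exp (c * t) = Real.exp (-(w.im - c) * t) * Real.exp (w.im * t) := by
      rw [← Real.exp_add]
      congr 1
      ring
    rw [h3]
    have : w.im - c ≠ 0 := (sub_pos.2 hw).ne'
    field_simp
  · have hp : 0 < c + w.im := by linarith
    have h1 : ‖∫ x in (-t)..t, (m x : ℂ) * Complex.exp (Complex.I * (-w) * x)‖ ≤
        ∫ x in Set.Iic t, D * Real.exp ((c + w.im) * x) := by
      have hi : IntegrableOn (fun x => D * Real.exp ((c + w.im) * x)) (Set.Iic t) :=
        (integrableOn_exp_mul_Iic hp t).const_mul D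
      rw [intervalIntegral.integral_of_le (by linarith)]
      refine (norm_integral_le_of_norm_le (hi.mono_set Set.Ioc_subset_Iic_self) (ae_of_all _ fun x => ?_)).trans
        (setIntegral_mono_set hi (ae_of_all _ fun x => by positivity)
          (Eventually.of_forall Set.Ioc_subset_Iic_self))
      rw [norm_mul, norm_exp_I_mul, Complex.norm_real]
      refine (mul_le_mul_of_nonneg_right (hDm x) (Real.exp_pos _).le).trans (le_of_eq ?_)
      rw [mul_assoc, ← Real.exp_add, Complex.neg_im]
      congr 2
      ring
    rw [integral_const_mul, integral_exp_mul_Iic hp] at h1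
    have h0 : Complex.exp (Complex.I * (-w) * t) * Complex.exp (Complex.I * w * t) = 1 := by
      rw [← Complex.exp_add, ← Complex.exp_zero]
      congr 1
      ring
    rw [moment, add_mul, h0, add_sub_cancel_left, norm_mul, norm_exp_I_mul]
    refine (mul_le_mul_of_nonneg_right h1 (Real.exp_pos _).le).trans ?_
    have h3 : Real.exp (c * t) = Real.exp ((c + w.im) * t) * Real.exp (-w.im * t) := by
      rw [← Real.exp_add]
      congr 1
      ring
    rw [h3, mul_div_assoc', div_mul_eq_mul_div, ← mul_assoc]
    exact div_le_div_of_nonneg_left (by positivity) (sub_pos.2 hw) (by linarith)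

theorem exists_norm_moment_le {m : ℝ → ℝ} (hm : Continuous m) (ht : 0 ≤ t) (V : ℝ) :
    ∃ R, ∀ w : ℂ, |w.im| ≤ V → ‖moment t m w‖ ≤ R := by
  have hexp : ∀ w : ℂ, |w.im| ≤ V → ∀ x : ℝ, |x| ≤ t → ‖Complex.exp (Complex.I * w * x)‖ ≤ Real.exp (V * t) := by
    intro w hw x hx
    rw [norm_exp_I_mul]
    refine Real.exp_le_exp.2 ((le_abs_self _).trans ?_)
    rw [abs_mul, abs_neg]
    exact mul_le_mul hw hx (abs_nonneg _) ((abs_nonneg _).trans hw)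
  obtain ⟨B, hB⟩ := isCompact_Icc.exists_bound_of_continuousOn (s := Set.Icc (-t) t) (f := m)
    hm.continuousOn
  refine ⟨Real.exp (V * t) + B * Real.exp (V * t) * |t - -t|, fun w hw => (norm_add_le _ _).trans
    (add_le_add (hexp w hw t (abs_of_nonneg ht).le) ?_)⟩
  refine intervalIntegral.norm_integral_le_of_norm_le_const fun x hx => ?_
  rw [Set.uIoc_of_le (by linarith)] at hx
  rw [norm_mul, Complex.norm_real]
  have hx' : x ∈ Set.Icc (-t) t := ⟨hx.1.le, hx.2⟩
  exact mul_le_mul (hB x hx') (hexp w hw x (abs_le.2 hx')) (norm_nonneg _)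
    ((norm_nonneg _).trans (hB x hx'))

/-- The moment functions of the two resolvents are related by a quadratic identity. -/
theorem IsResolvent.moment_mul_add {n : ℝ → ℝ} (hm : IsResolvent k t 1 m) (hn : IsResolvent k t (-1) n)
    (h3 : CondK3 k) (hc : 0 < c) (hC : ∀ x, |k x| ≤ C * Real.exp (c * x)) (w : ℂ) :
    moment t m w * moment t n (-w) + moment t m (-w) * moment t n w = 2 := by
  have ht := hm.nonneg
  set N : ℂ → ℂ := fun w => moment t m w * moment t n (-w) + moment t m (-w) * moment t n w with hN
  obtain ⟨D₁, hD₁, h₁⟩ := hm.exists_asymptotic h3 hc hC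
  obtain ⟨D₂, hD₂, h₂⟩ := hn.exists_asymptotic h3 hc hC
  have hasy : ∀ w : ℂ, c < w.im → ‖N w - 2‖ ≤
      2 * ((1 + D₁ / (w.im - c)) * (D₂ / (w.im - c)) + D₁ / (w.im - c)) := by
    intro w hw
    have hprod : ∀ (a b : ℂ) (A B : ℝ), ‖a - 1‖ ≤ A → ‖b - 1‖ ≤ B → ‖a * b - 1‖ ≤ (1 + A) * B + A := by
      intro a b A B ha hb
      have hA : ‖a‖ ≤ 1 + A := by
        have := norm_add_le (1 : ℂ) (a - 1)
        rw [add_sub_cancel, norm_one] at this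
        linarith
      calc ‖a * b - 1‖ = ‖a * (b - 1) + (a - 1)‖ := by ring_nf
        _ ≤ ‖a‖ * ‖b - 1‖ + ‖a - 1‖ := (norm_add_le _ _).trans (by rw [norm_mul])
        _ ≤ (1 + A) * B + A := add_le_add (mul_le_mul hA hb (norm_nonneg _)
            ((norm_nonneg _).trans hA)) ha
    obtain ⟨a1, a2⟩ := h₁ w hw
    obtain ⟨b1, b2⟩ := h₂ w hw
    have p1 := hprod _ _ _ _ a1 b2
    have p2 := hprod _ _ _ _ a2 b1
    have h0 : Complex.exp (-(Complex.I * w * t)) * Complex.exp (Complex.I * w * t) = 1 := by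
      rw [← Complex.exp_add, neg_add_cancel, Complex.exp_zero]
    -- Replacing M(w) and N(w) in the products by the combinations with known asymptotics adds terms
    -- in K̂(w), which cancel because the signs ε of m and n are opposite.
    have e : N w - 2 = ((moment t m w - (1 : ℝ) * (fourierInt (fun x => (k x : ℂ)) w * moment t m (-w))) *
        Complex.exp (-(Complex.I * w * t)) * (moment t n (-w) * Complex.exp (Complex.I * w * t)) - 1) +
        (moment t m (-w) * Complex.exp (Complex.I * w * t) *
        ((moment t n w - (-1 : ℝ) * (fourierInt (fun x => (k x : ℂ)) w * moment t n (-w))) *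
        Complex.exp (-(Complex.I * w * t))) - 1) := by
      rw [hN]
      push_cast
      linear_combination (-(moment t m w * moment t n (-w) + moment t m (-w) * moment t n w)) * h0
    rw [e, two_mul]
    exact (norm_add_le _ _).trans (add_le_add p1 p2)
  have hdiff : Differentiable ℂ N := by
    have d1 := differentiable_moment ht hm.continuous
    have d2 := differentiable_moment ht hn.continuous
    fun_prop
  have heven : ∀ w, N (-w) = N w := by
    intro w
    simp only [hN, neg_neg]
    ring
  -- The asymptotics bound the function above the line Im w = c + 1, evenness bounds it below the
  -- reflected line, and moments are bounded in the strip between. Liouville's theorem then makes it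
  -- constant.
  have hbdd : Bornology.IsBounded (Set.range N) := by
    obtain ⟨R₁, hR₁⟩ := exists_norm_moment_le hm.continuous ht (c + 1)
    obtain ⟨R₂, hR₂⟩ := exists_norm_moment_le hn.continuous ht (c + 1)
    have hup : ∀ w : ℂ, c + 1 ≤ w.im → ‖N w‖ ≤ 2 + 2 * ((1 + D₁) * D₂ + D₁) := by
      intro w hw
      have h1 : 1 ≤ w.im - c := by linarith
      have q1 : D₁ / (w.im - c) ≤ D₁ := div_le_self hD₁ h1
      have q2 : D₂ / (w.im - c) ≤ D₂ := div_le_self hD₂ h1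
      have q0 : 0 ≤ D₂ / (w.im - c) := by positivity
      have := norm_add_le (2 : ℂ) (N w - 2)
      rw [add_sub_cancel, Complex.norm_ofNat] at this
      refine this.trans (add_le_add le_rfl ((hasy w (by linarith)).trans ?_))
      gcongr
    refine isBounded_iff_forall_norm_le.2 ⟨max (2 + 2 * ((1 + D₁) * D₂ + D₁)) (R₁ * R₂ + R₁ * R₂), ?_⟩
    rintro _ ⟨w, rfl⟩
    rcases le_or_gt (c + 1) w.im with h | h
    · exact (hup w h).trans (le_max_left _ _)
    rcases le_or_gt (c + 1) (-w).im with h' | h'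
    · rw [← heven]
      exact (hup _ h').trans (le_max_left _ _)
    · rw [Complex.neg_im] at h'
      have hw : |w.im| ≤ c + 1 := abs_le.2 ⟨by linarith, h.le⟩
      have hw' : |(-w).im| ≤ c + 1 := by rwa [Complex.neg_im, abs_neg]
      refine (norm_add_le _ _).trans (le_trans ?_ (le_max_right _ _))
      rw [norm_mul, norm_mul]
      have := hR₁ w hw
      have := hR₂ w hw
      have := hR₁ _ hw'
      have := hR₂ _ hw'
      gcongr
      · exact (norm_nonneg _).trans (hR₁ w hw)
      · exact (norm_nonneg _).trans (hR₁ w hw)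
  have hconst : ∀ w, ‖N w - 2‖ ≤ 0 := by
    intro w
    have hlim : Tendsto (fun s : ℝ => 2 * ((1 + D₁ / s) * (D₂ / s) + D₁ / s)) atTop (𝓝 0) := by
      have l1 : Tendsto (fun s : ℝ => D₁ / s) atTop (𝓝 0) := tendsto_const_nhds.div_atTop tendsto_id
      have l2 : Tendsto (fun s : ℝ => D₂ / s) atTop (𝓝 0) := tendsto_const_nhds.div_atTop tendsto_id
      have := (((l1.const_add 1).mul l2).add l1).const_mul 2
      simpa using this
    refine ge_of_tendsto hlim ?_
    filter_upwards [eventually_gt_atTop 0] with s hs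
    rw [hdiff.apply_eq_apply_of_bounded hbdd w (((c + s : ℝ) : ℂ) * Complex.I)]
    have him : (((c + s : ℝ) : ℂ) * Complex.I).im = c + s := by simp
    have := hasy (((c + s : ℝ) : ℂ) * Complex.I) (by rw [him]; linarith)
    rwa [him, add_sub_cancel_left] at this
  exact sub_eq_zero.1 (norm_le_zero_iff.1 (hconst w))

end Resolvent

/-! ### Hankel and Laplace integrals of primitives -/

section Primitive

variable {𝕜 : Type*} [RCLike 𝕜] {q h : ℝ → 𝕜} {t : ℝ}

theorem integrableOn_translate_mul_of_support {f : ℝ → 𝕜} (hq : Continuous q) (hq0 : ∀ x ≤ 0, q x = 0)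
    (hf : Continuous f) (x : ℝ) : IntegrableOn (fun y => q (x + y) * f y) (Set.Iio t) := by
  have h1 : IntegrableOn (fun y => q (x + y) * f y) (Set.Icc (-x) t) :=
    Continuous.integrableOn_Icc (by fun_prop)
  refine h1.of_forall_sdiff_eq_zero measurableSet_Iio fun y hy => ?_
  have : y < -x := by
    by_contra hlt
    exact hy.2 ⟨not_lt.1 hlt, hy.1.le⟩
  rw [hq0 _ (by linarith), zero_mul]

theorem setIntegral_translate_mul_of_support {f : ℝ → 𝕜} (hq0 : ∀ x ≤ 0, q x = 0) {a x : ℝ}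
    (hax : a ≤ -x) (hat : a ≤ t) :
    ∫ y in Set.Iio t, q (x + y) * f y = ∫ y in a..t, q (x + y) * f y := by
  rw [← integral_Iic_eq_integral_Iio, intervalIntegral.integral_of_le hat]
  refine setIntegral_eq_of_subset_of_forall_sdiff_eq_zero measurableSet_Iic (fun y hy => hy.2) ?_
  intro y hy
  have : y ≤ a := by
    by_contra hlt
    exact hy.2 ⟨not_le.1 hlt, hy.1⟩
  rw [hq0 _ (by linarith), zero_mul]

/-- The Hankel integral of a primitive. -/
theorem setIntegral_translate_mul_primitive (ht : 0 ≤ t) (hq : Continuous q) (hq0 : ∀ x ≤ 0, q x = 0)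
    (hh : Continuous h) (hh0 : ∀ x ≤ -t, h x = 0) (S : 𝕜) (x : ℝ) :
    ∫ y in Set.Iio t, q (x + y) * (S - ∫ s in (-t)..y, h s) =
      ∫ ρ in (-t)..x, ((S - ∫ s in (-t)..t, h s) * q (ρ + t) + ∫ y in (-t)..t, q (ρ + y) * h y) := by
  -- A primitive of q allows integration by parts, trading the primitive of h for h itself; Fubini
  -- then recovers a primitive in x.
  set κ : ℝ → 𝕜 := fun x => ∫ s in (0 : ℝ)..x, q s with hκ
  have hκd : ∀ x, HasDerivAt κ (q x) x := fun x =>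
    (hq.integral_hasStrictDerivAt 0 x).hasDerivAt
  have hκc : Continuous κ := continuous_iff_continuousAt.2 fun x => (hκd x).continuousAt
  have hκ0 : ∀ x ≤ 0, κ x = 0 := by
    intro x hx
    refine (intervalIntegral.integral_congr (g := fun _ => 0) fun y hy => ?_).trans
      intervalIntegral.integral_zero
    rw [Set.uIcc_of_ge hx] at hy
    exact hq0 y hy.2
  have hHd : ∀ y, HasDerivAt (fun y => S - ∫ s in (-t)..y, h s) (-h y) y := fun y =>
    ((hh.integral_hasStrictDerivAt (-t) y).hasDerivAt).const_sub S
  -- Below a both q(x+·) and h vanish, so the half-line becomes a bounded interval and the boundary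
  -- term κ(x+a) is zero.
  set a : ℝ := min (-t) (-x) with ha
  have ha1 : a ≤ -t := min_le_left _ _
  have ha2 : a ≤ -x := min_le_right _ _
  rw [setIntegral_translate_mul_of_support hq0 ha2 (by linarith)]
  have hparts := intervalIntegral.integral_mul_deriv_eq_deriv_mul (a := a) (b := t)
    (u := fun y => S - ∫ s in (-t)..y, h s) (u' := fun y => -h y) (v := fun y => κ (x + y))
    (v' := fun y => q (x + y)) (fun y _ => hHd y)
    (fun y _ => (hκd (x + y)).comp_const_add x y)
    (Continuous.intervalIntegrable (by fun_prop) _ _) (Continuous.intervalIntegrable (by fun_prop) _ _)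
  have e1 : ∫ y in a..t, q (x + y) * (S - ∫ s in (-t)..y, h s) =
      ∫ y in a..t, (S - ∫ s in (-t)..y, h s) * q (x + y) := by
    simp_rw [mul_comm]
  have e2 : ∫ y in a..t, -h y * κ (x + y) = -∫ y in (-t)..t, h y * κ (x + y) := by
    rw [← intervalIntegral.integral_add_adjacent_intervals (b := -t)
      (Continuous.intervalIntegrable (by fun_prop) _ _) (Continuous.intervalIntegrable (by fun_prop) _ _)]
    have : ∫ y in a..(-t), -h y * κ (x + y) = 0 := by
      rw [← intervalIntegral.integral_zero (a := a) (b := -t)]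
      refine intervalIntegral.integral_congr fun y hy => ?_
      rw [Set.uIcc_of_le ha1] at hy
      rw [hh0 y hy.2, neg_zero, zero_mul]
    rw [this, zero_add, ← intervalIntegral.integral_neg]
    simp_rw [neg_mul]
  rw [e1, hparts, e2, hκ0 (x + a) (by linarith), mul_zero, sub_zero, sub_neg_eq_add]
  have hcont2 : Continuous fun p : ℝ × ℝ => q (p.1 + p.2) * h p.2 := by fun_prop
  have hinner : Continuous fun ρ => ∫ y in (-t)..t, q (ρ + y) * h y :=
    intervalIntegral.continuous_parametric_intervalIntegral_of_continuous' hcont2 _ _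
  rw [intervalIntegral.integral_add (Continuous.intervalIntegrable (by fun_prop) _ _)
    (hinner.intervalIntegrable _ _), intervalIntegral.integral_const_mul]
  have hshift : ∀ y ≤ t, ∫ ρ in (-t)..x, q (ρ + y) = κ (x + y) := by
    intro y hy
    rw [intervalIntegral.integral_comp_add_right]
    have := intervalIntegral.integral_add_adjacent_intervals (a := -t + y) (b := 0) (c := x + y)
      (hq.intervalIntegrable _ _) (hq.intervalIntegrable (μ := volume) _ _)
    rw [← this, intervalIntegral.integral_symm]
    have h0 := hκ0 (-t + y) (by linarith)
    rw [hκ] at h0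
    simp only at h0
    rw [h0, neg_zero, zero_add]
  rw [hshift t le_rfl]
  congr 1
  rw [intervalIntegral_intervalIntegral_swap]
  · refine intervalIntegral.integral_congr fun y hy => ?_
    rw [Set.uIcc_of_le (by linarith)] at hy
    rw [intervalIntegral.integral_mul_const, hshift y hy.2, mul_comm]
  · exact (hcont2.continuousOn.integrableOn_compact
      (isCompact_uIcc.prod isCompact_uIcc)).mono_set
      (Set.prod_mono Set.uIoc_subset_uIcc Set.uIoc_subset_uIcc)

/-- Integration by parts on `(t,∞)`, for a function of exponential growth. -/
theorem integral_Ioi_primitive_mul_exp {f : ℝ → ℂ} (hf : Continuous f) {D γ t : ℝ} (hγ : 0 < γ)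
    (ht : 0 ≤ t) (hD : ∀ x, ‖f x‖ ≤ D * Real.exp (γ * x)) (A : ℂ) {b : ℂ} (hb : b.re < -γ) :
    -b * ∫ x in Set.Ioi t, (A - ∫ s in t..x, f s) * Complex.exp (b * x) =
      A * Complex.exp (b * t) - ∫ x in Set.Ioi t, f x * Complex.exp (b * x) := by
  have hD0 : 0 ≤ D := by
    have := (norm_nonneg _).trans (hD 0)
    simpa using this
  have hnorm : ∀ x : ℝ, ‖Complex.exp (b * x)‖ = Real.exp (b.re * x) := by
    intro x
    rw [Complex.norm_exp, Complex.re_mul_ofReal]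
  have hcomb : ∀ x : ℝ, Real.exp (γ * x) * Real.exp (b.re * x) = Real.exp (-(-γ - b.re) * x) := by
    intro x
    rw [← Real.exp_add]
    congr 1
    ring
  set M : ℝ → ℂ := fun x => A - ∫ s in t..x, f s with hM
  have hMd : ∀ x, HasDerivAt M (-f x) x := fun x =>
    ((hf.integral_hasStrictDerivAt t x).hasDerivAt).const_sub A
  have hMc : Continuous M := continuous_iff_continuousAt.2 fun x => (hMd x).continuousAt
  have hMb : ∀ x, t ≤ x → ‖M x‖ ≤ (‖A‖ + D / γ) * Real.exp (γ * x) := by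
    intro x hx
    have h1 : ‖∫ s in t..x, f s‖ ≤ ∫ s in Set.Iic x, D * Real.exp (γ * s) := by
      have hi : IntegrableOn (fun s => D * Real.exp (γ * s)) (Set.Iic x) :=
        (integrableOn_exp_mul_Iic hγ x).const_mul D
      rw [intervalIntegral.integral_of_le hx]
      exact (norm_integral_le_of_norm_le (hi.mono_set Set.Ioc_subset_Iic_self)
        (ae_of_all _ fun s => hD s)).trans (setIntegral_mono_set hi (ae_of_all _ fun x => by positivity)
          (Eventually.of_forall Set.Ioc_subset_Iic_self))
    rw [integral_const_mul, integral_exp_mul_Iic hγ] at h1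
    have h2 : 1 ≤ Real.exp (γ * x) := Real.one_le_exp (mul_nonneg hγ.le (ht.trans hx))
    calc ‖M x‖ ≤ ‖A‖ + ‖∫ s in t..x, f s‖ := norm_sub_le _ _
      _ ≤ ‖A‖ * Real.exp (γ * x) + D * (Real.exp (γ * x) / γ) :=
        add_le_add (le_mul_of_one_le_right (norm_nonneg _) h2) h1
      _ = _ := by ring
  set g : ℝ → ℂ := fun x => M x * Complex.exp (b * x) with hg
  have hgb : ∀ x, t ≤ x → ‖g x‖ ≤ (‖A‖ + D / γ) * Real.exp (-(-γ - b.re) * x) := by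
    intro x hx
    rw [← hcomb, ← mul_assoc, hg]
    simp only
    rw [norm_mul, hnorm]
    exact mul_le_mul_of_nonneg_right (hMb x hx) (Real.exp_pos _).le
  have hexp := exp_neg_integrableOn_Ioi t (show 0 < -γ - b.re by linarith)
  have hgi : IntegrableOn g (Set.Ioi t) := by
    refine (hexp.const_mul (‖A‖ + D / γ)).mono' ?_ ?_
    · exact Continuous.aestronglyMeasurable (by fun_prop)
    · filter_upwards [ae_restrict_mem measurableSet_Ioi] with x hx
      exact hgb x hx.out.le
  have hfi : IntegrableOn (fun x : ℝ => f x * Complex.exp (b * x)) (Set.Ioi t) := by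
    refine (hexp.const_mul D).mono' (Continuous.aestronglyMeasurable (by fun_prop))
      (ae_of_all _ fun x => ?_)
    rw [← hcomb, ← mul_assoc, norm_mul, hnorm]
    exact mul_le_mul_of_nonneg_right (hD x) (Real.exp_pos _).le
  have hgd : ∀ x : ℝ, HasDerivAt g (-(f x * Complex.exp (b * x)) + b * g x) x := by
    intro x
    have h1 : HasDerivAt (fun x : ℝ => b * (x : ℂ)) b x := by
      simpa using (Complex.ofRealCLM.hasDerivAt (x := x)).const_mul b
    refine ((hMd x).mul h1.cexp).congr_deriv ?_
    simp only [hg]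
    ring
  have hlim : Tendsto g atTop (𝓝 0) := by
    have h1 : Tendsto (fun x : ℝ => (‖A‖ + D / γ) * Real.exp (-(-γ - b.re) * x)) atTop (𝓝 0) := by
      have h2 : Tendsto (fun x : ℝ => -(-γ - b.re) * x) atTop atBot :=
        tendsto_id.const_mul_atTop_of_neg (by linarith)
      simpa using (Real.tendsto_exp_atBot.comp h2).const_mul (‖A‖ + D / γ)
    refine squeeze_zero_norm' ?_ h1
    filter_upwards [eventually_ge_atTop t] with x hx
    exact hgb x hx
  have hneg : IntegrableOn (fun x : ℝ => -(f x * Complex.exp (b * x))) (Set.Ioi t) := hfi.neg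
  have hfin := integral_Ioi_of_hasDerivAt_of_tendsto' (fun x _ => hgd x)
    (hneg.add (hgi.const_mul _)) hlim
  rw [integral_add hneg (hgi.const_mul _), integral_neg, integral_const_mul] at hfin
  have hgt : g t = A * Complex.exp (b * t) := by simp [hg, hM]
  rw [hgt] at hfin
  linear_combination -hfin

end Primitive

/-! ### The solutions Φ, Ψ and the functions A, B -/

section Solutions

variable {k : C(ℝ, ℝ)} {t ε : ℝ} {m : ℝ → ℝ} {c C : ℝ}

/-- The function normalised to one at x = t has derivative -m. Its Hankel integral is the primitive
of K(·+t) + ∫ K(·+y) m(y) dy, which is εm; multiplied by ε it cancels the varying part. -/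
theorem IsResolvent.primitive_eq (hm : IsResolvent k t ε m) (h3 : CondK3 k) (x : ℝ) :
    (1 + (∫ s in (-t)..t, m s) - ∫ s in (-t)..x, m s) + ε * ∫ y in Set.Iio t, k (x + y) *
      (1 + (∫ s in (-t)..t, m s) - ∫ s in (-t)..y, m s) = 1 + ∫ s in (-t)..t, m s := by
  rw [setIntegral_translate_mul_primitive hm.nonneg k.continuous (fun x hx => h3.eq_zero hx) hm.continuous
    (fun x hx => hm.eq_zero h3 hx)]
  have : ∀ ρ, (1 + (∫ s in (-t)..t, m s) - ∫ s in (-t)..t, m s) * k (ρ + t) +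
      ∫ y in (-t)..t, k (ρ + y) * m y = ε * m ρ := by
    intro ρ
    rw [hm.eq ρ, ← mul_assoc, hm.mul_self, add_sub_cancel_right]
    ring
  simp_rw [this]
  rw [intervalIntegral.integral_const_mul, ← mul_assoc, hm.mul_self]
  ring

theorem IsResolvent.solvesIntegralEq (hm : IsResolvent k t ε m) (h3 : CondK3 k) {a : ℝ}
    (ha : a * (1 + ∫ s in (-t)..t, m s) = 1) :
    SolvesIntegralEq k ε t fun x => a * (1 + (∫ s in (-t)..t, m s) - ∫ s in (-t)..x, m s) := by
  have hc : Continuous fun x => ∫ s in (-t)..x, m s :=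
    intervalIntegral.continuous_primitive (fun _ _ => hm.continuous.intervalIntegrable _ _) _
  refine ⟨by fun_prop, fun x => ?_⟩
  simp_rw [mul_left_comm _ a]
  rw [integral_const_mul]
  linear_combination a * hm.primitive_eq h3 x + ha

/-- The difference of two solutions vanishes left of -t, so it is square integrable on (-∞,t) and
would be an eigenfunction for -ε. It is thus zero almost everywhere there, and the equation makes it
zero on all of ℝ. -/
theorem SolvesIntegralEq.unique (h3 : CondK3 k) (hε : ε * ε = 1)
    (h : ¬ TruncHasEigenvalue k t ((-ε : ℝ) : ℂ)) {Φ₁ Φ₂ : ℝ → ℝ} (h₁ : SolvesIntegralEq k ε t Φ₁)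
    (h₂ : SolvesIntegralEq k ε t Φ₂) : Φ₁ = Φ₂ := by
  set D : ℝ → ℝ := fun x => Φ₁ x - Φ₂ x with hD
  have hDc : Continuous D := h₁.1.sub h₂.1
  have hk0 : ∀ x ≤ 0, k x = 0 := fun x hx => h3.eq_zero hx
  have hDe : ∀ x, D x = -ε * ∫ y in Set.Iio t, k (x + y) * D y := by
    intro x
    simp only [hD, mul_sub]
    rw [integral_sub (integrableOn_translate_mul_of_support k.continuous hk0 h₁.1 x)
      (integrableOn_translate_mul_of_support k.continuous hk0 h₂.1 x)]
    linear_combination h₁.2 x - h₂.2 x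
  have hD0 : ∀ x ≤ -t, D x = 0 := by
    intro x hx
    rw [hDe, setIntegral_eq_zero_of_forall_eq_zero, mul_zero]
    intro y hy
    rw [hk0 _ (by linarith [hy.out]), zero_mul]
  have hDae : (fun x => (D x : ℂ)) =ᵐ[volume.restrict (Set.Iio t)] 0 := by
    by_contra hne
    refine h ⟨fun x => (D x : ℂ), ?_, hne, ?_⟩
    · have e : (fun x => (D x : ℂ)) = (Set.Ioi (-t)).indicator fun x => (D x : ℂ) := by
        funext x
        by_cases hx : x ∈ Set.Ioi (-t)
        · rw [Set.indicator_of_mem hx]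
        · rw [Set.indicator_of_notMem hx, hD0 x (not_lt.1 hx), Complex.ofReal_zero]
      obtain ⟨B, hB⟩ := isCompact_Icc.exists_bound_of_continuousOn (s := Set.Icc (-t) t)
        (f := fun x => (D x : ℂ)) (by fun_prop)
      rw [e, memLp_indicator_iff_restrict measurableSet_Ioi, Measure.restrict_restrict measurableSet_Ioi,
        Set.Ioi_inter_Iio]
      refine MemLp.of_bound (by fun_prop) B ?_
      filter_upwards [ae_restrict_mem measurableSet_Ioo] with x hx
      exact hB x ⟨hx.1.le, hx.2.le⟩
    · filter_upwards [ae_restrict_mem measurableSet_Iio] with x hx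
      rw [truncOp, Set.indicator_of_mem hx, hDe x]
      push_cast
      rw [← integral_complex_ofReal, ← mul_assoc, neg_mul_neg, ← Complex.ofReal_mul, hε, Complex.ofReal_one,
        one_mul]
      simp_rw [Complex.ofReal_mul]
  funext x
  refine sub_eq_zero.1 ?_
  have := hDe x
  rw [integral_eq_zero_of_ae, mul_zero] at this
  · exact this
  · filter_upwards [hDae] with y hy
    rw [Complex.ofReal_eq_zero.1 hy, mul_zero, Pi.zero_apply]

theorem moment_zero (t : ℝ) (m : ℝ → ℝ) : moment t m 0 = ((1 + ∫ s in (-t)..t, m s : ℝ) : ℂ) := by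
  rw [moment]
  push_cast
  simp [intervalIntegral.integral_ofReal]

/-- The quadratic identity at w = 0. It shows that neither total mass is zero, so the solutions can
be normalised, and that the two normalising constants are reciprocal. -/
theorem IsResolvent.mass_mul_mass {n : ℝ → ℝ} (hm : IsResolvent k t 1 m) (hn : IsResolvent k t (-1) n)
    (h3 : CondK3 k) (hc : 0 < c) (hC : ∀ x, |k x| ≤ C * Real.exp (c * x)) :
    (1 + ∫ s in (-t)..t, n s) * (1 + ∫ s in (-t)..t, m s) = 1 := by
  have := hm.moment_mul_add hn h3 hc hC 0
  rw [neg_zero, moment_zero, moment_zero, ← Complex.ofReal_mul, ← Complex.ofReal_add] at this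
  have h2 : (1 + ∫ s in (-t)..t, m s) * (1 + ∫ s in (-t)..t, n s) +
      (1 + ∫ s in (-t)..t, m s) * (1 + ∫ s in (-t)..t, n s) = 2 := by exact_mod_cast this
  linear_combination h2 / 2

/-- Uniqueness identifies the chosen solution with the normalised primitive; rebasing the integral
at t shows that a is its value at x = t. -/
theorem epsilon_solves (h3 : CondK3 k) (hm : IsResolvent k t ε m)
    (h : ¬ TruncHasEigenvalue k t ((-ε : ℝ) : ℂ)) {a : ℝ}
    (ha : a * (1 + ∫ s in (-t)..t, m s) = 1) (x : ℝ) :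
    Classical.epsilon (SolvesIntegralEq k ε t) x = a * (1 - ∫ s in t..x, m s) := by
  have hs := hm.solvesIntegralEq h3 ha
  rw [SolvesIntegralEq.unique h3 hm.mul_self h (Classical.epsilon_spec ⟨_, hs⟩) hs,
    ← intervalIntegral.integral_interval_sub_left (a := -t) (b := x) (c := t)
    (hm.continuous.intervalIntegrable _ _) (hm.continuous.intervalIntegrable _ _)]
  ring

theorem IsResolvent.integral_Ioi_primitive (hm : IsResolvent k t ε m) (h3 : CondK3 k) (hc : 0 < c)
    (hC : ∀ x, |k x| ≤ C * Real.exp (c * x)) {w : ℂ} (hw : c < w.im) (a : ℝ) :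
    -(Complex.I * w) * ∫ x in Set.Ioi t, ((a * (1 - ∫ s in t..x, m s) : ℝ) : ℂ) *
      Complex.exp (Complex.I * w * x) =
      a * (moment t m w - ε * (fourierInt (fun x => (k x : ℂ)) w * moment t m (-w))) := by
  obtain ⟨D, hD, hDm⟩ := hm.exists_growth hc hC
  have hmc := hm.continuous
  have := integral_Ioi_primitive_mul_exp (f := fun x => (m x : ℂ)) (by fun_prop) hc hm.nonneg
    (fun x => by rw [Complex.norm_real]; exact hDm x) 1 (b := Complex.I * w) (by simpa using hw)
  rw [one_mul] at this
  have e : ∫ x in Set.Ioi t, ((a * (1 - ∫ s in t..x, m s) : ℝ) : ℂ) * Complex.exp (Complex.I * w * x) =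
      a * ∫ x in Set.Ioi t, (1 - ∫ s in t..x, (m s : ℂ)) * Complex.exp (Complex.I * w * x) := by
    rw [← integral_const_mul]
    refine integral_congr_ae (ae_of_all _ fun x => ?_)
    simp only [intervalIntegral.integral_ofReal]
    push_cast
    ring
  rw [← hm.tail_eq h3 hC hw, e]
  linear_combination a * this

theorem CondK1.eqOn_compl {E : ℂ → ℂ} {Z : Set ℂ} (h1 : CondK1 E c Z) {F G : ℂ → ℂ}
    (hF : AnalyticOnNhd ℂ F Zᶜ) (hG : AnalyticOnNhd ℂ G Zᶜ) (h : ∀ z : ℂ, c < z.im → F z = G z) {z : ℂ}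
    (hz : z ∉ Z) : F z = G z := by
  have hz₀ : c < (((c + 1 : ℝ) : ℂ) * Complex.I).im := by simp
  refine hF.eqOn_of_preconnected_of_eventuallyEq hG (isPreconnected_compl_of_countable h1.countable)
    (h1.notMem_of_lt hz₀) ?_ hz
  filter_upwards [(isOpen_lt continuous_const Complex.continuous_im).mem_nhds hz₀] with w hw
  exact h w hw

theorem CondK1.analyticOnNhd_moment {E : ℂ → ℂ} {Z : Set ℂ} (h1 : CondK1 E c Z)
    (hm : IsResolvent k t ε m) : AnalyticOnNhd ℂ (fun z => E z * moment t m z -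
      ε * (E (-z) * moment t m (-z))) Zᶜ := by
  have hd := differentiable_moment hm.nonneg hm.continuous
  have ha : AnalyticOnNhd ℂ (moment t m) Zᶜ := fun z _ => hd.analyticAt z
  have hb : AnalyticOnNhd ℂ (fun z => moment t m (-z)) Zᶜ := fun z _ =>
    (hd.comp differentiable_neg).analyticAt z
  exact (h1.analytic.mul ha).sub (analyticOnNhd_const.mul (h1.analyticOnNhd_neg.mul hb))

/-- For Im z > c, integration by parts and E K̂ = E(-·) give a closed form that is analytic off Z.
The complement of the countable set Z is connected, so the function chosen by `Classical.epsilon`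
must agree with it. -/
theorem solA_eq {E : ℂ → ℂ} {Z : Set ℂ} (h1 : CondK1 E c Z) (h2 : CondK2 E c k) (h3 : CondK3 k)
    (hn : IsResolvent k t (-1) m) (h : ¬ TruncHasEigenvalue k t 1) {a : ℝ}
    (ha : a * (1 + ∫ s in (-t)..t, m s) = 1) {z : ℂ} (hz : z ∉ Z) :
    solA E c Z k t z = a / 2 * (E z * moment t m z + E (-z) * moment t m (-z)) := by
  obtain ⟨C, hC⟩ := h2.exists_growth h3
  have hPsi : ∀ x, solPsi k t x = a * (1 - ∫ s in t..x, m s) := fun x =>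
    epsilon_solves h3 hn (by simpa using h) ha x
  have hA : AnalyticOnNhd ℂ (fun z => (a / 2 : ℂ) * (E z * moment t m z + E (-z) * moment t m (-z))) Zᶜ := by
    have := (analyticOnNhd_const (v := (a / 2 : ℂ))).mul (h1.analyticOnNhd_moment hn)
    refine this.congr h1.isClosed.isOpen_compl fun z _ => ?_
    simp
  have hform : ∀ z : ℂ, c < z.im → -(Complex.I * z / 2) * E z *
      ∫ x in Set.Ioi t, (solPsi k t x : ℂ) * Complex.exp (Complex.I * z * (x : ℂ)) =
      (a / 2 : ℂ) * (E z * moment t m z + E (-z) * moment t m (-z)) := by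
    intro z hz
    simp_rw [hPsi]
    have := hn.integral_Ioi_primitive h3 h1.c_pos hC hz a
    rw [← h2.mul_fourierInt h1 h3 hz]
    push_cast at this ⊢
    linear_combination E z / 2 * this
  have hspec := Classical.epsilon_spec (p := fun F : ℂ → ℂ => AnalyticOnNhd ℂ F Zᶜ ∧ ∀ z : ℂ, c < z.im →
    F z = -(Complex.I * z / 2) * E z *
      ∫ x in Set.Ioi t, (solPsi k t x : ℂ) * Complex.exp (Complex.I * z * (x : ℂ)))
    ⟨_, hA, fun z hz => (hform z hz).symm⟩
  exact h1.eqOn_compl hspec.1 hA (fun z hz => (hspec.2 z hz).trans (hform z hz)) hz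

theorem solB_eq {E : ℂ → ℂ} {Z : Set ℂ} (h1 : CondK1 E c Z) (h2 : CondK2 E c k) (h3 : CondK3 k)
    (hm : IsResolvent k t 1 m) (h : ¬ TruncHasEigenvalue k t (-1)) {a : ℝ}
    (ha : a * (1 + ∫ s in (-t)..t, m s) = 1) {z : ℂ} (hz : z ∉ Z) :
    solB E c Z k t z = Complex.I * a / 2 * (E z * moment t m z - E (-z) * moment t m (-z)) := by
  obtain ⟨C, hC⟩ := h2.exists_growth h3
  have hPhi : ∀ x, solPhi k t x = a * (1 - ∫ s in t..x, m s) := fun x =>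
    epsilon_solves h3 hm (by simpa using h) ha x
  have hB : AnalyticOnNhd ℂ
      (fun z => (Complex.I * a / 2 : ℂ) * (E z * moment t m z - E (-z) * moment t m (-z))) Zᶜ := by
    have := (analyticOnNhd_const (v := (Complex.I * a / 2 : ℂ))).mul (h1.analyticOnNhd_moment hm)
    refine this.congr h1.isClosed.isOpen_compl fun z _ => ?_
    simp
  have hform : ∀ z : ℂ, c < z.im → -(Complex.I * z / 2) * E z *
      ∫ x in Set.Ioi t, (solPhi k t x : ℂ) * Complex.exp (Complex.I * z * (x : ℂ)) =
      -Complex.I * ((Complex.I * a / 2 : ℂ) * (E z * moment t m z - E (-z) * moment t m (-z))) := by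
    intro z hz
    simp_rw [hPhi]
    have := hm.integral_Ioi_primitive h3 h1.c_pos hC hz a
    rw [← h2.mul_fourierInt h1 h3 hz]
    push_cast at this ⊢
    linear_combination E z / 2 * this + (a / 2 * (E z * moment t m z -
      E z * fourierInt (fun x => (k x : ℂ)) z * moment t m (-z))) * Complex.I_sq
  have hspec := Classical.epsilon_spec (p := fun F : ℂ → ℂ => AnalyticOnNhd ℂ F Zᶜ ∧ ∀ z : ℂ, c < z.im →
    -Complex.I * F z = -(Complex.I * z / 2) * E z *
      ∫ x in Set.Ioi t, (solPhi k t x : ℂ) * Complex.exp (Complex.I * z * (x : ℂ)))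
    ⟨_, hB, fun z hz => (hform z hz).symm⟩
  refine h1.eqOn_compl hspec.1 hB (fun z hz => ?_) hz
  exact mul_left_cancel₀ (neg_ne_zero.2 Complex.I_ne_zero) ((hspec.2 z hz).trans (hform z hz))

end Solutions

/-! ### Hankel transforms of exponentials times primitives -/

theorem hankelOp_ae_eq_of_integrable {k : C(ℝ, ℝ)} (h3 : CondK3 k)
    (hc : ∀ s : ℝ, 0 ≤ s → ‖sqOp k s‖ ≤ 1) {f : L2}
    (hf : ∀ x, Integrable fun y => (k (x + y) : ℂ) * f y) :
    hankelOp k f =ᵐ[volume] fun x => ∫ y, (k (x + y) : ℂ) * f y := by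
  have hm : ∀ N : ℕ, MemLp ((Set.Iio (N : ℝ)).indicator f) 2 (volume : Measure ℝ) := fun N =>
    (Lp.memLp f).indicator measurableSet_Iio
  have hlim : Tendsto (fun N => (hm N).toLp _) atTop (𝓝 f) := by
    have key := (Lp.tendsto_Lp_iff_tendsto_eLpNorm'' (fi := atTop) _ hm f (Lp.memLp f)).2 ?_
    · rwa [Lp.toLp_coeFn] at key
    refine ((tendsto_eLpNorm_indicator_Ici (Lp.memLp f)).comp tendsto_natCast_atTop_atTop).congr fun N => ?_
    rw [Function.comp_apply, ← eLpNorm_neg]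
    congr 1
    funext x
    by_cases hx : x < N
    · simp [Set.indicator, hx, not_le.2 hx]
    · simp [Set.indicator, hx, not_lt.1 hx]
  have hT := ((hankelOp k).continuous.tendsto f).comp hlim
  -- Convergence in L² gives a.e. convergence along a subsequence, while integrability gives
  -- pointwise convergence of the integrals over (-∞,N).
  obtain ⟨ns, hns, hae⟩ := (tendstoInMeasure_of_tendsto_Lp hT).exists_seq_tendsto_ae
  have hpt : ∀ N : ℕ, hankelOp k ((hm N).toLp _) =ᵐ[volume]
      fun x => ∫ y in Set.Iio (N : ℝ), (k (x + y) : ℂ) * f y := by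
    intro N
    refine (hankelOp_ae_eq h3 hc (R := N) ?_).trans (ae_of_all _ fun x => ?_)
    · filter_upwards [(hm N).coeFn_toLp] with y hy hyN
      rw [hy, Set.indicator_of_notMem (by simpa using hyN.le)]
    · simp only
      rw [← integral_indicator measurableSet_Iio]
      refine integral_congr_ae ?_
      filter_upwards [(hm N).coeFn_toLp] with y hy
      rw [hy]
      by_cases hyN : y ∈ Set.Iio (N : ℝ)
      · rw [Set.indicator_of_mem hyN, Set.indicator_of_mem hyN]
      · rw [Set.indicator_of_notMem hyN, Set.indicator_of_notMem hyN, mul_zero]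
  filter_upwards [hae, ae_all_iff.2 hpt] with x hx hxN
  refine tendsto_nhds_unique hx ?_
  have hcov : AECover volume atTop fun N : ℕ => Set.Iio (N : ℝ) :=
    aecover_Iio tendsto_natCast_atTop_atTop
  refine ((hcov.integral_tendsto_of_countably_generated (hf x)).comp hns.tendsto_atTop).congr fun i => ?_
  exact (hxN (ns i)).symm

theorem star_fourierInt_ofReal (f : ℝ → ℝ) (z : ℂ) :
    star (fourierInt (fun x => (f x : ℂ)) z) = fourierInt (fun x => (f x : ℂ)) (-star z) := by
  rw [fourierInt, fourierInt, Complex.star_def, ← integral_conj]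
  refine integral_congr_ae (ae_of_all _ fun x => ?_)
  simp only [map_mul, Complex.conj_ofReal]
  have := star_exp_eq z x
  rw [Complex.star_def] at this
  rw [this]
  congr 2
  ring

/-- Half of a linear combination of two real functions. -/
def halfComb (a b : ℂ) (m n : ℝ → ℝ) (x : ℝ) : ℂ := (a * m x + b * n x) / 2

section Combination

variable {k : C(ℝ, ℝ)} {t : ℝ} {m n : ℝ → ℝ} {c C : ℝ}

theorem continuous_halfComb (hm : Continuous m) (hn : Continuous n) (a b : ℂ) :
    Continuous (halfComb a b m n) := by
  unfold halfComb
  fun_prop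

theorem halfComb_eq_zero (hm : IsResolvent k t 1 m) (hn : IsResolvent k t (-1) n) (h3 : CondK3 k)
    (a b : ℂ) {x : ℝ} (hx : x ≤ -t) : halfComb a b m n x = 0 := by
  simp [halfComb, hm.eq_zero h3 hx, hn.eq_zero h3 hx]

/-- As m and n satisfy the equation with opposite signs, the Hankel integral acts on their
combinations, up to a multiple of K(·+t), by reversing the sign of b. -/
theorem integral_translate_mul_halfComb (hm : IsResolvent k t 1 m) (hn : IsResolvent k t (-1) n)
    (a b : ℂ) (x : ℝ) :
    ∫ y in (-t)..t, (k (x + y) : ℂ) * halfComb a b m n y =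
      -halfComb (-a) b m n x - (a + b) / 2 * k (x + t) := by
  have hmc := hm.continuous
  have hnc := hn.continuous
  have e : ∀ y : ℝ, (k (x + y) : ℂ) * halfComb a b m n y =
      a / 2 * ((k (x + y) * m y : ℝ) : ℂ) + b / 2 * ((k (x + y) * n y : ℝ) : ℂ) := by
    intro y
    rw [halfComb]
    push_cast
    ring
  simp_rw [e]
  rw [intervalIntegral.integral_add (Continuous.intervalIntegrable (by fun_prop) _ _)
    (Continuous.intervalIntegrable (by fun_prop) _ _), intervalIntegral.integral_const_mul,
    intervalIntegral.integral_const_mul, intervalIntegral.integral_ofReal, intervalIntegral.integral_ofReal,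
    halfComb, hm.eq x, hn.eq x]
  push_cast
  ring

theorem integral_halfComb_mul_exp (hm : Continuous m) (hn : Continuous n) (a b w : ℂ) :
    ∫ x in (-t)..t, halfComb a b m n x * Complex.exp (Complex.I * w * x) =
      (a * moment t m w + b * moment t n w) / 2 - (a + b) / 2 * Complex.exp (Complex.I * w * t) := by
  have e : ∀ x : ℝ, halfComb a b m n x * Complex.exp (Complex.I * w * x) =
      a / 2 * ((m x : ℂ) * Complex.exp (Complex.I * w * x)) +
      b / 2 * ((n x : ℂ) * Complex.exp (Complex.I * w * x)) := by
    intro x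
    rw [halfComb]
    ring
  simp_rw [e]
  rw [intervalIntegral.integral_add (Continuous.intervalIntegrable (by fun_prop) _ _)
    (Continuous.intervalIntegrable (by fun_prop) _ _), intervalIntegral.integral_const_mul,
    intervalIntegral.integral_const_mul, moment, moment]
  ring

theorem exp_mul_exp_neg (ζ : ℂ) (x : ℝ) :
    Complex.exp (Complex.I * ζ * x) * Complex.exp (Complex.I * (-ζ) * x) = 1 := by
  rw [← Complex.exp_add, ← Complex.exp_zero]
  congr 1
  ring

theorem exp_mul_add (ζ : ℂ) (x y : ℝ) : Complex.exp (Complex.I * ζ * ((x + y : ℝ) : ℂ)) =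
    Complex.exp (Complex.I * ζ * x) * Complex.exp (Complex.I * ζ * y) := by
  rw [← Complex.exp_add]
  congr 1
  push_cast
  ring

/-- Twisting by e^{iζ(x+y)} leaves a kernel in x+y that vanishes on the left, so the formula for
primitives applies. The term in K(ρ+t) disappears when S equals the half-combination of moments at
-ζ, which is how a and b are later fixed. -/
theorem setIntegral_translate_mul_exp_primitive (hm : IsResolvent k t 1 m) (hn : IsResolvent k t (-1) n)
    (h3 : CondK3 k) (a b ζ S : ℂ) (x : ℝ) :
    ∫ y in Set.Iio t, (k (x + y) : ℂ) * (Complex.exp (Complex.I * ζ * y) *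
      (S - ∫ s in (-t)..y, halfComb a b m n s * Complex.exp (Complex.I * (-ζ) * s))) =
    Complex.exp (Complex.I * (-ζ) * x) * ∫ ρ in (-t)..x,
      ((S - (a * moment t m (-ζ) + b * moment t n (-ζ)) / 2) *
        (k (ρ + t) * Complex.exp (Complex.I * ζ * ((ρ + t : ℝ) : ℂ))) -
        halfComb (-a) b m n ρ * Complex.exp (Complex.I * ζ * ρ)) := by
  have hg := continuous_halfComb hm.continuous hn.continuous a b
  have key := setIntegral_translate_mul_primitive hm.nonneg (𝕜 := ℂ)
    (q := fun s => (k s : ℂ) * Complex.exp (Complex.I * ζ * s))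
    (h := fun s => halfComb a b m n s * Complex.exp (Complex.I * (-ζ) * s)) (by fun_prop)
    (fun x hx => by simp [h3.eq_zero hx]) (by fun_prop)
    (fun x hx => by simp [halfComb_eq_zero hm hn h3 a b hx]) S x
  have e1 : ∀ y : ℝ, (k (x + y) : ℂ) * (Complex.exp (Complex.I * ζ * y) *
      (S - ∫ s in (-t)..y, halfComb a b m n s * Complex.exp (Complex.I * (-ζ) * s))) =
      Complex.exp (Complex.I * (-ζ) * x) * ((k (x + y) : ℂ) * Complex.exp (Complex.I * ζ * ((x + y : ℝ) : ℂ)) *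
      (S - ∫ s in (-t)..y, halfComb a b m n s * Complex.exp (Complex.I * (-ζ) * s))) := by
    intro y
    rw [exp_mul_add]
    linear_combination (-((k (x + y) : ℂ) * Complex.exp (Complex.I * ζ * y) *
      (S - ∫ s in (-t)..y, halfComb a b m n s * Complex.exp (Complex.I * (-ζ) * s)))) * exp_mul_exp_neg ζ x
  simp_rw [e1]
  rw [integral_const_mul, key]
  congr 1
  refine intervalIntegral.integral_congr fun ρ _ => ?_
  have e2 : ∀ y : ℝ, (k (ρ + y) : ℂ) * Complex.exp (Complex.I * ζ * ((ρ + y : ℝ) : ℂ)) *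
      (halfComb a b m n y * Complex.exp (Complex.I * (-ζ) * y)) =
      Complex.exp (Complex.I * ζ * ρ) * ((k (ρ + y) : ℂ) * halfComb a b m n y) := by
    intro y
    rw [exp_mul_add]
    linear_combination (k (ρ + y) : ℂ) * halfComb a b m n y * Complex.exp (Complex.I * ζ * ρ) *
      exp_mul_exp_neg ζ y
  simp_rw [e2]
  rw [intervalIntegral.integral_const_mul, integral_translate_mul_halfComb hm hn,
    integral_halfComb_mul_exp hm.continuous hn.continuous, exp_mul_add]
  linear_combination (a + b) / 2 * (k (ρ + t) : ℂ) * Complex.exp (Complex.I * ζ * ρ) * exp_mul_exp_neg ζ t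

theorem memLp_indicator_Ioo_of_continuous {f : ℝ → ℂ} (hf : Continuous f) (t : ℝ) :
    MemLp ((Set.Ioo (-t) t).indicator f) 2 (volume : Measure ℝ) := by
  rw [memLp_indicator_iff_restrict measurableSet_Ioo]
  obtain ⟨B, hB⟩ := isCompact_Icc.exists_bound_of_continuousOn (s := Set.Icc (-t) t) hf.continuousOn
  refine MemLp.of_bound (by fun_prop) B ?_
  filter_upwards [ae_restrict_mem measurableSet_Ioo] with x hx
  exact hB x ⟨hx.1.le, hx.2.le⟩

/-- A function on `(-∞,t)` which is an exponential on `(-∞,-t)` is in `L²`. -/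
theorem memLp_indicator_Iio_exp_mul {z : ℂ} (hz : 0 < z.im) {u : ℝ → ℂ} (hu : Continuous u) {S : ℂ}
    (hS : ∀ x ≤ -t, u x = S) :
    MemLp ((Set.Iio t).indicator fun x => Complex.exp (Complex.I * star z * x) * u x) 2
      (volume : Measure ℝ) := by
  obtain ⟨B, hB⟩ := isCompact_Icc.exists_bound_of_continuousOn (s := Set.Icc (-t) t) hu.continuousOn
  have h1 := (memLp_evalFun (-t) hz).1.comp_measurePreserving (Measure.measurePreserving_neg volume)
  refine h1.of_le_mul (c := max B ‖S‖) (AEStronglyMeasurable.indicator (by fun_prop) measurableSet_Iio)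
    (ae_of_all _ fun x => ?_)
  by_cases hx : x ∈ Set.Iio t
  · have hx' : -x ∈ Set.Ioi (-t) := neg_lt_neg hx.out
    rw [Set.indicator_of_mem hx, Function.comp_apply, evalFun, Set.indicator_of_mem hx', norm_mul, mul_comm]
    have e : -(Complex.I * star z * ((-x : ℝ) : ℂ)) = Complex.I * star z * x := by push_cast; ring
    rw [e]
    refine mul_le_mul_of_nonneg_right ?_ (norm_nonneg _)
    rcases le_or_gt x (-t) with h | h
    · rw [hS x h]
      exact le_max_right _ _
    · exact (hB x ⟨h.le, hx.out.le⟩).trans (le_max_left _ _)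
  · rw [Set.indicator_of_notMem hx, norm_zero]
    exact mul_nonneg ((norm_nonneg _).trans (le_max_right _ _)) (norm_nonneg _)

/-- Substituting s = x+y leaves the tail of ∫ K(s) e^{-i z̄ s} ds beyond x+t, i.e. the full
transform minus an integral over a bounded interval. -/
theorem integrable_translate_mul_evalFun (h3 : CondK3 k) (hC : ∀ x, |k x| ≤ C * Real.exp (c * x)) {z : ℂ}
    (hz : c < z.im) (x : ℝ) : Integrable (fun y => (k (x + y) : ℂ) * evalFun t z y) ∧
      ∫ y, (k (x + y) : ℂ) * evalFun t z y = Complex.exp (Complex.I * star z * x) *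
        (fourierInt (fun x => (k x : ℂ)) (-star z) - ∫ ρ in (-t)..x,
          (k (ρ + t) * Complex.exp (Complex.I * (-star z) * ((ρ + t : ℝ) : ℂ)))) := by
  set p : ℝ → ℂ := fun s => (k s : ℂ) * Complex.exp (Complex.I * (-star z) * s) with hp
  have hpi : Integrable p := integrable_mul_exp_of_re (integrable_kernel_exp h3 hC hz) (by simp)
  have e : (fun y => (k (x + y) : ℂ) * evalFun t z y) = (Set.Ioi t).indicator
      fun y => Complex.exp (Complex.I * star z * x) * p (y + x) := by
    funext y
    by_cases hy : y ∈ Set.Ioi t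
    · rw [evalFun, Set.indicator_of_mem hy, Set.indicator_of_mem hy, hp]
      simp only
      rw [add_comm y x, exp_mul_add]
      have e1 : -(Complex.I * star z * (y : ℂ)) = Complex.I * (-star z) * y := by ring
      rw [e1]
      linear_combination (-((k (x + y) : ℂ) * Complex.exp (Complex.I * (-star z) * y))) *
        exp_mul_exp_neg (star z) x
    · rw [evalFun, Set.indicator_of_notMem hy, Set.indicator_of_notMem hy, mul_zero]
  have hi : Integrable fun y => Complex.exp (Complex.I * star z * x) * p (y + x) :=
    (hpi.comp_add_right x).const_mul _
  have hshift : ∫ y in Set.Ioi t, p (y + x) = ∫ y in Set.Ioi (t + x), p y := by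
    have := (measurePreserving_add_right volume x).setIntegral_preimage_emb
      (measurableEmbedding_addRight x) p (Set.Ioi (t + x))
    simpa using this
  rw [e]
  refine ⟨hi.indicator measurableSet_Ioi, ?_⟩
  rw [integral_indicator measurableSet_Ioi, integral_const_mul]
  congr 1
  rw [hshift, intervalIntegral.integral_comp_add_right p, neg_add_cancel, eq_sub_iff_add_eq, add_comm,
    add_comm t x, intervalIntegral.integral_interval_add_Ioi hpi.integrableOn hpi.integrableOn]
  refine setIntegral_eq_integral_of_forall_compl_eq_zero fun s hs => ?_
  simp only [hp]
  rw [h3.eq_zero (not_lt.1 hs), Complex.ofReal_zero, zero_mul]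

end Combination

/-! ### The projection of the evaluation vector in closed form -/

section KernelFormula

variable {k : C(ℝ, ℝ)} {c t : ℝ} {θ : ℂ → ℂ} {m n : ℝ → ℝ}

/-- By `eq_kernelV` it suffices to find α, β supported in (-∞,t] with e_z + α + Tβ in V_t. There
take α = e^{-i z̄ x} G and β = e^{i z̄ x}(-ϑ - H). The condition `hab'` makes Tβ = -e^{-i z̄ x} G,
cancelling α on x < t. The condition `hab` makes Te_z + Tα = e^{i z̄ x}(ϑ + H), cancelling β there.
Right of t only e_z and Tβ remain. -/
theorem HasInnerSymbol.kernelV_ae_eq (h : HasInnerSymbol k c θ) (hm : IsResolvent k t 1 m)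
    (hn : IsResolvent k t (-1) n) {z a b : ℂ} (hz : c < z.im)
    (hab : (a * moment t m (star z) + b * moment t n (star z)) / 2 = 1)
    (hab' : (-a * moment t m (-star z) + b * moment t n (-star z)) / 2 =
      -fourierInt (fun x => (k x : ℂ)) (-star z)) :
    kernelV k t z =ᵐ[volume] (Set.Ioi t).indicator fun x => Complex.exp (Complex.I * (-star z) * x) *
      (1 - ∫ s in (-t)..x, halfComb a b m n s * Complex.exp (Complex.I * star z * s)) := by
  obtain ⟨C, hC⟩ := h.growth
  have ht := hm.nonneg
  have hz0 : 0 < z.im := h.c_pos.trans hz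
  have hg := continuous_halfComb hm.continuous hn.continuous a b
  have hg' := continuous_halfComb hm.continuous hn.continuous (-a) b
  set ϑ := fourierInt (fun x => (k x : ℂ)) (-star z) with hϑ
  set G : ℝ → ℂ := fun x => ∫ s in (-t)..x, halfComb a b m n s * Complex.exp (Complex.I * star z * s) with hG
  set H : ℝ → ℂ := fun x => ∫ s in (-t)..x, halfComb (-a) b m n s * Complex.exp (Complex.I * (-star z) * s)
    with hH
  have hGc : Continuous G :=
    intervalIntegral.continuous_primitive (fun _ _ => Continuous.intervalIntegrable (by fun_prop) _ _) _
  have hHc : Continuous H :=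
    intervalIntegral.continuous_primitive (fun _ _ => Continuous.intervalIntegrable (by fun_prop) _ _) _
  have hzero : ∀ (a b w : ℂ) (x : ℝ), x ≤ -t →
      ∫ s in (-t)..x, halfComb a b m n s * Complex.exp (Complex.I * w * s) = 0 := by
    intro a b w x hx
    refine (intervalIntegral.integral_congr (g := fun _ => 0) fun y hy => ?_).trans
      intervalIntegral.integral_zero
    rw [Set.uIcc_of_ge hx] at hy
    simp only
    rw [halfComb_eq_zero hm hn h.support a b hy.2, zero_mul]
  have hfm : MemLp ((Set.Iio t).indicator fun x => Complex.exp (Complex.I * (-star z) * x) * G x) 2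
      (volume : Measure ℝ) := by
    have e : ((Set.Iio t).indicator fun x => Complex.exp (Complex.I * (-star z) * x) * G x) =
        (Set.Ioo (-t) t).indicator fun x => Complex.exp (Complex.I * (-star z) * x) * G x := by
      funext x
      by_cases hx : x ∈ Set.Ioo (-t) t
      · rw [Set.indicator_of_mem hx, Set.indicator_of_mem (show x ∈ Set.Iio t from hx.2)]
      · rw [Set.indicator_of_notMem hx]
        by_cases hx' : x ∈ Set.Iio t
        · rw [Set.indicator_of_mem hx', hG]
          simp only
          rw [hzero _ _ _ x (not_lt.1 fun h => hx ⟨h, hx'⟩), mul_zero]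
        · rw [Set.indicator_of_notMem hx']
    rw [e]
    exact memLp_indicator_Ioo_of_continuous (by fun_prop) t
  have hfm' : MemLp ((Set.Iio t).indicator fun x => Complex.exp (Complex.I * star z * x) * (-ϑ - H x)) 2
      (volume : Measure ℝ) := by
    refine memLp_indicator_Iio_exp_mul hz0 (by fun_prop) (S := -ϑ) fun x hx => ?_
    rw [hH]
    simp only
    rw [hzero _ _ _ x hx, sub_zero]
  have hsupp : ∀ {f : ℝ → ℂ} (hf : MemLp ((Set.Iio t).indicator f) 2 (volume : Measure ℝ)),
      (∀ᵐ x : ℝ, t < x → hf.toLp _ x = 0) ∧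
      hankelOp k (hf.toLp _) =ᵐ[volume] fun x => ∫ y in Set.Iio t, (k (x + y) : ℂ) * f y := by
    intro f hf
    have h1 : ∀ᵐ x : ℝ, t < x → hf.toLp _ x = 0 := by
      filter_upwards [hf.coeFn_toLp] with x hx hxt
      rw [hx, Set.indicator_of_notMem (by simpa using hxt.le)]
    refine ⟨h1, (hankelOp_ae_eq h.support h.norm_sqOp_le_one h1).trans (ae_of_all _ fun x => ?_)⟩
    simp only
    rw [← integral_indicator measurableSet_Iio]
    refine integral_congr_ae ?_
    filter_upwards [hf.coeFn_toLp] with y hy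
    rw [hy]
    by_cases hyt : y ∈ Set.Iio t
    · rw [Set.indicator_of_mem hyt, Set.indicator_of_mem hyt]
    · rw [Set.indicator_of_notMem hyt, Set.indicator_of_notMem hyt, mul_zero]
  obtain ⟨hf0, hfT⟩ := hsupp hfm
  obtain ⟨hf0', hfT'⟩ := hsupp hfm'
  have hTe : hankelOp k (evalL2 t z) =ᵐ[volume] fun x => ∫ y, (k (x + y) : ℂ) * evalFun t z y := by
    have hcongr : ∀ x, (fun y => (k (x + y) : ℂ) * evalL2 t z y) =ᵐ[volume]
        fun y => (k (x + y) : ℂ) * evalFun t z y := by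
      intro x
      filter_upwards [evalL2_coeFn t hz0] with y hy
      rw [hy]
    refine (hankelOp_ae_eq_of_integrable h.support h.norm_sqOp_le_one fun x =>
      (integrable_translate_mul_evalFun h.support hC hz x).1.congr (hcongr x).symm).trans
      (ae_of_all _ fun x => integral_congr_ae (hcongr x))
  have hv1 : ∀ x, ∫ y in Set.Iio t, (k (x + y) : ℂ) * (Complex.exp (Complex.I * star z * y) * (-ϑ - H y)) =
      -(Complex.exp (Complex.I * (-star z) * x) * G x) := by
    intro x
    rw [hH, setIntegral_translate_mul_exp_primitive hm hn h.support, hab', sub_self]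
    simp only [zero_mul, zero_sub, neg_neg]
    rw [intervalIntegral.integral_neg, mul_neg]
  have hv2 : ∀ x, ∫ y in Set.Iio t, (k (x + y) : ℂ) * (Complex.exp (Complex.I * (-star z) * y) * G y) =
      Complex.exp (Complex.I * star z * x) * ((∫ ρ in (-t)..x,
        (k (ρ + t) * Complex.exp (Complex.I * (-star z) * ((ρ + t : ℝ) : ℂ)))) + H x) := by
    intro x
    have := setIntegral_translate_mul_exp_primitive hm hn h.support a b (-star z) 0 x
    simp only [neg_neg] at this
    rw [hab] at this
    simp only [zero_sub, mul_neg, integral_neg, neg_mul, one_mul] at this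
    simp only [neg_mul, mul_neg] at hG hH ⊢
    rw [intervalIntegral.integral_sub (Continuous.intervalIntegrable (by fun_prop) _ _)
      (Continuous.intervalIntegrable (by fun_prop) _ _), intervalIntegral.integral_neg] at this
    rw [hG, hH]
    linear_combination -this
  have hmem : evalL2 t z + hfm.toLp _ + hankelOp k (hfm'.toLp _) ∈ spaceV k t := by
    refine h.mem_spaceV_iff.2 ⟨?_, ?_⟩
    · show ∀ᵐ x : ℝ, x < t → _
      filter_upwards [Lp.coeFn_add (evalL2 t z + hfm.toLp _) (hankelOp k (hfm'.toLp _)),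
        Lp.coeFn_add (evalL2 t z) (hfm.toLp _), evalL2_coeFn t hz0, hfm.coeFn_toLp, hfT'] with
        x e1 e2 e3 e4 e5 hx
      rw [e1, Pi.add_apply, e2, Pi.add_apply, e3, e4, e5, hv1, evalFun,
        Set.indicator_of_notMem (by simpa using hx.le), Set.indicator_of_mem (show x ∈ Set.Iio t from hx)]
      ring
    · rw [map_add, map_add, h.hankelOp_hankelOp]
      show ∀ᵐ x : ℝ, x < t → _
      filter_upwards [Lp.coeFn_add (hankelOp k (evalL2 t z) + hankelOp k (hfm.toLp _)) (hfm'.toLp _),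
        Lp.coeFn_add (hankelOp k (evalL2 t z)) (hankelOp k (hfm.toLp _)), hTe, hfT, hfm'.coeFn_toLp] with
        x e1 e2 e3 e4 e5 hx
      rw [e1, Pi.add_apply, e2, Pi.add_apply, e3, e4, e5, hv2,
        (integrable_translate_mul_evalFun h.support hC hz x).2,
        Set.indicator_of_mem (show x ∈ Set.Iio t from hx)]
      ring
  rw [← h.eq_kernelV hmem hf0 hf0' rfl]
  filter_upwards [Lp.coeFn_add (evalL2 t z + hfm.toLp _) (hankelOp k (hfm'.toLp _)),
    Lp.coeFn_add (evalL2 t z) (hfm.toLp _), evalL2_coeFn t hz0, hfm.coeFn_toLp, hfT', ae_ne_real t] with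
    x e1 e2 e3 e4 e5 hne
  rw [e1, Pi.add_apply, e2, Pi.add_apply, e3, e4, e5, hv1, evalFun]
  have e6 : -(Complex.I * star z * (x : ℂ)) = Complex.I * (-star z) * x := by ring
  rcases lt_or_gt_of_ne hne with hx | hx
  · rw [Set.indicator_of_notMem (show x ∉ Set.Ioi t from not_lt.2 hx.le),
      Set.indicator_of_notMem (show x ∉ Set.Ioi t from not_lt.2 hx.le),
      Set.indicator_of_mem (show x ∈ Set.Iio t from hx)]
    ring
  · rw [Set.indicator_of_mem (show x ∈ Set.Ioi t from hx), Set.indicator_of_mem (show x ∈ Set.Ioi t from hx),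
      Set.indicator_of_notMem (by simpa using hx.le), e6]
    ring

end KernelFormula

/-! ### The Fourier transform of the projection -/

section KernelTransform

variable {k : C(ℝ, ℝ)} {c t : ℝ} {θ : ℂ → ℂ} {m n : ℝ → ℝ}

/-- The numerators of the de Branges functions attached to the resolvents, divided by `E`. -/
def outgoing (θ : ℂ → ℂ) (t ε : ℝ) (m : ℝ → ℝ) (w : ℂ) : ℂ :=
  moment t m w - ε * (θ w * moment t m (-w))

theorem HasInnerSymbol.differentiableAt_outgoing (h : HasInnerSymbol k c θ) {ε : ℝ}
    (hm : IsResolvent k t ε m) {w : ℂ} (hw : 0 < w.im) : DifferentiableAt ℂ (outgoing θ t ε m) w := by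
  have h1 := (h.isInner.analytic w hw).differentiableAt
  have h2 := differentiable_moment hm.nonneg hm.continuous
  have h3 : Differentiable ℂ fun w => moment t m (-w) := h2.comp differentiable_neg
  unfold outgoing
  exact (h2 w).sub ((h1.mul (h3 w)).const_mul _)

/-- Integration by parts produces the factor w - z̄. The exponentials then combine to e^{iwx}, so
only the tails of m and n at w remain, and these are the outgoing functions by `tail_eq`. -/
theorem HasInnerSymbol.fourierInt_kernelV (h : HasInnerSymbol k c θ) (hm : IsResolvent k t 1 m)
    (hn : IsResolvent k t (-1) n) {z w a b : ℂ} (hz : c < z.im) (hw : c < w.im)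
    (hab : (a * moment t m (star z) + b * moment t n (star z)) / 2 = 1)
    (hab' : (-a * moment t m (-star z) + b * moment t n (-star z)) / 2 =
      -fourierInt (fun x => (k x : ℂ)) (-star z)) :
    fourierInt (kernelV k t z) w * (w - star z) =
      Complex.I / 2 * (a * outgoing θ t 1 m w + b * outgoing θ t (-1) n w) := by
  obtain ⟨C, hC⟩ := h.growth
  have ht := hm.nonneg
  have hmc := hm.continuous
  have hnc := hn.continuous
  have hg := continuous_halfComb hmc hnc a b
  obtain ⟨D₁, hD₁, hb₁⟩ := hm.exists_growth h.c_pos hC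
  obtain ⟨D₂, hD₂, hb₂⟩ := hn.exists_growth h.c_pos hC
  set f : ℝ → ℂ := fun s => halfComb a b m n s * Complex.exp (Complex.I * star z * s) with hf
  have hfc : Continuous f := by fun_prop
  have hfb : ∀ x, ‖f x‖ ≤ (‖a‖ * D₁ + ‖b‖ * D₂) * Real.exp ((c + z.im) * x) := by
    intro x
    have e : Real.exp ((c + z.im) * x) = Real.exp (c * x) * Real.exp (z.im * x) := by
      rw [← Real.exp_add, add_mul]
    have h1 : ‖halfComb a b m n x‖ ≤ (‖a‖ * D₁ + ‖b‖ * D₂) * Real.exp (c * x) := by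
      have h2 : ‖a * m x + b * n x‖ ≤ ‖a‖ * (D₁ * Real.exp (c * x)) + ‖b‖ * (D₂ * Real.exp (c * x)) := by
        refine (norm_add_le _ _).trans (add_le_add ?_ ?_)
        · rw [norm_mul, Complex.norm_real]
          exact mul_le_mul_of_nonneg_left (hb₁ x) (norm_nonneg _)
        · rw [norm_mul, Complex.norm_real]
          exact mul_le_mul_of_nonneg_left (hb₂ x) (norm_nonneg _)
      rw [halfComb, norm_div, Complex.norm_ofNat]
      have h3 := norm_nonneg (a * m x + b * n x)
      linarith
    rw [hf, e, ← mul_assoc]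
    simp only
    rw [norm_mul, norm_exp_I_mul]
    have e2 : -(star z).im * x = z.im * x := by simp
    rw [e2]
    exact mul_le_mul_of_nonneg_right h1 (Real.exp_pos _).le
  have hint : ∀ y, ∫ s in (-t)..y, f s = (∫ s in (-t)..t, f s) + ∫ s in t..y, f s := fun y =>
    (intervalIntegral.integral_add_adjacent_intervals (hfc.intervalIntegrable _ _)
      (hfc.intervalIntegrable _ _)).symm
  have hA : ∫ s in (-t)..t, f s = 1 - (a + b) / 2 * Complex.exp (Complex.I * star z * t) := by
    rw [hf, integral_halfComb_mul_exp hmc hnc, hab]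
  have hF : fourierInt (kernelV k t z) w = ∫ x in Set.Ioi t,
      ((a + b) / 2 * Complex.exp (Complex.I * star z * t) - ∫ s in t..x, f s) *
        Complex.exp (Complex.I * (w - star z) * x) := by
    rw [fourierInt_congr (h.kernelV_ae_eq hm hn hz hab hab'), fourierInt,
      ← integral_indicator measurableSet_Ioi]
    refine integral_congr_ae (ae_of_all _ fun x => ?_)
    by_cases hx : x ∈ Set.Ioi t
    · simp only [Set.indicator_of_mem hx]
      rw [hint, hA]
      have e3 : Complex.exp (Complex.I * (w - star z) * x) =
          Complex.exp (Complex.I * (-star z) * x) * Complex.exp (Complex.I * w * x) := by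
        rw [← Complex.exp_add]
        congr 1
        ring
      rw [e3]
      ring
    · simp only [Set.indicator_of_notMem hx, zero_mul]
  have hparts := integral_Ioi_primitive_mul_exp hfc (γ := c + z.im) (by linarith [h.c_pos]) ht hfb
    ((a + b) / 2 * Complex.exp (Complex.I * star z * t)) (b := Complex.I * (w - star z))
    (by simp; linarith)
  rw [← hF] at hparts
  obtain ⟨i1, -⟩ := hm.fourierInt_eq h.support hC hw
  obtain ⟨i2, -⟩ := hn.fourierInt_eq h.support hC hw
  have e4 : ∀ x : ℝ, f x * Complex.exp (Complex.I * (w - star z) * x) =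
      a / 2 * ((m x : ℂ) * Complex.exp (Complex.I * w * x)) +
      b / 2 * ((n x : ℂ) * Complex.exp (Complex.I * w * x)) := by
    intro x
    have e5 : Complex.exp (Complex.I * w * x) =
        Complex.exp (Complex.I * star z * x) * Complex.exp (Complex.I * (w - star z) * x) := by
      rw [← Complex.exp_add]
      congr 1
      ring
    rw [e5, hf]
    simp only [halfComb]
    ring
  have e6 : Complex.exp (Complex.I * star z * t) * Complex.exp (Complex.I * (w - star z) * t) =
      Complex.exp (Complex.I * w * t) := by
    rw [← Complex.exp_add]
    congr 1
    ring
  simp_rw [e4] at hparts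
  rw [integral_add (i1.integrableOn.const_mul _) (i2.integrableOn.const_mul _), integral_const_mul,
    integral_const_mul, mul_assoc _ _ (Complex.exp _), e6] at hparts
  have t1 := hm.tail_eq h.support hC hw
  have t2 := hn.tail_eq h.support hC hw
  rw [outgoing, outgoing, h.fourier w hw, ← t1, ← t2]
  linear_combination Complex.I * hparts +
    fourierInt (kernelV k t z) w * (w - star z) * Complex.I_sq

/-- The quadratic identity at z̄ says that a = conj(outgoing of n at z) and b = conj(outgoing of m
at z) solve both linear conditions on the projection. This gives the formula for Im z, Im w > c, and
both sides continue analytically in w. -/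
theorem HasInnerSymbol.reproKernel_mul (h : HasInnerSymbol k c θ) (hm : IsResolvent k t 1 m)
    (hn : IsResolvent k t (-1) n) {z w : ℂ} (hz : 0 < z.im) (hw : 0 < w.im) :
    reproKernel k t z w * (w - star z) = Complex.I / (4 * Real.pi) *
      (star (outgoing θ t (-1) n z) * outgoing θ t 1 m w +
        star (outgoing θ t 1 m z) * outgoing θ t (-1) n w) := by
  obtain ⟨C, hC⟩ := h.growth
  have hpi : (Real.pi : ℂ) ≠ 0 := by exact_mod_cast Real.pi_ne_zero
  have hstep : ∀ z : ℂ, 0 < z.im → (∀ w : ℂ, c < w.im →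
      reproKernel k t z w * (w - star z) = Complex.I / (4 * Real.pi) *
      (star (outgoing θ t (-1) n z) * outgoing θ t 1 m w +
        star (outgoing θ t 1 m z) * outgoing θ t (-1) n w)) → ∀ w : ℂ, 0 < w.im →
      reproKernel k t z w * (w - star z) = Complex.I / (4 * Real.pi) *
      (star (outgoing θ t (-1) n z) * outgoing θ t 1 m w +
        star (outgoing θ t 1 m z) * outgoing θ t (-1) n w) := by
    intro z _ hzw w hw
    refine eqOn_upperHalfPlane (f := fun w => reproKernel k t z w * (w - star z))
      (g := fun w => Complex.I / (4 * Real.pi) *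
      (star (outgoing θ t (-1) n z) * outgoing θ t 1 m w +
        star (outgoing θ t 1 m z) * outgoing θ t (-1) n w)) h.c_pos (fun w hw => ?_) (fun w hw => ?_) hzw hw
    · exact (h.differentiableAt_reproKernel hw).mul (by fun_prop)
    · exact (((h.differentiableAt_outgoing hm hw).const_mul _).add
        ((h.differentiableAt_outgoing hn hw).const_mul _)).const_mul _
  have hfar : ∀ z : ℂ, c < z.im → ∀ w : ℂ, 0 < w.im →
      reproKernel k t z w * (w - star z) = Complex.I / (4 * Real.pi) *
      (star (outgoing θ t (-1) n z) * outgoing θ t 1 m w +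
        star (outgoing θ t 1 m z) * outgoing θ t (-1) n w) := by
    intro z hz
    refine hstep z (h.c_pos.trans hz) fun w hw => ?_
    have hN := hm.moment_mul_add hn h.support h.c_pos hC (star z)
    have s1 : star (outgoing θ t (-1) n z) = moment t n (-star z) +
        fourierInt (fun x => (k x : ℂ)) (-star z) * moment t n (star z) := by
      rw [outgoing, star_sub, star_mul', star_mul', star_moment, star_moment, h.fourier z hz,
        star_fourierInt_ofReal]
      simp
    have s2 : star (outgoing θ t 1 m z) = moment t m (-star z) -
        fourierInt (fun x => (k x : ℂ)) (-star z) * moment t m (star z) := by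
      rw [outgoing, star_sub, star_mul', star_mul', star_moment, star_moment, h.fourier z hz,
        star_fourierInt_ofReal]
      simp
    have key := h.fourierInt_kernelV hm hn hz hw (a := star (outgoing θ t (-1) n z))
      (b := star (outgoing θ t 1 m z))
      (by rw [s1, s2]; linear_combination hN / 2)
      (by rw [s1, s2]; linear_combination (-fourierInt (fun x => (k x : ℂ)) (-star z) / 2) * hN)
    rw [reproKernel, mul_assoc, key]
    field_simp
    ring
  -- The kernel is antianalytic in z, so the extension in z interchanges the variables by Hermitian
  -- symmetry and conjugates the case already proved.
  refine hstep z hz (fun w hw => ?_) w hw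
  have h1 := congrArg star (hfar w hw z hz)
  rw [star_mul', h.star_reproKernel (h.c_pos.trans hw) hz] at h1
  simp only [star_sub, star_mul', star_add, star_div₀, Complex.star_def, Complex.conj_I,
    Complex.conj_ofReal, map_ofNat, Complex.conj_conj] at h1 ⊢
  linear_combination -h1

/-- High on the imaginary axis both outgoing functions, divided by e^{izt}, are close to one. The
diagonal kernel involves the real part of the product of one with the conjugate of the other, which
is then positive. -/
theorem HasInnerSymbol.exists_reproKernel_ne_zero (h : HasInnerSymbol k c θ) (hm : IsResolvent k t 1 m)
    (hn : IsResolvent k t (-1) n) : ∃ z : ℂ, 0 < z.im ∧ reproKernel k t z z ≠ 0 := by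
  obtain ⟨C, hC⟩ := h.growth
  obtain ⟨D₁, hD₁, h₁⟩ := hm.exists_asymptotic h.support h.c_pos hC
  obtain ⟨D₂, hD₂, h₂⟩ := hn.exists_asymptotic h.support h.c_pos hC
  set s : ℝ := 4 * (D₁ + D₂ + 1) with hs
  have hs0 : 0 < s := by positivity
  set z : ℂ := ((c + s : ℝ) : ℂ) * Complex.I with hz
  have him : z.im = c + s := by simp [hz]
  have hzc : c < z.im := by rw [him]; linarith
  have hz0 : 0 < z.im := h.c_pos.trans hzc
  refine ⟨z, hz0, fun h0 => ?_⟩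
  have hkey := h.reproKernel_mul hm hn hz0 hz0
  rw [h0, zero_mul] at hkey
  have hpi : (Real.pi : ℂ) ≠ 0 := by exact_mod_cast Real.pi_ne_zero
  have hne : Complex.I / (4 * Real.pi) ≠ 0 :=
    div_ne_zero Complex.I_ne_zero (mul_ne_zero (by norm_num) hpi)
  have hsum := (mul_eq_zero.1 hkey.symm).resolve_left hne
  set e : ℂ := Complex.exp (-(Complex.I * z * t)) with he
  have hre : ∀ {p D : ℝ} {u : ℂ}, ‖u - 1‖ ≤ D / p → 0 < p → 4 * D < p → 3 / 4 < u.re ∧ |u.im| < 1 / 4 := by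
    intro p D u hu hp hD
    have h4 : D / p < 1 / 4 := by
      rw [div_lt_iff₀ hp]
      linarith
    have a1 := (Complex.abs_re_le_norm (u - 1)).trans_lt (hu.trans_lt h4)
    have a2 := (Complex.abs_im_le_norm (u - 1)).trans_lt (hu.trans_lt h4)
    simp only [Complex.sub_re, Complex.sub_im, Complex.one_re, Complex.one_im, sub_zero] at a1 a2
    exact ⟨by linarith [(abs_lt.1 a1).1], a2⟩
  have e1 : z.im - c = s := by rw [him]; ring
  have u1 := (h₁ z hzc).1
  have u2 := (h₂ z hzc).1
  rw [← h.fourier z hzc, e1] at u1 u2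
  obtain ⟨r1, i1⟩ := hre u1 hs0 (by rw [hs]; linarith)
  obtain ⟨r2, i2⟩ := hre u2 hs0 (by rw [hs]; linarith)
  have hsum' : (star (outgoing θ t (-1) n z * e) * (outgoing θ t 1 m z * e)).re = 0 := by
    have h5 : star (outgoing θ t (-1) n z * e) * (outgoing θ t 1 m z * e) +
        star (outgoing θ t 1 m z * e) * (outgoing θ t (-1) n z * e) = 0 := by
      rw [star_mul', star_mul']
      linear_combination star e * e * hsum
    have h6 := congrArg Complex.re h5
    simp only [Complex.add_re, Complex.mul_re, Complex.star_def, Complex.conj_re, Complex.conj_im,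
      Complex.zero_re] at h6 ⊢
    linarith
  rw [outgoing, outgoing] at hsum'
  rw [Complex.mul_re, Complex.star_def, Complex.conj_re, Complex.conj_im] at hsum'
  have i3 := abs_lt.1 i1
  have i4 := abs_lt.1 i2
  have := mul_lt_mul'' r1 r2 (by norm_num) (by norm_num)
  have i5 : |(((moment t n z - (-1 : ℝ) * (θ z * moment t n (-z))) * e).im *
      ((moment t m z - (1 : ℝ) * (θ z * moment t m (-z))) * e).im)| ≤ 1 / 4 * (1 / 4) := by
    rw [abs_mul]
    exact mul_le_mul i2.le i1.le (abs_nonneg _) (by norm_num)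
  have i6 := abs_le.1 i5
  nlinarith

end KernelTransform

/-! ### The kernel through A and B, and the theorem -/

/-- The reproducing kernel of `F(V_t)` in terms of the solutions `A(t,·)` and `B(t,·)`. -/
theorem reproKernel_eq {E : ℂ → ℂ} {c t : ℝ} {Z : Set ℂ} {k : C(ℝ, ℝ)} {θ : ℂ → ℂ} {m n : ℝ → ℝ}
    (h1 : CondK1 E c Z) (h2 : CondK2 E c k) (h : HasInnerSymbol k c θ)
    (hθ : ∀ z : ℂ, 0 < z.im → z ∉ Z → E z * θ z = E (-z)) (hm : IsResolvent k t 1 m)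
    (hn : IsResolvent k t (-1) n) (he1 : ¬ TruncHasEigenvalue k t 1)
    (he2 : ¬ TruncHasEigenvalue k t (-1)) {z w : ℂ} (hz : 0 < z.im) (hw : 0 < w.im) (hzZ : z ∉ Z)
    (hwZ : w ∉ Z) (hEz : E z ≠ 0) (hEw : E w ≠ 0) :
    reproKernel k t z w = 1 / (star (E z) * E w) *
      ((star (solA E c Z k t z) * solB E c Z k t w - solA E c Z k t w * star (solB E c Z k t z)) /
        ((Real.pi : ℂ) * (w - star z))) := by
  obtain ⟨C, hC⟩ := h.growth
  have hmass := hm.mass_mul_mass hn h.support h.c_pos hC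
  -- The mass of n normalises Φ and that of m normalises Ψ, because their product is one; for the
  -- same reason both constants disappear from the products of A and B.
  set a : ℝ := 1 + ∫ s in (-t)..t, n s with ha
  set b : ℝ := 1 + ∫ s in (-t)..t, m s with hb
  have hab : (a : ℂ) * b = 1 := by exact_mod_cast hmass
  have hA : ∀ {z : ℂ}, 0 < z.im → z ∉ Z →
      solA E c Z k t z = E z * (b / 2 * outgoing θ t (-1) n z) := by
    intro z hz hzZ
    rw [solA_eq h1 h2 h.support hn he1 (a := b) (by rw [mul_comm]; exact hmass) hzZ, ← hθ z hz hzZ, outgoing]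
    push_cast
    ring
  have hB : ∀ {z : ℂ}, 0 < z.im → z ∉ Z →
      solB E c Z k t z = E z * (Complex.I * a / 2 * outgoing θ t 1 m z) := by
    intro z hz hzZ
    rw [solB_eq h1 h2 h.support hm he2 (a := a) hmass hzZ, ← hθ z hz hzZ, outgoing]
    push_cast
    ring
  have hwz : w - star z ≠ 0 := by
    intro h0
    have := congrArg Complex.im h0
    simp at this
    linarith
  have hpi : (Real.pi : ℂ) ≠ 0 := by exact_mod_cast Real.pi_ne_zero
  have hEz' : star (E z) ≠ 0 := star_ne_zero.2 hEz
  have key := h.reproKernel_mul hm hn hz hw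
  rw [hA hz hzZ, hA hw hwZ, hB hz hzZ, hB hw hwZ]
  have e1 : star (E z * (b / 2 * outgoing θ t (-1) n z)) * (E w * (Complex.I * a / 2 * outgoing θ t 1 m w)) -
      E w * (b / 2 * outgoing θ t (-1) n w) * star (E z * (Complex.I * a / 2 * outgoing θ t 1 m z)) =
      star (E z) * E w * (Real.pi * (reproKernel k t z w * (w - star z))) := by
    rw [key]
    simp only [star_mul', star_div₀, Complex.star_def, Complex.conj_I, Complex.conj_ofReal, map_ofNat]
    field_simp
    linear_combination (4 * (starRingEnd ℂ) (E z) * ((starRingEnd ℂ) (outgoing θ t (-1) n z) *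
      outgoing θ t 1 m w + (starRingEnd ℂ) (outgoing θ t 1 m z) * outgoing θ t (-1) n w)) * hab
  rw [e1]
  field_simp

end CanonicalSystem

end

theorem theorem1p5 (E : ℂ → ℂ) (c : ℝ) (Z : Set ℂ) (K : ℝ → ℝ) (τ : EReal)
    (h1 : CanonicalSystem.CondK1 E c Z) (h2 : CanonicalSystem.CondK2 E c K)
    (h3 : CanonicalSystem.CondK3 K) (h4 : CanonicalSystem.CondK4 K)
    (h5 : CanonicalSystem.CondK5 K τ) :
    (CanonicalSystem.ThetaIsInner E Z →
      ∃ j : ℝ → ℂ → ℂ → ℂ, ∀ t : ℝ, 0 ≤ t → (t : EReal) < τ →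
        CanonicalSystem.IsReproducingKernel (CanonicalSystem.fourierV K t) (j t) ∧
        (∀ z w : ℂ, 0 < z.im → 0 < w.im → z ∉ Z → w ∉ Z → E z ≠ 0 → E w ≠ 0 →
          j t z w = 1 / (star (E z) * E w) *
            ((star (CanonicalSystem.solA E c Z K t z) * CanonicalSystem.solB E c Z K t w
              - CanonicalSystem.solA E c Z K t w * star (CanonicalSystem.solB E c Z K t z)) /
              ((Real.pi : ℂ) * (w - star z)))) ∧
        ∃ z : ℂ, 0 < z.im ∧ j t z z ≠ 0) ∧
    (τ = ⊤ →
      CanonicalSystem.ThetaIsInner E Z ∧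
      ∃ j : ℝ → ℂ → ℂ → ℂ,
        (∀ t : ℝ, 0 ≤ t →
          CanonicalSystem.IsReproducingKernel (CanonicalSystem.fourierV K t) (j t)) ∧
        ∀ z w : ℂ, 0 < z.im → 0 < w.im → Tendsto (fun t => j t z w) atTop (𝓝 0)) := by
  set k : C(ℝ, ℝ) := ⟨K, h2.continuous⟩
  have h2' : CanonicalSystem.CondK2 E c k := h2
  have h3' : CanonicalSystem.CondK3 k := h3
  refine ⟨fun hθ => ?_, fun hτ => ?_⟩
  · obtain ⟨θ, h, hE⟩ := CanonicalSystem.hasInnerSymbol_of_thetaIsInner h1 h2' h3' hθ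
    refine ⟨CanonicalSystem.reproKernel k, fun t ht htτ => ⟨h.isReproducingKernel ht, ?_⟩⟩
    obtain ⟨he1, he2⟩ : ¬ CanonicalSystem.TruncHasEigenvalue k t 1 ∧
        ¬ CanonicalSystem.TruncHasEigenvalue k t (-1) := h5.not_eigenvalue t ht htτ
    obtain ⟨m, hm⟩ := CanonicalSystem.exists_isResolvent h3' ht (one_mul 1) (by simpa using he1)
    obtain ⟨n, hn⟩ := CanonicalSystem.exists_isResolvent (ε := -1) h3' ht (by norm_num)
      (by simpa using he2)
    exact ⟨fun z w hz hw hzZ hwZ hEz hEw =>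
      CanonicalSystem.reproKernel_eq h1 h2' h hE hm hn he1 he2 hz hw hzZ hwZ hEz hEw,
      h.exists_reproKernel_ne_zero hm hn⟩
  · have hθ : CanonicalSystem.ThetaIsInner E Z :=
      CanonicalSystem.thetaIsInner_of_not_eigenvalue h1 h2' h3' fun t ht =>
        h5.not_eigenvalue t ht (hτ ▸ EReal.coe_lt_top t)
    obtain ⟨θ, h, -⟩ := CanonicalSystem.hasInnerSymbol_of_thetaIsInner h1 h2' h3' hθ
    exact ⟨hθ, CanonicalSystem.reproKernel k, fun t ht => h.isReproducingKernel ht,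
      fun z w hz hw => h.tendsto_reproKernel hz hw⟩
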